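/- **Setting.** Let $\{f(\cdot;\theta):\theta\in\Theta\}$ be a parametric family of probability densities of non-negative lifetimes, with distribution functions $F(\cdot;\theta)$, where $\Theta\subset\mathbb R^d$ is compact and convex, and let the true parameter $\theta_0$ be an interior point of $\Theta$. A record is $x=(t,C,t_l)$: for an individual with failure time $T\sim f(\cdot;\theta_0)$, independent of the pair of its censoring time $c$ ($c=\infty$ allowed) and its truncation time $t_l$, with $0\le t_l\le c$ almost surely, and conditionally on $T>t_l$, one records $t=\min(T,c)$, $C=\mathbf 1\{T>c\}$ and $t_l$. Let $x_1,x_2,\dots$ be i.i.d. records, $\mathcal D_n=(x_1,\dots,x_n)$, let $\mathbb E$ be the expectation over a record $x$, and let $$l(x,\theta)=(1-C)\log f(t;\theta)+C\log\{1-F(t;\theta)\}-\log\{1-F(t_l;\theta)\},\qquad l_i(\theta)=l(x_i,\theta).$$ Almost surely the likelihood contribution of $x$ is positive for all $\theta\in\Theta$ and $l(x,\cdot)$ is twice continuously differentiable in a neighbourhood of each point of $\Theta$, with gradient $\dot l$ and Hessian $\ddot l=(\ddot l_{(jk)})$. For a vector $v$ write $v^2=vv^\top$. Let $\hat\theta=\hat\theta_n\in\Theta$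 maximize $l_f(\theta)=\frac1n\sum_{i=1}^n l_i(\theta)$ over $\Theta$. Let $\pi_{1},\dots,\pi_{n}>0$ be subsampling probabilities with $\sum_{i=1}^n\pi_i=1$ (depending on $n$ and possibly on $\mathcal D_n$). Given $\mathcal D_n$, draw $r=r_n$ records $x_1^*,\dots,x_r^*$ independently with replacement, each equal to $x_i$ with probability $\pi_i$, and let $\pi_j^*$ be the probability of the $j$-th drawn record. Let the measurable $\tilde\theta_g\in\Theta$ maximize $\frac1r\sum_{j=1}^r\frac1{\pi_j^*}l(x_j^*,\theta)$ over $\Theta$. Let $n\to\infty$, $r_n\to\infty$ and $r_n/n\to\gamma\in[0,\infty)$. **Assumptions.** 1. With probability tending to one $\hat\theta$ is the unique maximizer of $l_f$ over $\Theta$; for all $\theta\in\Theta$, $\mathbb E|l(x,\theta)|<\infty$ and $\mathbb E\{l(x,\theta)^2\}<\infty$. 2. For all $\theta\in\Theta$, $-\mathbb E\{\ddot l(x,\theta)\}$ is positive definite and $\mathbb E\{\ddot l_{(jk)}(x,\theta)^2\}<\infty$ for all $j,k$; there is $\psi$ with $\mathbb E\{\psi(x)^2\}<\infty$ such that almost surely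 $|\ddot l_{(jk)}(x,\theta_1)-\ddot l_{(jk)}(x,\theta_2)|\le\psi(x)\|\theta_1-\theta_2\|$ for all $\theta_1,\theta_2\in\Theta$ and all $j,k$. 3. For all $\theta\in\Theta$, $\Lambda(\theta)=\mathbb E\{\dot l(x,\theta)^2\}$ exists (that is, $\mathbb E\|\dot l(x,\theta)\|^2<\infty$) and is positive definite; there is $\delta>0$ such that for each $\theta\in\Theta$, $\mathbf 1\{\|\theta-\hat\theta\|<\delta\}\,\frac1n\sum_{i=1}^n\|\dot l_i(\theta)\|^4=O_p(1)$. 4. $\max_{1\le i\le n}(n\pi_i)^{-1}=O_p(1)$. 5. $\Lambda_g(\theta_0)=\frac1{n^2}\sum_{i=1}^n\frac1{\pi_i}\dot l_i(\theta_0)^2$ converges in probability to a constant matrix $\Lambda_{1g}$. **Conclusion.** Let $M_{0g}=\mathbb E\{\ddot l(x,\theta_0)\}$ and $V_{0g}=M_{0g}^{-1}\{\Lambda_{1g}+\gamma\Lambda(\theta_0)\}M_{0g}^{-1}$. Then $V_{0g}$ is positive definite, and unconditionally $$\sqrt r\,V_{0g}^{-1/2}(\tilde\theta_g-\theta_0)\xrightarrow{d}N(0,I).$$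 -/

import Mathlib

open MeasureTheory ProbabilityTheory Filter Topology
open scoped Matrix ENNReal

noncomputable section

namespace CensoredSubsampling

/-- The parameter space `ℝ^d` with its Euclidean norm. -/
abbrev Param (d : ℕ) := EuclideanSpace ℝ (Fin d)

/-- One record `(t, C, t_l)`: the observed failure or right-censoring time `t`, the censoring
indicator `C` (`true` means censored), and the left-truncation time `t_l`. -/
abbrev Obs := ℝ × Bool × ℝ

variable {d : ℕ}

/-! ### The lifetime model and the log-likelihood -/

/-- `g` is the probability density function of a non-negative lifetime. -/
structure IsLifetimeDensity (g : ℝ → ℝ) : Prop where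
  measurable : Measurable g
  nonneg : ∀ t, 0 ≤ g t
  eq_zero_of_neg : ∀ t, t < 0 → g t = 0
  integral_eq_one : ∫ t, g t = 1

/-- The cumulative distribution function `F(t; θ)` of the density `f(·; θ)`. -/
def lifetimeCDF (f : Param d → ℝ → ℝ) (θ : Param d) (t : ℝ) : ℝ :=
  ∫ s in Set.Iic t, f θ s

/-- The likelihood contribution of one record:
`f(t; θ) / (1 - F(t_l; θ))` if it is uncensored, `(1 - F(t; θ)) / (1 - F(t_l; θ))` otherwise. -/
def likelihood (f : Param d → ℝ → ℝ) (x : Obs) (θ : Param d) : ℝ :=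
  (if x.2.1 then 1 - lifetimeCDF f θ x.1 else f θ x.1) / (1 - lifetimeCDF f θ x.2.2)

/-- The log-likelihood contribution `l(x, θ)` of one record:
`(1 - C) log f(t; θ) + C log (1 - F(t; θ)) - log (1 - F(t_l; θ))`. -/
def logLik (f : Param d → ℝ → ℝ) (x : Obs) (θ : Param d) : ℝ :=
  (if x.2.1 then Real.log (1 - lifetimeCDF f θ x.1) else Real.log (f θ x.1))
    - Real.log (1 - lifetimeCDF f θ x.2.2)

/-- The score: the gradient of `l(x, ·)` at `θ`. -/
def score (f : Param d → ℝ → ℝ) (x : Obs) (θ : Param d) : Param d :=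
  gradient (logLik f x) θ

/-- The Hessian matrix of `l(x, ·)` at `θ`. -/
def hess (f : Param d → ℝ → ℝ) (x : Obs) (θ : Param d) : Matrix (Fin d) (Fin d) ℝ :=
  Matrix.of fun j k =>
    iteratedFDeriv ℝ 2 (logLik f x) θ ![EuclideanSpace.single j 1, EuclideanSpace.single k 1]

/-- The square of the score, i.e. the matrix (score)(score)ᵀ. -/
def scoreSq (f : Param d → ℝ → ℝ) (x : Obs) (θ : Param d) : Matrix (Fin d) (Fin d) ℝ :=
  Matrix.of fun j k => score f x θ j * score f x θ k

/-! ### The law of a record: random right-censoring and left-truncation -/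

/-- The law with density `f(·; θ)`. -/
def lifetimeLaw (f : Param d → ℝ → ℝ) (θ : Param d) : Measure ℝ :=
  volume.withDensity fun t => ENNReal.ofReal (f θ t)

/-- What is recorded of an individual with latent `(T, (c, t_l))`: failure time `T`, censoring
time `c` (`⊤` if there is no censoring) and truncation time `t_l`. -/
def observe (w : ℝ × EReal × ℝ) : Obs :=
  if (w.1 : EReal) ≤ w.2.1 then (w.1, false, w.2.2) else (w.2.1.toReal, true, w.2.2)

theorem measurable_observe : Measurable observe := by
  unfold observe
  refine Measurable.ite ?_ ?_ ?_
  · exact measurableSet_le (by fun_prop) (by fun_prop)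
  · fun_prop
  · fun_prop

/-- The law of a record `x`. The failure time `T` has density `f(·; θ)` and is independent of the
pair (censoring time, truncation time), which has law `G`; the individual enters the data only if
it has not failed before its truncation time, so we condition on `t_l < T`. -/
def obsLaw (f : Param d → ℝ → ℝ) (θ : Param d) (G : Measure (EReal × ℝ)) : Measure Obs :=
  (((lifetimeLaw f θ).prod G)[|{w : ℝ × EReal × ℝ | w.2.2 < w.1}]).map observe

/-! ### Full-data and subsample objective functions -/

/-- The full-data log-likelihood `l_f(θ) = (1/n) ∑_{i<n} l(x_i, θ)`. -/
def fullLogLik (f : Param d → ℝ → ℝ) (n : ℕ) (x : ℕ → Obs) (θ : Param d) : ℝ :=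
  (1 / (n : ℝ)) * ∑ i ∈ Finset.range n, logLik f (x i) θ

/-- The weighted pseudo log-likelihood `l_g^*(θ) = (1/r) ∑_{j<r} l(x_j^*, θ) / π_j^*` of the
subsample that consists of the records with indices `a 0, …, a (r-1)`. -/
def subLogLik (f : Param d → ℝ → ℝ) (r : ℕ) (π : ℕ → ℝ) (a : ℕ → ℕ) (x : ℕ → Obs)
    (θ : Param d) : ℝ :=
  (1 / (r : ℝ)) * ∑ j ∈ Finset.range r, (1 / π (a j)) * logLik f (x (a j)) θ

/-- `Λ_g(θ) = (1/n²) ∑_{i<n} (1/π_i) (score)(score)ᵀ`. -/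
def LambdaG (f : Param d → ℝ → ℝ) (n : ℕ) (π : ℕ → ℝ) (x : ℕ → Obs) (θ : Param d) :
    Matrix (Fin d) (Fin d) ℝ :=
  (1 / (n : ℝ) ^ 2) • ∑ i ∈ Finset.range n, (1 / π i) • scoreSq f (x i) θ

/-- The expected Hessian `E{l̈(x, θ)}`, entry by entry, for `x` with law `Q`. -/
def meanHess (f : Param d → ℝ → ℝ) (Q : Measure Obs) (θ : Param d) :
    Matrix (Fin d) (Fin d) ℝ :=
  Matrix.of fun j k => ∫ x, hess f x θ j k ∂Q

/-- `Λ(θ)`, the expectation of (score)(score)ᵀ, entry by entry, for `x` with law `Q`. -/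
def Lambda (f : Param d → ℝ → ℝ) (Q : Measure Obs) (θ : Param d) :
    Matrix (Fin d) (Fin d) ℝ :=
  Matrix.of fun j k => ∫ x, scoreSq f x θ j k ∂Q

/-- The matrix `V_{0g} = M⁻¹ (Λ₁ + γ Λ(θ₀)) M⁻¹` with `M = E{l̈(x, θ₀)}`. -/
def V0 (f : Param d → ℝ → ℝ) (Q : Measure Obs) (θ₀ : Param d)
    (Λ₁ : Matrix (Fin d) (Fin d) ℝ) (γ : ℝ) : Matrix (Fin d) (Fin d) ℝ :=
  (meanHess f Q θ₀)⁻¹ * (Λ₁ + γ • Lambda f Q θ₀) * (meanHess f Q θ₀)⁻¹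

/-- `V^{-1/2}` for a positive definite matrix `V`, by the functional calculus. -/
def invSqrt (V : Matrix (Fin d) (Fin d) ℝ) : Matrix (Fin d) (Fin d) ℝ :=
  cfc (fun t : ℝ => (Real.sqrt t)⁻¹) V

/-! ### Probabilistic notions -/

/-- `X_n = O_p(1)`. -/
def BoundedInProb {Ω : Type*} [MeasurableSpace Ω] (P : Measure Ω) (X : ℕ → Ω → ℝ) : Prop :=
  ∀ ε : ℝ, 0 < ε → ∃ K : ℝ, ∀ᶠ n in atTop, P {ω | K < |X n ω|} ≤ ENNReal.ofReal ε

/-- The σ-algebra generated by the full data `D_n = (x_0, …, x_{n-1})`. -/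
abbrev dataSigma {Ω : Type*} (x : ℕ → Ω → Obs) (n : ℕ) : MeasurableSpace Ω :=
  MeasurableSpace.comap (fun ω (i : Fin n) => x i ω) inferInstance

/-- General subsampling of size `r n` from `D_n` with replacement: the probabilities
`π n 0, …, π n (n-1)` are positive, add up to one and may depend on `D_n`; conditionally on `D_n`
the selected indices `a n 0, …, a n (r n - 1)` are independent, each equal to `i` with
probability `π n i`. -/
structure IsGeneralSubsampling {Ω : Type*} [MeasurableSpace Ω] (P : Measure Ω)
    (x : ℕ → Ω → Obs) (r : ℕ → ℕ) (π : ℕ → ℕ → Ω → ℝ) (a : ℕ → ℕ → Ω → ℕ) : Prop where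
  measurable_prob : ∀ n i, i < n → Measurable[dataSigma x n] (π n i)
  prob_pos : ∀ n i ω, i < n → 0 < π n i ω
  sum_prob : ∀ n ω, 1 ≤ n → ∑ i ∈ Finset.range n, π n i ω = 1
  measurable_index : ∀ n j, Measurable (a n j)
  condProb_index : ∀ n, 1 ≤ n → ∀ s : Fin (r n) → Fin n,
    P⟦{ω | ∀ j : Fin (r n), a n j ω = s j}|dataSigma x n⟧
      =ᵐ[P] fun ω => ∏ j : Fin (r n), π n (s j) ω

/-! ### Regularity conditions -/

/-- The set-up: a parametric family of lifetime densities on a compact convex parameter set that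
has the true parameter in its interior; the truncation time is non-negative and not larger than
the censoring time; and almost surely the likelihood contribution of a record is positive on `Θ`
and its logarithm twice continuously differentiable around every point of `Θ`. -/
structure IsRegularModel (f : Param d → ℝ → ℝ) (Θ : Set (Param d)) (θ₀ : Param d)
    (G : Measure (EReal × ℝ)) : Prop where
  density : ∀ θ ∈ Θ, IsLifetimeDensity (f θ)
  isCompact : IsCompact Θ
  convex : Convex ℝ Θ
  mem_interior : θ₀ ∈ interior Θ
  trunc_le_cens : ∀ᵐ w ∂G, 0 ≤ w.2 ∧ (w.2 : EReal) ≤ w.1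
  likelihood_pos : ∀ᵐ x ∂(obsLaw f θ₀ G), ∀ θ ∈ Θ, 0 < likelihood f x θ
  contDiffAt : ∀ᵐ x ∂(obsLaw f θ₀ G), ∀ θ ∈ Θ, ContDiffAt ℝ 2 (logLik f x) θ

/-- The log-likelihood has first and second moments at every `θ ∈ Θ`. -/
structure LogLikMoments (f : Param d → ℝ → ℝ) (Θ : Set (Param d)) (Q : Measure Obs) : Prop where
  integrable : ∀ θ ∈ Θ, Integrable (fun x => logLik f x θ) Q
  memLp_two : ∀ θ ∈ Θ, MemLp (fun x => logLik f x θ) 2 Q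

/-- `θhat n` maximizes the full-data log-likelihood over `Θ`, and with probability tending to one
it is the only maximizer. -/
structure IsUniqueMLE {Ω : Type*} [MeasurableSpace Ω] (P : Measure Ω) (f : Param d → ℝ → ℝ)
    (Θ : Set (Param d)) (x : ℕ → Ω → Obs) (θhat : ℕ → Ω → Param d) : Prop where
  isMax : ∀ n, 1 ≤ n → ∀ᵐ ω ∂P,
    θhat n ω ∈ Θ ∧ IsMaxOn (fullLogLik f n fun i => x i ω) Θ (θhat n ω)
  unique : Tendsto (fun n => P {ω | ∃ θ ∈ Θ, θ ≠ θhat n ω ∧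
    IsMaxOn (fullLogLik f n fun i => x i ω) Θ θ}) atTop (𝓝 0)

/-- Conditions on the Hessian of the log-likelihood: `-E{l̈(x, θ)}` is positive definite, the
entries have second moments, and they are Lipschitz in `θ` with a square-integrable constant. -/
structure HessianConditions (f : Param d → ℝ → ℝ) (Θ : Set (Param d)) (Q : Measure Obs) :
    Prop where
  posDef : ∀ θ ∈ Θ, (-(meanHess f Q θ)).PosDef
  memLp_two : ∀ θ ∈ Θ, ∀ j k, MemLp (fun x => hess f x θ j k) 2 Q
  lipschitz : ∃ ψ : Obs → ℝ, MemLp ψ 2 Q ∧ ∀ᵐ x ∂Q, ∀ θ₁ ∈ Θ, ∀ θ₂ ∈ Θ, ∀ j k,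
    |hess f x θ₁ j k - hess f x θ₂ j k| ≤ ψ x * ‖θ₁ - θ₂‖

/-- Conditions on the score: `Λ(θ)` (exists and) is positive definite, and for some `δ > 0`, for
each `θ ∈ Θ`, the averages of `‖score‖⁴` at `θ` on the event `‖θ - θhat n‖ < δ` are `O_p(1)`. -/
structure ScoreConditions {Ω : Type*} [MeasurableSpace Ω] (P : Measure Ω)
    (f : Param d → ℝ → ℝ) (Θ : Set (Param d)) (Q : Measure Obs)
    (x : ℕ → Ω → Obs) (θhat : ℕ → Ω → Param d) : Prop where
  memLp_two : ∀ θ ∈ Θ, MemLp (fun x => score f x θ) 2 Q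
  posDef : ∀ θ ∈ Θ, (Lambda f Q θ).PosDef
  fourth : ∃ δ : ℝ, 0 < δ ∧ ∀ θ ∈ Θ, BoundedInProb P fun n =>
    Set.indicator {ω | ‖θ - θhat n ω‖ < δ} fun ω =>
      (1 / (n : ℝ)) * ∑ i ∈ Finset.range n, ‖score f (x i ω) θ‖ ^ 4

end CensoredSubsampling

end

set_option linter.unusedSectionVars false

/-! Write `u` for the estimation error, `M` for the expected Hessian at `θ₀`, and compare two
averages of a function `h` of a record: `fullAvg` over the data and the inverse-probability weighted
`subAvg` over the subsample. Given the data, `subAvg h` is a mean of `r` independent draws with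
conditional mean `fullAvg h`. Its conditional variance is at most `K / r` times the full average of
`h²` on the event that all weights `(n π_i)⁻¹` are at most `K`. Since the weights are `O_p(1)`, this
gives the law of large numbers `tendsto_subAvg` for every square-integrable `h`.

Consistency. A likelihood ratio of records has expectation at most one, also under censoring and
truncation, so `θ₀` maximizes the expected log-likelihood (`integral_logLik_le`). Negative definite
expected Hessians make it strictly concave along segments from `θ₀`, so the maximizer is unique
(`integral_logLik_lt`). The law of large numbers, an integrable Lipschitz envelope and compactness
then give `tendsto_estimator`.

Linearization. Once the estimator is interior, its weighted score vanishes. A Taylor expansion with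
Lipschitz Hessian turns this into `√r u = -M⁻¹ √r subAvg(score) + o_p(1)`
(`tendsto_sqrt_mul_estimator_add`).

Central limit theorem (`tendsto_integral_exp_subAvg`). The conditional characteristic function of
`√r subAvg h` is exactly the `r`-th power of that of one draw. It is close to `exp(i √r fullAvg h -
V/2)`, where `V` is the quadratic form of `Λ_g(θ₀)` and converges to a constant. Taking expectations
leaves the ordinary central limit theorem for `√r fullAvg h = √(r/n) √n fullAvg h`, whose variance
carries the factor `γ`. The two sources of noise add up to `Λ₁ + γ Λ(θ₀)`, and linear combinations
of the coordinates with Lévy's continuity theorem finish the proof.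

Positive definiteness of `Λ₁` is Cauchy–Schwarz: the quadratic form of `Λ_g(θ₀)` dominates the
square of the full average of `|h|`, whose limit is positive. -/

namespace CensoredSubsampling

/-! ### Convergence and boundedness in probability, as a filter calculus. -/

section InProbability

variable {Ω : Type*} [MeasurableSpace Ω] {P : Measure Ω}

/-- The filter of the sets of pairs `(n, ω)` that hold with probability tending to one. Convergence
in probability to a constant is convergence along this filter. -/
def probFilter (P : Measure Ω) : Filter (ℕ × Ω) where
  sets := {S | Tendsto (fun n => P {ω | (n, ω) ∉ S}) atTop (𝓝 0)}
  univ_sets := by simp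
  sets_of_superset {S T} hS hST := by
    refine tendsto_of_tendsto_of_tendsto_of_le_of_le tendsto_const_nhds hS (fun _ => zero_le)
      fun n => measure_mono fun ω hω h => hω (hST h)
  inter_sets {S T} hS hT := by
    have h := Tendsto.add hS hT
    rw [add_zero] at h
    refine tendsto_of_tendsto_of_tendsto_of_le_of_le tendsto_const_nhds h (fun _ => zero_le)
      fun n => ?_
    refine (measure_mono fun ω hω => ?_).trans (measure_union_le _ _)
    by_cases h : (n, ω) ∈ S
    · exact Or.inr fun h' => hω ⟨h, h'⟩
    · exact Or.inl h

theorem eventually_probFilter {p : ℕ × Ω → Prop} :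
    (∀ᶠ q in probFilter P, p q) ↔ Tendsto (fun n => P {ω | ¬ p (n, ω)}) atTop (𝓝 0) :=
  Iff.rfl

theorem eventually_probFilter_of_ae {p : ℕ → Ω → Prop} (h : ∀ᶠ n in atTop, ∀ᵐ ω ∂P, p n ω) :
    ∀ᶠ q in probFilter P, p q.1 q.2 := by
  rw [eventually_probFilter]
  refine tendsto_const_nhds.congr' ?_
  filter_upwards [h] with n hn
  exact (ae_iff.1 hn).symm

theorem tendsto_fst_probFilter : Tendsto Prod.fst (probFilter P) atTop := by
  intro S hS
  refine eventually_probFilter_of_ae (p := fun n _ => n ∈ S) ?_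
  filter_upwards [hS] with n hn
  exact Eventually.of_forall fun _ => hn

theorem tendstoInMeasure_const_iff {E : Type*} [PseudoMetricSpace E] {X : ℕ → Ω → E} {c : E} :
    TendstoInMeasure P X atTop (fun _ => c) ↔
      Tendsto (fun q : ℕ × Ω => X q.1 q.2) (probFilter P) (𝓝 c) := by
  rw [tendstoInMeasure_iff_dist, Metric.tendsto_nhds]
  simp only [eventually_probFilter, not_lt]

/-- Where `|X| ≤ K`, it is enough that `|Y| < ε / (|K| + 1)`; the `+ 1` keeps the divisor positive.
Only outer measures of bad sets are compared, so neither factor has to be measurable. -/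
theorem BoundedInProb.tendsto_mul {X : ℕ → Ω → ℝ} (hX : BoundedInProb P X) {Y : ℕ × Ω → ℝ}
    (hY : Tendsto Y (probFilter P) (𝓝 0)) :
    Tendsto (fun q => X q.1 q.2 * Y q) (probFilter P) (𝓝 0) := by
  rw [Metric.tendsto_nhds]
  intro ε hε
  rw [eventually_probFilter, ENNReal.tendsto_nhds_zero]
  intro η hη
  obtain ⟨η', hη', hη'η⟩ : ∃ η' : ℝ, 0 < η' ∧ ENNReal.ofReal η' + ENNReal.ofReal η' ≤ η := by
    obtain ⟨t, ht, htη⟩ := ENNReal.lt_iff_exists_nnreal_btwn.1 hη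
    refine ⟨t / 2, by simpa using ht, ?_⟩
    rw [← ENNReal.ofReal_add (by positivity) (by positivity), add_halves]
    simpa using htη.le
  obtain ⟨K, hK⟩ := hX η' hη'
  have hpos : 0 < ε / (|K| + 1) := by positivity
  have hY' := (Metric.tendsto_nhds.1 hY) _ hpos
  rw [eventually_probFilter, ENNReal.tendsto_nhds_zero] at hY'
  filter_upwards [hK, hY' (ENNReal.ofReal η') (by simpa using hη')] with n hn hn'
  refine le_trans ?_ ((add_le_add hn hn').trans hη'η)
  refine (measure_mono fun ω hω => ?_).trans (measure_union_le _ _)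
  simp only [Set.mem_union, Set.mem_ofPred_eq, dist_zero_right, Real.norm_eq_abs, not_lt,
    abs_mul] at hω ⊢
  by_contra! hcon
  have h1 : |X n ω| < |K| + 1 := by
    have := le_abs_self K
    linarith [hcon.1]
  have h2 : |X n ω| * |Y (n, ω)| < (|K| + 1) * (ε / (|K| + 1)) :=
    mul_lt_mul'' h1 hcon.2 (abs_nonneg _) (abs_nonneg _)
  rw [mul_div_cancel₀ _ (by positivity)] at h2
  linarith

theorem BoundedInProb.add {X Y : ℕ → Ω → ℝ} (hX : BoundedInProb P X) (hY : BoundedInProb P Y) :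
    BoundedInProb P fun n ω => X n ω + Y n ω := by
  intro ε hε
  obtain ⟨K, hK⟩ := hX (ε / 2) (by positivity)
  obtain ⟨L, hL⟩ := hY (ε / 2) (by positivity)
  refine ⟨K + L, ?_⟩
  filter_upwards [hK, hL] with n h1 h2
  rw [← add_halves ε, ENNReal.ofReal_add (by positivity) (by positivity)]
  refine le_trans ?_ (add_le_add h1 h2)
  refine (measure_mono fun ω hω => ?_).trans (measure_union_le _ _)
  simp only [Set.mem_union, Set.mem_ofPred_eq] at hω ⊢
  by_contra! hcon
  have := abs_add_le (X n ω) (Y n ω)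
  linarith [hcon.1, hcon.2]

theorem BoundedInProb.mono {X Y : ℕ → Ω → ℝ} (hY : BoundedInProb P Y)
    (h : ∀ n ω, |X n ω| ≤ |Y n ω|) : BoundedInProb P X := by
  intro ε hε
  obtain ⟨K, hK⟩ := hY ε hε
  refine ⟨K, ?_⟩
  filter_upwards [hK] with n hn
  exact (measure_mono fun ω hω => lt_of_lt_of_le hω (h n ω)).trans hn

theorem BoundedInProb.sum {ι : Type*} (s : Finset ι) {X : ι → ℕ → Ω → ℝ}
    (h : ∀ i ∈ s, BoundedInProb P (X i)) : BoundedInProb P fun n ω => ∑ i ∈ s, X i n ω := by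
  classical
  induction s using Finset.induction_on with
  | empty => exact fun ε hε => ⟨0, Eventually.of_forall fun n => by simp⟩
  | insert i s hi ih =>
    simp only [Finset.sum_insert hi]
    exact (h i (by simp)).add (ih fun j hj => h j (by simp [hj]))

/-- Integrals of a bounded sequence that tends to zero in probability tend to zero. -/
theorem tendsto_integral_of_tendsto_probFilter [IsProbabilityMeasure P] {E : Type*}
    [NormedAddCommGroup E] [NormedSpace ℝ E] {Z : ℕ → Ω → E} {C : ℝ}
    (hC : ∀ n ω, ‖Z n ω‖ ≤ C) (hZ : Tendsto (fun q : ℕ × Ω => Z q.1 q.2) (probFilter P) (𝓝 0)) :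
    Tendsto (fun n => ∫ ω, Z n ω ∂P) atTop (𝓝 0) := by
  rw [tendsto_zero_iff_norm_tendsto_zero]
  rw [Metric.tendsto_nhds] at hZ
  simp only [dist_zero_right, eventually_probFilter, not_lt] at hZ
  suffices h : Tendsto (fun n => ∫⁻ ω, ‖Z n ω‖ₑ ∂P) atTop (𝓝 0) by
    have := (ENNReal.tendsto_toReal ENNReal.zero_ne_top).comp h
    refine tendsto_of_tendsto_of_tendsto_of_le_of_le' tendsto_const_nhds this
      (Eventually.of_forall fun _ => norm_nonneg _) ?_
    filter_upwards [h.eventually (gt_mem_nhds ENNReal.zero_lt_top)] with n hn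
    simp only [Function.comp, ENNReal.toReal_zero] at *
    rw [← toReal_enorm]
    exact ENNReal.toReal_mono hn.ne (enorm_integral_le_lintegral_enorm _)
  rw [ENNReal.tendsto_nhds_zero]
  intro η hη
  obtain ⟨t, ht, htη⟩ := ENNReal.lt_iff_exists_nnreal_btwn.1 hη
  have ht' : (0 : ℝ) < t := by simpa using ht
  have h1 := ENNReal.Tendsto.const_mul (a := ENNReal.ofReal C) (hZ (t / 2) (by positivity))
    (Or.inr ENNReal.ofReal_ne_top)
  rw [mul_zero, ENNReal.tendsto_nhds_zero] at h1
  filter_upwards [h1 (ENNReal.ofReal (t / 2)) (by simpa using ht')] with n hn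
  calc ∫⁻ ω, ‖Z n ω‖ₑ ∂P
      ≤ ∫⁻ ω, ENNReal.ofReal (t / 2) +
          {ω | (t : ℝ) / 2 ≤ ‖Z n ω‖}.indicator (fun _ => ENNReal.ofReal C) ω ∂P := by
        refine lintegral_mono fun ω => ?_
        rw [← ofReal_norm]
        by_cases h : (t : ℝ) / 2 ≤ ‖Z n ω‖
        · rw [Set.indicator_of_mem (a := ω) h]
          exact (ENNReal.ofReal_le_ofReal (hC n ω)).trans le_add_self
        · exact (ENNReal.ofReal_le_ofReal (not_le.1 h).le).trans le_self_add
    _ ≤ ENNReal.ofReal (t / 2) + ENNReal.ofReal (t / 2) := by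
        rw [lintegral_add_left measurable_const, lintegral_const, measure_univ, mul_one]
        gcongr
        exact (lintegral_indicator_const_le _ _).trans hn
    _ ≤ η := by
        rw [← ENNReal.ofReal_add (by positivity) (by positivity), add_halves]
        simpa using htη.le

/-- Convergence to zero in probability from convergence of truncated first moments. -/
theorem tendsto_probFilter_of_lintegral {ι : Type*} {A : ι → ℕ → Set Ω}
    (hA : ∀ ε : ℝ, 0 < ε → ∃ K, ∀ᶠ n in atTop, P (A K n)ᶜ ≤ ENNReal.ofReal ε)
    (hAm : ∀ K n, MeasurableSet (A K n)) {T : ℕ → Ω → ℝ≥0∞}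
    (hT : ∀ n, AEMeasurable (T n) P)
    (h : ∀ K, Tendsto (fun n => ∫⁻ ω in A K n, T n ω ∂P) atTop (𝓝 0)) :
    ∀ ε : ℝ≥0∞, 0 < ε → ∀ᶠ q in probFilter P, T q.1 q.2 < ε := by
  intro ε hε
  wlog hε' : ε ≠ ∞ generalizing ε
  · filter_upwards [this 1 one_pos ENNReal.one_ne_top] with q hq
    rw [not_ne_iff.1 hε']
    exact hq.trans ENNReal.one_lt_top
  rw [eventually_probFilter, ENNReal.tendsto_nhds_zero]
  intro η hη
  obtain ⟨t, ht, htη⟩ := ENNReal.lt_iff_exists_nnreal_btwn.1 hη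
  have ht' : (0 : ℝ) < t := by simpa using ht
  obtain ⟨K, hK⟩ := hA (t / 2) (by positivity)
  have h1 := ENNReal.Tendsto.div_const (h K) (Or.inr hε.ne')
  rw [ENNReal.zero_div, ENNReal.tendsto_nhds_zero] at h1
  filter_upwards [hK, h1 (ENNReal.ofReal (t / 2)) (by simpa using ht')] with n hn hn'
  calc P {ω | ¬ T n ω < ε}
      ≤ P ({ω | ε ≤ T n ω} ∩ A K n) + P (A K n)ᶜ := by
        refine (measure_mono fun ω hω => ?_).trans (measure_union_le _ _)
        by_cases h : ω ∈ A K n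
        · exact Or.inl ⟨not_lt.1 hω, h⟩
        · exact Or.inr h
    _ ≤ ENNReal.ofReal (t / 2) + ENNReal.ofReal (t / 2) := by
        refine add_le_add ?_ hn
        rw [← Measure.restrict_apply' (hAm K n)]
        exact (meas_ge_le_lintegral_div (hT n).restrict hε.ne' hε').trans hn'
    _ ≤ η := by
        rw [← ENNReal.ofReal_add (by positivity) (by positivity), add_halves]
        simpa using htη.le

/-- Boundedness in probability from bounded truncated second moments. -/
theorem boundedInProb_of_lintegral {ι : Type*} {A : ι → ℕ → Set Ω}
    (hA : ∀ ε : ℝ, 0 < ε → ∃ K, ∀ᶠ n in atTop, P (A K n)ᶜ ≤ ENNReal.ofReal ε)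
    (hAm : ∀ K n, MeasurableSet (A K n)) {X : ℕ → Ω → ℝ} (hX : ∀ n, AEMeasurable (X n) P)
    (h : ∀ K, ∃ C : ℝ, ∀ᶠ n in atTop,
      ∫⁻ ω in A K n, ENNReal.ofReal (X n ω ^ 2) ∂P ≤ ENNReal.ofReal C) :
    BoundedInProb P X := by
  intro ε hε
  obtain ⟨K, hK⟩ := hA (ε / 2) (by positivity)
  obtain ⟨C, hC⟩ := h K
  set L : ℝ := √((|C| + 1) / (ε / 2)) with hL
  have hLpos : 0 < L := Real.sqrt_pos.2 (by positivity)
  have hL2 : L ^ 2 = (|C| + 1) / (ε / 2) := Real.sq_sqrt (by positivity)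
  refine ⟨L, ?_⟩
  filter_upwards [hK, hC] with n hn hn'
  calc P {ω | L < |X n ω|}
      ≤ P ({ω | ENNReal.ofReal (L ^ 2) ≤ ENNReal.ofReal (X n ω ^ 2)} ∩ A K n) + P (A K n)ᶜ := by
        refine (measure_mono fun ω hω => ?_).trans (measure_union_le _ _)
        by_cases h : ω ∈ A K n
        · refine Or.inl ⟨ENNReal.ofReal_le_ofReal ?_, h⟩
          rw [← sq_abs (X n ω)]
          exact pow_le_pow_left₀ hLpos.le (le_of_lt hω) 2
        · exact Or.inr h
    _ ≤ ENNReal.ofReal (ε / 2) + ENNReal.ofReal (ε / 2) := by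
        refine add_le_add ?_ hn
        rw [← Measure.restrict_apply' (hAm K n)]
        refine (meas_ge_le_lintegral_div ((hX n).restrict.pow_const 2).ennreal_ofReal (by positivity)
          ENNReal.ofReal_ne_top).trans ?_
        refine (ENNReal.div_le_div_right hn' _).trans ?_
        rw [← ENNReal.ofReal_div_of_pos (by positivity), hL2]
        refine ENNReal.ofReal_le_ofReal ?_
        rw [div_div_eq_mul_div, div_le_iff₀ (by positivity), mul_comm]
        gcongr
        linarith [le_abs_self C]
    _ = ENNReal.ofReal ε := by
        rw [← ENNReal.ofReal_add (by positivity) (by positivity), add_halves]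

end InProbability

end CensoredSubsampling
namespace CensoredSubsampling

/-! ### Integrals over an event from its conditional probability. -/

section Transfer

variable {Ω : Type*} {m m0 : MeasurableSpace Ω} {P : Measure Ω} [IsProbabilityMeasure P]

/-- By the defining property of conditional expectation, both measures give `B` in `m` the mass `∫_B
P(A | m)`. Hence, for `m`-measurable integrands, restricting to `A` amounts to reweighting by `w`.
-/
theorem restrict_trim_eq_withDensity_trim (hm : m ≤ m0) {A : Set Ω} (hA : MeasurableSet[m0] A)
    {w : Ω → ℝ} (hw0 : ∀ ω, 0 ≤ w ω) (h : P⟦A|m⟧ =ᵐ[P] w) :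
    (P.restrict A).trim hm = (P.withDensity fun ω => ENNReal.ofReal (w ω)).trim hm := by
  have hwi : Integrable w P := (integrable_congr h).1 integrable_condExp
  refine @Measure.ext _ m _ _ fun B hB => ?_
  rw [trim_measurableSet_eq hm hB, trim_measurableSet_eq hm hB, withDensity_apply _ (hm B hB),
    ← ofReal_integral_eq_lintegral_ofReal hwi.integrableOn (Eventually.of_forall hw0),
    ← setIntegral_congr_ae (hm B hB) (h.mono fun ω hω _ => hω),
    setIntegral_condExp hm ((integrable_const _).indicator hA) hB,
    integral_indicator_const _ hA, Measure.restrict_apply (hm B hB), smul_eq_mul, mul_one,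
    ofReal_measureReal, Measure.restrict_apply hA, Set.inter_comm]

theorem setLIntegral_of_condProb (hm : m ≤ m0) {A : Set Ω} (hA : MeasurableSet[m0] A)
    {w : Ω → ℝ} (hw : Measurable[m] w) (hw0 : ∀ ω, 0 ≤ w ω) (h : P⟦A|m⟧ =ᵐ[P] w)
    {F : Ω → ℝ≥0∞} (hF : Measurable[m] F) :
    ∫⁻ ω in A, F ω ∂P = ∫⁻ ω, ENNReal.ofReal (w ω) * F ω ∂P := by
  rw [← lintegral_trim hm hF, restrict_trim_eq_withDensity_trim hm hA hw0 h,
    lintegral_trim hm hF, lintegral_withDensity_eq_lintegral_mul _ (hw.mono hm le_rfl).ennreal_ofReal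
      (hF.mono hm le_rfl)]
  rfl

theorem setIntegral_of_condProb (hm : m ≤ m0) {A : Set Ω} (hA : MeasurableSet[m0] A)
    {w : Ω → ℝ} (hw : Measurable[m] w) (hw0 : ∀ ω, 0 ≤ w ω) (h : P⟦A|m⟧ =ᵐ[P] w)
    {F : Ω → ℂ} (hF : Measurable[m] F) :
    ∫ ω in A, F ω ∂P = ∫ ω, (w ω : ℂ) * F ω ∂P := by
  rw [integral_trim hm hF.stronglyMeasurable, restrict_trim_eq_withDensity_trim hm hA hw0 h,
    ← integral_trim hm hF.stronglyMeasurable, integral_withDensity_eq_integral_toReal_smul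
      (hw.mono hm le_rfl).ennreal_ofReal (Eventually.of_forall fun _ => ENNReal.ofReal_lt_top)]
  refine integral_congr_ae (Eventually.of_forall fun ω => ?_)
  simp [ENNReal.toReal_ofReal (hw0 ω)]

end Transfer

/-! ### Moments and exponentials under finite product weights. -/

section FiniteSums

variable {ι : Type*} [Fintype ι] {r : ℕ}

theorem sum_prod_eq_pow {R : Type*} [CommSemiring R] (p : ι → R) :
    ∑ s : Fin r → ι, ∏ j, p (s j) = (∑ i, p i) ^ r := by
  classical
  have := (Finset.prod_univ_sum (fun _ : Fin r => (Finset.univ : Finset ι)) fun _ i => p i).symm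
  simpa using this

/-- The product weight makes the coordinates of `s` independent, so the exponential of the sum
factorizes. This is the source of the `r`-th power in the conditional characteristic function. -/
theorem sum_prod_mul_exp_sum (p y : ι → ℂ) :
    ∑ s : Fin r → ι, (∏ j, p (s j)) * Complex.exp (∑ j, y (s j)) =
      (∑ i, p i * Complex.exp (y i)) ^ r := by
  rw [← sum_prod_eq_pow]
  refine Finset.sum_congr rfl fun s _ => ?_
  rw [Complex.exp_sum, Finset.prod_mul_distrib]

/-- After expanding the square, each off-diagonal term factorizes and contains the vanishing factor
`∑ p z`; only the `r` diagonal terms survive. -/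
theorem sum_prod_mul_sum_sq {p z : ι → ℝ} (hp : ∑ i, p i = 1) (hz : ∑ i, p i * z i = 0) :
    ∑ s : Fin r → ι, (∏ j, p (s j)) * (∑ j, z (s j)) ^ 2 = r * ∑ i, p i * z i ^ 2 := by
  classical
  have key : ∀ j k : Fin r, ∑ s : Fin r → ι, (∏ l, p (s l)) * (z (s j) * z (s k)) =
      if j = k then ∑ i, p i * z i ^ 2 else 0 := by
    intro j k
    -- The two extra factors are spread over all coordinates as `if` factors, so that the sum over
    -- `s` becomes a product of one-coordinate sums.
    have h1 : ∀ s : Fin r → ι, (∏ l, p (s l)) * (z (s j) * z (s k)) =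
        ∏ l, (p (s l) * (if l = j then z (s l) else 1) * (if l = k then z (s l) else 1)) := by
      intro s
      rw [Finset.prod_mul_distrib, Finset.prod_mul_distrib, Finset.prod_ite_eq', Finset.prod_ite_eq']
      simp [mul_assoc]
    have h2 := Finset.prod_univ_sum (fun _ : Fin r => (Finset.univ : Finset ι)) fun l i =>
      p i * (if l = j then z i else 1) * (if l = k then z i else 1)
    simp only [Fintype.piFinset_univ] at h2
    simp_rw [h1]
    rw [← h2]
    split_ifs with hjk
    · subst hjk
      rw [Finset.prod_eq_single j]
      · simp [pow_two, mul_assoc]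
      · intro l _ hl
        simp [hl, hp]
      · simp
    · refine Finset.prod_eq_zero (Finset.mem_univ j) ?_
      simp [hjk, hz]
  simp_rw [pow_two (∑ j, z _), Finset.sum_mul_sum, Finset.mul_sum]
  rw [Finset.sum_comm]
  have : ∀ j : Fin r, ∑ s : Fin r → ι, ∑ k, (∏ l, p (s l)) * (z (s j) * z (s k)) =
      ∑ i, p i * z i ^ 2 := by
    intro j
    rw [Finset.sum_comm]
    simp_rw [key]
    simp
  simp_rw [this]
  simp [Finset.mul_sum]

/-- The variance of the mean of a sample with replacement is at most `1 / r` times the second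
moment of one draw. -/
theorem sum_prod_mul_sub_sq_le {p y : ι → ℝ} (hp : ∑ i, p i = 1) (hr : 1 ≤ r) :
    ∑ s : Fin r → ι, (∏ j, p (s j)) * ((1 / (r : ℝ)) * ∑ j, y (s j) - ∑ i, p i * y i) ^ 2 ≤
      (1 / (r : ℝ)) * ∑ i, p i * y i ^ 2 := by
  have hr0 : (r : ℝ) ≠ 0 := by positivity
  set μ := ∑ i, p i * y i with hμ
  have hz : ∑ i, p i * (y i - μ) = 0 := by
    simp_rw [mul_sub, Finset.sum_sub_distrib, ← Finset.sum_mul, hp, ← hμ]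
    ring
  have h := sum_prod_mul_sum_sq (r := r) hp hz
  have h1 : ∀ s : Fin r → ι, (1 / (r : ℝ)) * ∑ j, y (s j) - μ =
      (1 / (r : ℝ)) * ∑ j, (y (s j) - μ) := by
    intro s
    rw [Finset.sum_sub_distrib]
    simp [mul_sub, hr0]
  have h2 : ∑ i, p i * (y i - μ) ^ 2 = ∑ i, p i * y i ^ 2 - μ ^ 2 := by
    have : ∀ i, p i * (y i - μ) ^ 2 = p i * y i ^ 2 - 2 * μ * (p i * y i) + p i * μ ^ 2 :=
      fun i => by ring
    simp_rw [this, Finset.sum_add_distrib, Finset.sum_sub_distrib, ← Finset.mul_sum,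
      ← Finset.sum_mul, hp, ← hμ]
    ring
  simp_rw [h1, mul_pow]
  have h3 : ∀ s : Fin r → ι, (∏ j, p (s j)) * ((1 / (r : ℝ)) ^ 2 * (∑ j, (y (s j) - μ)) ^ 2) =
      (1 / (r : ℝ)) ^ 2 * ((∏ j, p (s j)) * (∑ j, (y (s j) - μ)) ^ 2) := fun s => by ring
  simp_rw [h3]
  rw [← Finset.mul_sum, h, h2]
  have : (1 / (r : ℝ)) ^ 2 * (r * (∑ i, p i * y i ^ 2 - μ ^ 2)) =
      (1 / (r : ℝ)) * (∑ i, p i * y i ^ 2 - μ ^ 2) := by field_simp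
  rw [this]
  gcongr
  nlinarith [sq_nonneg μ]

end FiniteSums

/-! ### Integration over the subsampling mechanism. -/

section Subsampling

variable {Ω : Type*} [MeasurableSpace Ω] {P : Measure Ω} [IsProbabilityMeasure P]
  {x : ℕ → Ω → Obs} {r : ℕ → ℕ} {π : ℕ → ℕ → Ω → ℝ} {a : ℕ → ℕ → Ω → ℕ}

theorem dataSigma_le (hx : ∀ i, Measurable (x i)) (n : ℕ) :
    dataSigma x n ≤ (inferInstance : MeasurableSpace Ω) :=
  (measurable_pi_lambda _ fun i : Fin n => hx i).comap_le

theorem measurable_dataSigma (n : ℕ) (i : Fin n) : Measurable[dataSigma x n] (x i) := by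
  have h : Measurable[dataSigma x n] fun ω (i : Fin n) => x i ω := comap_measurable _
  exact (measurable_pi_apply i).comp h

namespace IsGeneralSubsampling

/-- The event that the selected indices are `s`. -/
def selected (r : ℕ → ℕ) (a : ℕ → ℕ → Ω → ℕ) (n : ℕ) (s : Fin (r n) → Fin n) : Set Ω :=
  {ω | ∀ j : Fin (r n), a n j ω = s j}

variable (hsub : IsGeneralSubsampling P x r π a) (hx : ∀ i, Measurable (x i))
include hsub

theorem measurableSet_selected (n : ℕ) (s : Fin (r n) → Fin n) :
    MeasurableSet (selected r a n s) := by
  have : selected r a n s = ⋂ j : Fin (r n), a n j ⁻¹' {(s j : ℕ)} := by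
    ext ω
    simp [selected]
  rw [this]
  exact MeasurableSet.iInter fun j => hsub.measurable_index n j (measurableSet_singleton _)

theorem measurable_prod_prob (n : ℕ) (s : Fin (r n) → Fin n) :
    Measurable[dataSigma x n] fun ω => ∏ j, π n (s j) ω :=
  Finset.measurable_fun_prod _ fun j _ => hsub.measurable_prob n (s j) (s j).2

theorem prod_prob_nonneg (n : ℕ) (s : Fin (r n) → Fin n) (ω : Ω) : 0 ≤ ∏ j, π n (s j) ω :=
  Finset.prod_nonneg fun j _ => (hsub.prob_pos n (s j) ω (s j).2).le

theorem sum_prob_fin {n : ℕ} (hn : 1 ≤ n) (ω : Ω) : ∑ i : Fin n, π n i ω = 1 := by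
  rw [← hsub.sum_prob n ω hn, Finset.sum_range]

theorem disjoint_selected (n : ℕ) :
    Pairwise (Function.onFun Disjoint (selected (Ω := Ω) r a n)) := by
  intro s t hst
  refine Set.disjoint_left.2 fun ω hs ht => hst ?_
  funext j
  exact Fin.ext ((hs j).symm.trans (ht j))

include hx

/-- The conditional probabilities of all index tuples add up to `(∑ π_i) ^ r = 1`. That the drawn
indices are below `n` is not assumed pointwise; it is recovered here almost surely. -/
theorem ae_exists_selected {n : ℕ} (hn : 1 ≤ n) :
    ∀ᵐ ω ∂P, ∃ s, ω ∈ selected r a n s := by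
  have h : ∫⁻ ω in ⋃ s, selected r a n s, 1 ∂P = 1 := by
    rw [lintegral_iUnion (hsub.measurableSet_selected n) (hsub.disjoint_selected n), tsum_fintype]
    have h1 : ∀ s, ∫⁻ ω in selected r a n s, 1 ∂P = ∫⁻ ω, ENNReal.ofReal (∏ j, π n (s j) ω) ∂P := by
      intro s
      rw [setLIntegral_of_condProb (dataSigma_le hx n) (hsub.measurableSet_selected n s)
        (hsub.measurable_prod_prob n s) (hsub.prod_prob_nonneg n s) (hsub.condProb_index n hn s)
        measurable_const]
      simp
    simp_rw [h1]
    rw [← lintegral_finsetSum _ fun s _ =>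
      ((hsub.measurable_prod_prob n s).mono (dataSigma_le hx n) le_rfl).ennreal_ofReal]
    have h2 : ∀ ω, ∑ s : Fin (r n) → Fin n, ENNReal.ofReal (∏ j, π n (s j) ω) = 1 := by
      intro ω
      rw [← ENNReal.ofReal_sum_of_nonneg fun s _ => hsub.prod_prob_nonneg n s ω,
        sum_prod_eq_pow (fun i : Fin n => π n i ω), hsub.sum_prob_fin hn]
      simp
    simp [h2]
  rw [setLIntegral_one] at h
  have := (prob_compl_eq_zero_iff (MeasurableSet.iUnion (hsub.measurableSet_selected n))).2 h
  filter_upwards [compl_mem_ae_iff.2 this] with ω hω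
  simpa using hω

theorem ae_index_lt {n : ℕ} (hn : 1 ≤ n) : ∀ᵐ ω ∂P, ∀ j < r n, a n j ω < n := by
  filter_upwards [hsub.ae_exists_selected hx hn] with ω ⟨s, hs⟩ j hj
  rw [hs ⟨j, hj⟩]
  exact (s ⟨j, hj⟩).2

/-- The selection events partition the space up to a null set, and on each of them `Φ` is a function
of the data. Conditioning therefore yields a finite mixture with product weights, to which the
finite-sum identities apply for each fixed `ω`. `integral_eq` is the counterpart for bounded complex
functions. -/
theorem lintegral_eq {n : ℕ} (hn : 1 ≤ n) {Φ : Ω → ℝ≥0∞} {F : (Fin (r n) → Fin n) → Ω → ℝ≥0∞}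
    (hF : ∀ s, Measurable[dataSigma x n] (F s)) (hΦ : ∀ s, ∀ ω ∈ selected r a n s, Φ ω = F s ω) :
    ∫⁻ ω, Φ ω ∂P = ∫⁻ ω, ∑ s, ENNReal.ofReal (∏ j, π n (s j) ω) * F s ω ∂P := by
  have h0 : (⋃ s, selected r a n s) =ᵐ[P] Set.univ := by
    rw [eventuallyEq_univ]
    filter_upwards [hsub.ae_exists_selected hx hn] with ω hω
    simpa using hω
  rw [← setLIntegral_univ, ← setLIntegral_congr h0,
    lintegral_iUnion (hsub.measurableSet_selected n) (hsub.disjoint_selected n), tsum_fintype,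
    lintegral_finsetSum _ fun s _ => by
      exact ((hsub.measurable_prod_prob n s).mono (dataSigma_le hx n) le_rfl).ennreal_ofReal.mul
        ((hF s).mono (dataSigma_le hx n) le_rfl)]
  refine Finset.sum_congr rfl fun s _ => ?_
  rw [setLIntegral_congr_fun (hsub.measurableSet_selected n s) (hΦ s)]
  exact setLIntegral_of_condProb (dataSigma_le hx n) (hsub.measurableSet_selected n s)
        (hsub.measurable_prod_prob n s) (hsub.prod_prob_nonneg n s) (hsub.condProb_index n hn s)
        (hF s)

theorem prod_prob_le_one {n : ℕ} (hn : 1 ≤ n) (s : Fin (r n) → Fin n) (ω : Ω) :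
    ∏ j, π n (s j) ω ≤ 1 := by
  refine Finset.prod_le_one (fun j _ => (hsub.prob_pos n (s j) ω (s j).2).le) fun j _ => ?_
  rw [← hsub.sum_prob_fin hn ω]
  exact Finset.single_le_sum (f := fun i : Fin n => π n i ω)
    (fun i _ => (hsub.prob_pos n i ω i.2).le) (Finset.mem_univ (s j))

theorem integral_eq {n : ℕ} (hn : 1 ≤ n) {Φ : Ω → ℂ} {F : (Fin (r n) → Fin n) → Ω → ℂ} {C : ℝ}
    (hF : ∀ s, Measurable[dataSigma x n] (F s)) (hFC : ∀ s ω, ‖F s ω‖ ≤ C)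
    (hΦ : ∀ s, ∀ ω ∈ selected r a n s, Φ ω = F s ω) :
    ∫ ω, Φ ω ∂P = ∫ ω, ∑ s, ((∏ j, π n (s j) ω : ℝ) : ℂ) * F s ω ∂P := by
  have h0 : (⋃ s, selected r a n s) =ᵐ[P] Set.univ := by
    rw [eventuallyEq_univ]
    filter_upwards [hsub.ae_exists_selected hx hn] with ω hω
    simpa using hω
  have hm := dataSigma_le hx n
  have hFi : ∀ s, Integrable (F s) P := fun s =>
    Integrable.of_bound ((hF s).mono hm le_rfl).aestronglyMeasurable C
      (Eventually.of_forall (hFC s))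
  rw [← setIntegral_univ, ← setIntegral_congr_set h0,
    integral_iUnion_fintype (hsub.measurableSet_selected n) (hsub.disjoint_selected n),
    integral_finsetSum]
  · refine Finset.sum_congr rfl fun s _ => ?_
    rw [setIntegral_congr_fun (hsub.measurableSet_selected n s) (hΦ s)]
    exact setIntegral_of_condProb hm (hsub.measurableSet_selected n s)
        (hsub.measurable_prod_prob n s) (hsub.prod_prob_nonneg n s) (hsub.condProb_index n hn s)
        (hF s)
  · intro s _
    refine (hFi s).bdd_mul (c := 1) ?_ (Eventually.of_forall fun ω => ?_)
    · exact (Complex.measurable_ofReal.comp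
        ((hsub.measurable_prod_prob n s).mono hm le_rfl)).aestronglyMeasurable
    · rw [Complex.norm_real, Real.norm_of_nonneg (hsub.prod_prob_nonneg n s ω)]
      exact hsub.prod_prob_le_one hx hn s ω
  · exact fun s => (hFi s).integrableOn.congr_fun (fun ω hω => (hΦ s ω hω).symm)
      (hsub.measurableSet_selected n s)

end IsGeneralSubsampling

end Subsampling

end CensoredSubsampling
namespace CensoredSubsampling

/-! ### Quantitative Gaussian approximation of a power of a characteristic function. -/

section ComplexExp

/-- Small `w` is the power series bound. For `‖w‖ ≥ 1` the sign of the real part gives `‖exp w‖ ≤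
1`, and `1 + 1 + ‖w‖ ≤ 3 ‖w‖²`. -/
theorem norm_exp_sub_one_sub_le {w : ℂ} (hw : w.re ≤ 0) :
    ‖Complex.exp w - 1 - w‖ ≤ 3 * ‖w‖ ^ 2 := by
  rcases le_total ‖w‖ 1 with h | h
  · have := Complex.norm_exp_sub_one_sub_id_le h
    nlinarith [norm_nonneg w, sq_nonneg ‖w‖]
  · have h1 : ‖Complex.exp w‖ ≤ 1 := by
      rw [Complex.norm_exp]
      exact Real.exp_le_one_iff.2 hw
    calc ‖Complex.exp w - 1 - w‖ ≤ ‖Complex.exp w‖ + ‖(1 : ℂ)‖ + ‖w‖ :=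
          (norm_sub_le _ _).trans (add_le_add_left (norm_sub_le _ _) _)
      _ ≤ 3 * ‖w‖ ^ 2 := by
          rw [norm_one]
          nlinarith

/-- The error is cubic for small `u` and quadratic for large `u`. Keeping both in `min 1 |u|` is
what lets the Lindeberg step work with second moments only. -/
theorem norm_exp_mul_I_sub_le (u : ℝ) :
    ‖Complex.exp (u * Complex.I) - (1 + u * Complex.I - u ^ 2 / 2)‖ ≤ 4 * (u ^ 2 * min 1 |u|) := by
  have hn : ‖(u : ℂ) * Complex.I‖ = |u| := by simp
  have hI : ((u : ℂ) * Complex.I) ^ 2 = -(u : ℂ) ^ 2 := by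
    rw [mul_pow, Complex.I_sq]
    ring
  rcases le_total |u| 1 with h | h
  · rw [min_eq_right h]
    have := Complex.exp_bound (x := (u : ℂ) * Complex.I) (by rw [hn]; exact h)
      (n := 3) (by norm_num)
    simp only [Finset.sum_range_succ, Finset.range_zero, Finset.sum_empty, pow_zero, pow_one, hI,
      Nat.factorial] at this
    rw [hn] at this
    have e : Complex.exp (u * Complex.I) - (1 + u * Complex.I - u ^ 2 / 2) =
        Complex.exp (u * Complex.I) - (0 + 1 / ((1 : ℕ) : ℂ) + u * Complex.I / (((0 + 1) * 1 : ℕ) : ℂ) +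
          -(u : ℂ) ^ 2 / (((1 + 1) * ((0 + 1) * 1) : ℕ) : ℂ)) := by
      push_cast
      ring
    rw [e]
    refine this.trans ?_
    norm_num
    have h3 : |u| ^ 3 = u ^ 2 * |u| := by rw [pow_succ, sq_abs]
    rw [h3]
    have : 0 ≤ u ^ 2 * |u| := by positivity
    linarith
  · rw [min_eq_left h, mul_one]
    have h1 : ‖Complex.exp (u * Complex.I)‖ = 1 := Complex.norm_exp_ofReal_mul_I u
    calc ‖Complex.exp (u * Complex.I) - (1 + u * Complex.I - u ^ 2 / 2)‖
        ≤ ‖Complex.exp (u * Complex.I)‖ + (‖(1 : ℂ)‖ + ‖(u : ℂ) * Complex.I‖ +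
            ‖(u : ℂ) ^ 2 / 2‖) :=
          (norm_sub_le _ _).trans (add_le_add_right ((norm_sub_le _ _).trans
            (add_le_add_left (norm_add_le _ _) _)) _)
      _ ≤ 4 * u ^ 2 := by
          rw [h1, norm_one, hn, norm_div, norm_pow, Complex.norm_real, Real.norm_eq_abs, sq_abs]
          have := sq_abs u
          simp only [Complex.norm_ofNat]
          nlinarith

theorem norm_pow_sub_pow_le_mul {z w : ℂ} (hz : ‖z‖ ≤ 1) (hw : ‖w‖ ≤ 1) (n : ℕ) :
    ‖z ^ n - w ^ n‖ ≤ n * ‖z - w‖ := by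
  induction n with
  | zero => simp
  | succ n ih =>
    have : z ^ (n + 1) - w ^ (n + 1) = z ^ n * (z - w) + (z ^ n - w ^ n) * w := by ring
    rw [this]
    refine (norm_add_le _ _).trans ?_
    rw [norm_mul, norm_mul, norm_pow]
    have h1 : ‖z‖ ^ n ≤ 1 := pow_le_one₀ (norm_nonneg _) hz
    have h2 : ‖z ^ n - w ^ n‖ * ‖w‖ ≤ ‖z ^ n - w ^ n‖ := mul_le_of_le_one_right (norm_nonneg _) hw
    have h3 : ‖z‖ ^ n * ‖z - w‖ ≤ ‖z - w‖ := mul_le_of_le_one_left (norm_nonneg _) h1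
    push_cast
    linarith

/-- Gaussian approximation of the `r`-th power of the characteristic function of a finitely
supported law with weights `p`, mean `m` and second moment `s`. -/
theorem norm_sum_mul_exp_pow_sub_exp_le {ι : Type*} [Fintype ι] {p u : ι → ℝ} (hp0 : ∀ i, 0 ≤ p i)
    (hp : ∑ i, p i = 1) {m s : ℝ} (hm : ∑ i, p i * u i = m) (hs : ∑ i, p i * u i ^ 2 = s)
    (r : ℕ) :
    ‖(∑ i, (p i : ℂ) * Complex.exp (u i * Complex.I)) ^ r -
        Complex.exp (r * (m * Complex.I - s / 2))‖ ≤
      r * (4 * ∑ i, p i * (u i ^ 2 * min 1 |u i|) + 3 * (m ^ 2 + s ^ 2 / 4)) := by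
  have hs0 : 0 ≤ s := hs ▸ Finset.sum_nonneg fun i _ => mul_nonneg (hp0 i) (sq_nonneg _)
  -- Here `s` is the raw second moment, not the variance. The discrepancy is part of the error term
  -- with `m ^ 2`, harmless later because `r m²` will be the square of a vanishing average.
  set w : ℂ := m * Complex.I - s / 2 with hw
  have hre : w.re ≤ 0 := by
    simp [hw]
    positivity
  have hnorm : ‖w‖ ^ 2 = m ^ 2 + s ^ 2 / 4 := by
    rw [← Complex.normSq_eq_norm_sq, Complex.normSq_apply]
    simp [hw]
    ring
  rw [Complex.exp_nat_mul]
  refine (norm_pow_sub_pow_le_mul ?_ ?_ r).trans ?_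
  · refine (norm_sum_le _ _).trans (le_of_eq ?_)
    rw [← hp]
    refine Finset.sum_congr rfl fun i _ => ?_
    rw [norm_mul, Complex.norm_exp_ofReal_mul_I, mul_one, Complex.norm_real,
      Real.norm_of_nonneg (hp0 i)]
  · rw [Complex.norm_exp]
    exact Real.exp_le_one_iff.2 hre
  · refine mul_le_mul_of_nonneg_left ?_ (Nat.cast_nonneg r)
    -- Both terms are compared with `1 + w`, which is exactly the weighted sum of the second-order
    -- Taylor polynomials.
    have e : ∑ i, (p i : ℂ) * Complex.exp (u i * Complex.I) - Complex.exp w =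
        ∑ i, (p i : ℂ) * (Complex.exp (u i * Complex.I) - (1 + u i * Complex.I - u i ^ 2 / 2)) -
          (Complex.exp w - 1 - w) := by
      have h1 : ∑ i, (p i : ℂ) * (1 + u i * Complex.I - u i ^ 2 / 2) = 1 + w := by
        have hp' : ∑ i, (p i : ℂ) = 1 := by exact_mod_cast hp
        have hm' : ∑ i, (p i : ℂ) * u i = m := by exact_mod_cast hm
        have hs' : ∑ i, (p i : ℂ) * (u i : ℂ) ^ 2 = s := by exact_mod_cast hs
        have : ∀ i, (p i : ℂ) * (1 + u i * Complex.I - u i ^ 2 / 2) =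
            p i + (p i * u i) * Complex.I - (p i * u i ^ 2) / 2 := fun i => by ring
        simp_rw [this, Finset.sum_sub_distrib, Finset.sum_add_distrib, ← Finset.sum_mul,
          ← Finset.sum_div, hp', hm', hs', hw]
        ring
      simp_rw [mul_sub (_ : ℂ) (Complex.exp _), Finset.sum_sub_distrib, h1]
      ring
    rw [e]
    refine (norm_sub_le _ _).trans (add_le_add ?_ ?_)
    · refine (norm_sum_le _ _).trans ?_
      rw [Finset.mul_sum]
      refine Finset.sum_le_sum fun i _ => ?_
      rw [norm_mul, Complex.norm_real, Real.norm_of_nonneg (hp0 i), mul_left_comm]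
      exact mul_le_mul_of_nonneg_left (norm_exp_mul_I_sub_le _) (hp0 i)
    · rw [← hnorm]
      exact norm_exp_sub_one_sub_le hre

end ComplexExp

/-! ### Law of large numbers and central limit theorem for the full data. -/

section FullAverage

variable {Ω : Type*} [MeasurableSpace Ω] {P : Measure Ω} [IsProbabilityMeasure P]
  {x : ℕ → Ω → Obs} {Q : Measure Obs} {h : Obs → ℝ}

/-- The full-data average of `h`. -/
noncomputable def fullAvg (x : ℕ → Ω → Obs) (h : Obs → ℝ) (n : ℕ) (ω : Ω) : ℝ :=
  (1 / (n : ℝ)) * ∑ i ∈ Finset.range n, h (x i ω)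

theorem measurable_fullAvg (hx : ∀ i, Measurable (x i)) (hh : Measurable h) (n : ℕ) :
    Measurable (fullAvg x h n) :=
  (Finset.measurable_fun_sum _ fun i _ => hh.comp (hx i)).const_mul _

theorem integrable_fullAvg (hx : ∀ i, Measurable (x i)) (hlaw : ∀ i, P.map (x i) = Q)
    (hh : Integrable h Q) (n : ℕ) : Integrable (fullAvg x h n) P := by
  refine (integrable_finsetSum _ fun i _ => ?_).const_mul _
  exact Integrable.comp_measurable (by rwa [hlaw i]) (hx i)

theorem integral_fullAvg (hx : ∀ i, Measurable (x i)) (hlaw : ∀ i, P.map (x i) = Q)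
    (hh : Integrable h Q) {n : ℕ} (hn : 1 ≤ n) : ∫ ω, fullAvg x h n ω ∂P = ∫ z, h z ∂Q := by
  unfold fullAvg
  have hint : ∀ i, Integrable (fun ω => h (x i ω)) P := fun i =>
    Integrable.comp_measurable (g := h) (by rwa [hlaw i]) (hx i)
  rw [integral_const_mul, integral_finsetSum _ fun i _ => hint i]
  have : ∀ i, ∫ ω, h (x i ω) ∂P = ∫ z, h z ∂Q := by
    intro i
    rw [← hlaw i, integral_map (hx i).aemeasurable (by rw [hlaw i]; exact hh.aestronglyMeasurable)]
  have hn' : (n : ℝ) ≠ 0 := by positivity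
  simp [this]
  field_simp

theorem identDistrib_comp (hx : ∀ i, Measurable (x i)) (hlaw : ∀ i, P.map (x i) = Q)
    (hh : Measurable h) (i : ℕ) :
    IdentDistrib (fun ω => h (x i ω)) (fun ω => h (x 0 ω)) P P :=
  IdentDistrib.comp ⟨(hx i).aemeasurable, (hx 0).aemeasurable, by rw [hlaw i, hlaw 0]⟩ hh

/-- The law of large numbers for the full-data averages. -/
theorem tendsto_fullAvg (hx : ∀ i, Measurable (x i)) (hind : iIndepFun x P)
    (hlaw : ∀ i, P.map (x i) = Q) (hhm : Measurable h) (hh : Integrable h Q) :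
    Tendsto (fun q : ℕ × Ω => fullAvg x h q.1 q.2) (probFilter P) (𝓝 (∫ z, h z ∂Q)) := by
  have hint : Integrable (fun ω => h (x 0 ω)) P :=
    Integrable.comp_measurable (g := h) (by rwa [hlaw 0]) (hx 0)
  have hmean : ∫ ω, h (x 0 ω) ∂P = ∫ z, h z ∂Q := by
    rw [← hlaw 0, integral_map (hx 0).aemeasurable hhm.aestronglyMeasurable]
  have := strong_law_ae_real (fun i ω => h (x i ω)) hint
    (fun i j hij => (hind.indepFun hij).comp hhm hhm) (identDistrib_comp hx hlaw hhm)
  rw [← tendstoInMeasure_const_iff]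
  refine tendstoInMeasure_of_tendsto_ae
    (fun n => (measurable_fullAvg hx hhm n).aestronglyMeasurable) ?_
  filter_upwards [this] with ω hω
  rw [← hmean]
  refine hω.congr fun n => ?_
  unfold fullAvg
  ring

theorem integral_fullAvg_sq (hx : ∀ i, Measurable (x i)) (hind : iIndepFun x P)
    (hlaw : ∀ i, P.map (x i) = Q) (hhm : Measurable h) (hh : MemLp h 2 Q) (h0 : ∫ z, h z ∂Q = 0)
    {n : ℕ} (hn : 1 ≤ n) :
    ∫ ω, fullAvg x h n ω ^ 2 ∂P = (1 / (n : ℝ)) * ∫ z, h z ^ 2 ∂Q := by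
  have : IsProbabilityMeasure Q := hlaw 0 ▸ Measure.isProbabilityMeasure_map (hx 0).aemeasurable
  have hmem : ∀ i, MemLp (fun ω => h (x i ω)) 2 P := fun i =>
    MemLp.comp_of_map (g := h) (by rwa [hlaw i]) (hx i).aemeasurable
  have hvar : ∀ i, variance (fun ω => h (x i ω)) P = ∫ z, h z ^ 2 ∂Q := by
    intro i
    rw [variance_of_integral_eq_zero (X := fun ω => h (x i ω)) (hhm.comp (hx i)).aemeasurable, ← hlaw i,
      integral_map (hx i).aemeasurable (by fun_prop)]
    rw [← h0, ← hlaw i, integral_map (hx i).aemeasurable (by fun_prop)]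
  rw [← variance_of_integral_eq_zero (measurable_fullAvg hx hhm n).aemeasurable
    (by rw [integral_fullAvg hx hlaw (hh.integrable one_le_two) hn, h0])]
  have e : fullAvg x h n = fun ω => (1 / (n : ℝ)) * (∑ i ∈ Finset.range n, fun ω => h (x i ω)) ω := by
    funext ω
    simp [fullAvg]
  rw [e, variance_const_mul, IndepFun.variance_sum (fun i _ => hmem i)
    fun i _ j _ hij => (hind.indepFun hij).comp hhm hhm]
  simp_rw [hvar]
  have hn' : (n : ℝ) ≠ 0 := by positivity
  simp
  field_simp

/-- The central limit theorem for the full-data averages, on the scale `√r` with `r / n → γ`. -/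
theorem tendsto_integral_exp_fullAvg (hx : ∀ i, Measurable (x i)) (hind : iIndepFun x P)
    (hlaw : ∀ i, P.map (x i) = Q) (hhm : Measurable h) (hh : MemLp h 2 Q) (h0 : ∫ z, h z ∂Q = 0)
    {r : ℕ → ℕ} {γ : ℝ} (hγ : Tendsto (fun n => (r n : ℝ) / (n : ℝ)) atTop (𝓝 γ)) :
    Tendsto (fun n => ∫ ω, Complex.exp ((√(r n) * fullAvg x h n ω : ℝ) * Complex.I) ∂P) atTop
      (𝓝 (Complex.exp (-(γ * ∫ z, h z ^ 2 ∂Q) / 2 : ℝ))) := by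
  have hQ : IsProbabilityMeasure Q := hlaw 0 ▸ Measure.isProbabilityMeasure_map (hx 0).aemeasurable
  have hγ0 : 0 ≤ γ := ge_of_tendsto' hγ fun n => by positivity
  have hmem : MemLp (fun ω => h (x 0 ω)) 2 P :=
    MemLp.comp_of_map (g := h) (by rwa [hlaw 0]) (hx 0).aemeasurable
  have hmean : ∫ ω, h (x 0 ω) ∂P = 0 := by
    rw [← h0, ← hlaw 0, integral_map (hx 0).aemeasurable hhm.aestronglyMeasurable]
  have hvar : Var[fun ω => h (x 0 ω); P] = ∫ z, h z ^ 2 ∂Q := by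
    rw [variance_of_integral_eq_zero (X := fun ω => h (x 0 ω)) (hhm.comp (hx 0)).aemeasurable hmean, ← hlaw 0,
      integral_map (hx 0).aemeasurable (by fun_prop)]
  set v := Var[fun ω => h (x 0 ω); P] with hv
  have hY : HasLaw (id : ℝ → ℝ) (gaussianReal 0 v.toNNReal) (gaussianReal 0 v.toNNReal) :=
    HasLaw.id
  have hclt := tendstoInDistribution_inv_sqrt_mul_sum_sub (X := fun i ω => h (x i ω)) hY hmem
    (hind.comp (fun _ => h) fun _ => hhm) (identDistrib_comp hx hlaw hhm)
  -- Slutsky: the `√n` central limit theorem is multiplied by `√(r/n) → √γ`. This includes `γ = 0`,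
  -- where the limit law is degenerate.
  have ht : TendstoInMeasure P (fun n (_ : Ω) => √((r n : ℝ) / n)) atTop (fun _ => √γ) := by
    rw [tendstoInMeasure_const_iff]
    exact (hγ.sqrt).comp tendsto_fst_probFilter
  have hd := hclt.continuous_comp_prodMk_of_tendstoInMeasure_const
    (g := fun y : ℝ × ℝ => y.2 * y.1) (by fun_prop) ht fun _ => aemeasurable_const
  have hchar := (ProbabilityMeasure.tendsto_iff_tendsto_charFun.1 hd.tendsto) 1
  have hlim : charFun ((gaussianReal 0 v.toNNReal).map fun y => √γ * id y) 1 =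
      Complex.exp (-(γ * ∫ z, h z ^ 2 ∂Q) / 2 : ℝ) := by
    simp only [id]
    rw [charFun_map_mul, charFun_gaussianReal, ← hvar, Real.coe_toNNReal _ (variance_nonneg _ _)]
    congr 1
    have : ((√γ : ℝ) : ℂ) ^ 2 = γ := by exact_mod_cast Real.sq_sqrt hγ0
    push_cast
    simp only [mul_one, mul_zero, zero_mul, zero_sub]
    rw [this]
    ring
  simp only [ProbabilityMeasure.coe_mk] at hchar
  rw [hlim] at hchar
  refine hchar.congr fun n => ?_
  rw [charFun_apply_real, integral_map]
  · refine integral_congr_ae (Eventually.of_forall fun ω => ?_)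
    simp only
    congr 2
    rw [Complex.ofReal_one, one_mul]
    congr 1
    rw [hmean, mul_zero, sub_zero, fullAvg, Real.sqrt_div (Nat.cast_nonneg _)]
    rcases Nat.eq_zero_or_pos n with rfl | hn
    · simp
    · have hs : √(n : ℝ) * √(n : ℝ) = n := Real.mul_self_sqrt (Nat.cast_nonneg n)
      have hs0 : √(n : ℝ) ≠ 0 := by positivity
      nth_rewrite 3 [← hs]
      field_simp
  · exact hd.forall_aemeasurable n
  · fun_prop

end FullAverage

end CensoredSubsampling
namespace CensoredSubsampling

/-! ### Law of large numbers and the `1 / √r` rate for the subsample averages. -/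

section SubsampleAverage

variable {Ω : Type*} [MeasurableSpace Ω] {P : Measure Ω} [IsProbabilityMeasure P]
  {x : ℕ → Ω → Obs} {Q : Measure Obs} {h : Obs → ℝ}
  {r : ℕ → ℕ} {π : ℕ → ℕ → Ω → ℝ} {a : ℕ → ℕ → Ω → ℕ}

/-- The inverse-probability weighted average of `h` over the subsample. -/
noncomputable def subAvg (x : ℕ → Ω → Obs) (r : ℕ → ℕ) (π : ℕ → ℕ → Ω → ℝ) (a : ℕ → ℕ → Ω → ℕ)
    (h : Obs → ℝ) (n : ℕ) (ω : Ω) : ℝ :=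
  (1 / (r n : ℝ)) * ∑ j ∈ Finset.range (r n),
    ((n : ℝ) * π n (a n j ω) ω)⁻¹ * h (x (a n j ω) ω)

/-- The event that the weights `(n π_i)⁻¹` are at most `K`. -/
def weightsLE (π : ℕ → ℕ → Ω → ℝ) (K : NNReal) (n : ℕ) : Set Ω :=
  {ω | ∀ i : Fin n, ((n : ℝ) * π n i ω)⁻¹ ≤ K}

/-- The weights are only bounded in probability, so moments involving them are taken on `weightsLE`.
That event depends on the data alone, so it can be kept when conditioning. -/
theorem exists_measure_compl_weightsLE_le
    (hπ : BoundedInProb P fun n ω => ⨆ i : Fin n, ((n : ℝ) * π n i ω)⁻¹) (ε : ℝ) (hε : 0 < ε) :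
    ∃ K : NNReal, ∀ᶠ n in atTop, P (weightsLE π K n)ᶜ ≤ ENNReal.ofReal ε := by
  obtain ⟨K, hK⟩ := hπ ε hε
  refine ⟨K.toNNReal, ?_⟩
  filter_upwards [hK] with n hn
  refine (measure_mono fun ω hω => ?_).trans hn
  simp only [weightsLE, Set.mem_compl_iff, Set.mem_ofPred_eq, not_forall, not_le] at hω ⊢
  obtain ⟨i, hi⟩ := hω
  calc K ≤ K.toNNReal := Real.le_coe_toNNReal K
    _ < ((n : ℝ) * π n i ω)⁻¹ := hi
    _ ≤ ⨆ i : Fin n, ((n : ℝ) * π n i ω)⁻¹ :=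
        le_ciSup (f := fun i : Fin n => ((n : ℝ) * π n i ω)⁻¹) (Set.finite_range _).bddAbove i
    _ ≤ _ := le_abs_self _

theorem fullAvg_eq_sum_fin (n : ℕ) (ω : Ω) :
    fullAvg x h n ω = (1 / (n : ℝ)) * ∑ i : Fin n, h (x i ω) := by
  rw [fullAvg, Finset.sum_range]

theorem subAvg_eq_of_mem_selected {n : ℕ} {s : Fin (r n) → Fin n} {ω : Ω}
    (hs : ω ∈ IsGeneralSubsampling.selected r a n s) :
    subAvg x r π a h n ω =
      (1 / (r n : ℝ)) * ∑ j, ((n : ℝ) * π n (s j) ω)⁻¹ * h (x (s j) ω) := by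
  rw [subAvg, Finset.sum_range]
  congr 1
  refine Finset.sum_congr rfl fun j _ => ?_
  rw [show a n j ω = s j from hs j]

namespace IsGeneralSubsampling

variable (hsub : IsGeneralSubsampling P x r π a) (hx : ∀ i, Measurable (x i))
include hsub

theorem measurableSet_weightsLE (K : NNReal) (n : ℕ) :
    MeasurableSet[dataSigma x n] (weightsLE π K n) := by
  have : weightsLE π K n = ⋂ i : Fin n, {ω | ((n : ℝ) * π n i ω)⁻¹ ≤ K} := by
    ext ω
    simp [weightsLE]
  rw [this]
  refine MeasurableSet.iInter fun i => ?_
  exact @measurableSet_le _ _ _ _ _ (dataSigma x n) _ _ _ _ _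
    (((hsub.measurable_prob n i i.2).const_mul _).inv) measurable_const

theorem measurable_weighted (hh : Measurable h) (n : ℕ) (i : Fin n) :
    Measurable[dataSigma x n] fun ω => ((n : ℝ) * π n i ω)⁻¹ * h (x i ω) :=
  (((hsub.measurable_prob n i i.2).const_mul _).inv).mul (hh.comp (measurable_dataSigma n i))

/-- Unbiasedness of inverse-probability weighting: the sampling probability cancels against the
weight. -/
theorem sum_prob_mul_weighted (n : ℕ) (ω : Ω) :
    ∑ i : Fin n, π n i ω * (((n : ℝ) * π n i ω)⁻¹ * h (x i ω)) = fullAvg x h n ω := by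
  rw [fullAvg_eq_sum_fin, Finset.mul_sum]
  refine Finset.sum_congr rfl fun i _ => ?_
  have := (hsub.prob_pos n i ω i.2).ne'
  have hn : (n : ℝ) ≠ 0 := by have := i.pos; positivity
  field_simp

include hx

/-- Only almost everywhere, since measurability of `π n i` is available for `i < n` alone; outside
the selection events an index may exceed that range. -/
theorem aemeasurable_subAvg (hh : Measurable h) (n : ℕ) :
    AEMeasurable (subAvg x r π a h n) P := by
  rcases Nat.eq_zero_or_pos n with rfl | hn
  · have : subAvg x r π a h 0 = fun _ => 0 := by
      funext ω
      simp [subAvg]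
    rw [this]
    exact aemeasurable_const
  refine ⟨fun ω => ∑ s, (selected r a n s).indicator
    (fun ω => (1 / (r n : ℝ)) * ∑ j, ((n : ℝ) * π n (s j) ω)⁻¹ * h (x (s j) ω)) ω, ?_, ?_⟩
  · refine Finset.measurable_fun_sum _ fun s _ =>
      Measurable.indicator ?_ (hsub.measurableSet_selected n s)
    exact (Finset.measurable_fun_sum _ fun j _ =>
      (hsub.measurable_weighted hh n (s j)).mono (dataSigma_le hx n) le_rfl).const_mul _
  · filter_upwards [hsub.ae_exists_selected hx hn] with ω ⟨s, hs⟩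
    rw [Finset.sum_eq_single s, Set.indicator_of_mem hs, subAvg_eq_of_mem_selected hs]
    · intro t _ hts
      exact Set.indicator_of_notMem
        (fun ht => Set.disjoint_left.1 (hsub.disjoint_selected n hts) ht hs) _
    · simp

/-- The conditional variance bound for the subsample average. -/
theorem setLIntegral_sub_sq_le (hlaw : ∀ i, P.map (x i) = Q) (hhm : Measurable h)
    (hh : MemLp h 2 Q) (K : NNReal) {n : ℕ} (hn : 1 ≤ n) (hr : 1 ≤ r n) :
    ∫⁻ ω in weightsLE π K n, ENNReal.ofReal ((subAvg x r π a h n ω - fullAvg x h n ω) ^ 2) ∂P ≤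
      ENNReal.ofReal (K / r n * ∫ z, h z ^ 2 ∂Q) := by
  have hm := dataSigma_le hx n
  have hA := hsub.measurableSet_weightsLE K n
  have hfull : Measurable[dataSigma x n] (fullAvg x h n) := by
    have : fullAvg x h n = fun ω => (1 / (n : ℝ)) * ∑ i : Fin n, h (x i ω) := by
      funext ω
      exact fullAvg_eq_sum_fin n ω
    rw [this]
    exact (Finset.measurable_fun_sum _ fun i _ => hhm.comp (measurable_dataSigma n i)).const_mul _
  have h2 : Integrable (fun z => h z ^ 2) Q := hh.integrable_sq
  rw [← lintegral_indicator (hm _ hA), hsub.lintegral_eq hx hn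
    (F := fun s => (weightsLE π K n).indicator fun ω => ENNReal.ofReal
      (((1 / (r n : ℝ)) * ∑ j, ((n : ℝ) * π n (s j) ω)⁻¹ * h (x (s j) ω) - fullAvg x h n ω) ^ 2))]
  rotate_left
  · intro s
    refine Measurable.indicator (m := dataSigma x n) ?_ hA
    exact ((((Finset.measurable_fun_sum _ fun j _ =>
      hsub.measurable_weighted hhm n (s j)).const_mul _).sub hfull).pow_const 2).ennreal_ofReal
  · intro s ω hs
    simp only [Set.indicator, subAvg_eq_of_mem_selected hs]
  rw [← integral_fullAvg hx hlaw h2 hn, ← integral_const_mul,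
    ofReal_integral_eq_lintegral_ofReal ((integrable_fullAvg hx hlaw h2 n).const_mul _)
      (Eventually.of_forall fun ω => by
        have : 0 ≤ fullAvg x (fun z => h z ^ 2) n ω := by
          unfold fullAvg
          positivity
        exact mul_nonneg (by positivity) this)]
  refine lintegral_mono fun ω => ?_
  by_cases hω : ω ∈ weightsLE π K n
  · simp only [Set.indicator_of_mem hω]
    simp_rw [← ENNReal.ofReal_mul (hsub.prod_prob_nonneg n _ ω)]
    rw [← ENNReal.ofReal_sum_of_nonneg fun (s : Fin (r n) → Fin n) _ =>
      mul_nonneg (hsub.prod_prob_nonneg n s ω) (sq_nonneg _)]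
    refine ENNReal.ofReal_le_ofReal ?_
    have := sum_prod_mul_sub_sq_le (p := fun i : Fin n => π n i ω)
      (y := fun i : Fin n => ((n : ℝ) * π n i ω)⁻¹ * h (x i ω)) (hsub.sum_prob_fin hn ω) hr
    rw [hsub.sum_prob_mul_weighted] at this
    refine this.trans ?_
    rw [fullAvg_eq_sum_fin, div_eq_mul_one_div (K : ℝ), mul_comm (K : ℝ), mul_assoc]
    refine mul_le_mul_of_nonneg_left ?_ (one_div_nonneg.2 (Nat.cast_nonneg _))
    rw [Finset.mul_sum, Finset.mul_sum]
    refine Finset.sum_le_sum fun i _ => ?_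
    have hp := hsub.prob_pos n i ω i.2
    have hn0 : (0 : ℝ) < n := by positivity
    -- One of the two weights cancels against the probability of the draw; the remaining one is
    -- bounded by `K`.
    have e : π n i ω * (((n : ℝ) * π n i ω)⁻¹ * h (x i ω)) ^ 2 =
        ((n : ℝ) * π n i ω)⁻¹ * (1 / (n : ℝ) * h (x i ω) ^ 2) := by
      field_simp
    rw [e]
    exact mul_le_mul_of_nonneg_right (hω i) (by positivity)
  · simp [Set.indicator, hω]

variable (hπ : BoundedInProb P fun n ω => ⨆ i : Fin n, ((n : ℝ) * π n i ω)⁻¹)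
  (hr : Tendsto r atTop atTop)
include hπ hr

theorem tendsto_subAvg_sub_fullAvg (hlaw : ∀ i, P.map (x i) = Q) (hhm : Measurable h)
    (hh : MemLp h 2 Q) :
    Tendsto (fun q : ℕ × Ω => subAvg x r π a h q.1 q.2 - fullAvg x h q.1 q.2) (probFilter P)
      (𝓝 0) := by
  have key := tendsto_probFilter_of_lintegral (P := P) (A := weightsLE π)
    (exists_measure_compl_weightsLE_le hπ)
    (fun K n => dataSigma_le hx n _ (hsub.measurableSet_weightsLE K n))
    (T := fun n ω => ENNReal.ofReal ((subAvg x r π a h n ω - fullAvg x h n ω) ^ 2))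
    (fun n => (((hsub.aemeasurable_subAvg hx hhm n).sub
      (measurable_fullAvg hx hhm n).aemeasurable).pow_const 2).ennreal_ofReal) ?_
  · rw [Metric.tendsto_nhds]
    intro ε hε
    filter_upwards [key (ENNReal.ofReal (ε ^ 2)) (by simpa using pow_pos hε 2)] with q hq
    rw [ENNReal.ofReal_lt_ofReal_iff (by positivity)] at hq
    rw [dist_zero_right, Real.norm_eq_abs]
    exact abs_lt_of_sq_lt_sq hq hε.le
  · intro K
    have hlim : Tendsto (fun n => ENNReal.ofReal (K / r n * ∫ z, h z ^ 2 ∂Q)) atTop (𝓝 0) := by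
      rw [← ENNReal.ofReal_zero]
      refine (ENNReal.continuous_ofReal.tendsto 0).comp ?_
      have : Tendsto (fun n => (K : ℝ) / (r n : ℝ)) atTop (𝓝 0) :=
        (tendsto_const_div_atTop_nhds_zero_nat _).comp hr
      simpa using this.mul_const (∫ z, h z ^ 2 ∂Q)
    refine tendsto_of_tendsto_of_tendsto_of_le_of_le' tendsto_const_nhds hlim
      (Eventually.of_forall fun _ => zero_le) ?_
    filter_upwards [eventually_ge_atTop 1, hr.eventually_ge_atTop 1] with n hn hrn
    exact hsub.setLIntegral_sub_sq_le hx hlaw hhm hh K hn hrn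

/-- The law of large numbers for the subsample averages. -/
theorem tendsto_subAvg (hind : iIndepFun x P) (hlaw : ∀ i, P.map (x i) = Q) (hh : MemLp h 2 Q) :
    Tendsto (fun q : ℕ × Ω => subAvg x r π a h q.1 q.2) (probFilter P) (𝓝 (∫ z, h z ∂Q)) := by
  have hQ : IsProbabilityMeasure Q := hlaw 0 ▸ Measure.isProbabilityMeasure_map (hx 0).aemeasurable
  -- The law of large numbers is applied to the log-likelihood, its Hessian and the envelope, which
  -- are only almost everywhere measurable; a measurable version gives the same averages almost
  -- surely.
  wlog hhm : Measurable h generalizing h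
  · have hmk := hh.aestronglyMeasurable.ae_eq_mk
    set g := hh.aestronglyMeasurable.mk h with hg
    have := this (h := g) ((memLp_congr_ae hmk).1 hh)
      hh.aestronglyMeasurable.stronglyMeasurable_mk.measurable
    rw [integral_congr_ae hmk]
    refine this.congr' ?_
    refine eventually_probFilter_of_ae (p := fun n ω => subAvg x r π a g n ω =
      subAvg x r π a h n ω) (Eventually.of_forall fun n => ?_)
    have hall : ∀ᵐ ω ∂P, ∀ i, h (x i ω) = g (x i ω) := by
      rw [ae_all_iff]
      intro i
      rw [← hlaw i] at hmk
      exact ae_of_ae_map (hx i).aemeasurable hmk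
    filter_upwards [hall] with ω hω
    simp only [subAvg, hω]
  have h1 := hsub.tendsto_subAvg_sub_fullAvg hx hπ hr hlaw hhm hh
  have h2 := tendsto_fullAvg hx hind hlaw hhm (hh.integrable one_le_two)
  simpa using h1.add h2

/-- Centred subsample averages are of order `1 / √r` in probability. -/
theorem boundedInProb_sqrt_mul_subAvg (hind : iIndepFun x P) (hlaw : ∀ i, P.map (x i) = Q)
    (hhm : Measurable h) (hh : MemLp h 2 Q) (h0 : ∫ z, h z ∂Q = 0) {γ : ℝ}
    (hγ : Tendsto (fun n => (r n : ℝ) / (n : ℝ)) atTop (𝓝 γ)) :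
    BoundedInProb P fun n ω => √(r n) * subAvg x r π a h n ω := by
  have hsq : ∀ (n : ℕ) (y : ℝ), (√(r n) * y) ^ 2 = r n * y ^ 2 := fun n y => by
    rw [mul_pow, Real.sq_sqrt (Nat.cast_nonneg _)]
  -- Sampling noise, controlled through the conditional variance; the noise of the data themselves
  -- is `h2`.
  have h1 : BoundedInProb P fun n ω => √(r n) * (subAvg x r π a h n ω - fullAvg x h n ω) := by
    refine boundedInProb_of_lintegral (A := weightsLE π) (exists_measure_compl_weightsLE_le hπ)
      (fun K n => dataSigma_le hx n _ (hsub.measurableSet_weightsLE K n))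
      (fun n => ((hsub.aemeasurable_subAvg hx hhm n).sub
        (measurable_fullAvg hx hhm n).aemeasurable).const_mul _) fun K => ?_
    refine ⟨K * ∫ z, h z ^ 2 ∂Q, ?_⟩
    filter_upwards [eventually_ge_atTop 1, hr.eventually_ge_atTop 1] with n hn hrn
    have hrpos : (0 : ℝ) < r n := by positivity
    simp_rw [hsq, ENNReal.ofReal_mul hrpos.le]
    rw [lintegral_const_mul' _ _ ENNReal.ofReal_ne_top]
    refine (mul_le_mul_right (hsub.setLIntegral_sub_sq_le hx hlaw hhm hh K hn hrn) _).trans ?_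
    rw [← ENNReal.ofReal_mul hrpos.le]
    refine ENNReal.ofReal_le_ofReal (le_of_eq ?_)
    field_simp
  have h2 : BoundedInProb P fun n ω => √(r n) * fullAvg x h n ω := by
    refine boundedInProb_of_lintegral (ι := Unit) (A := fun _ _ => Set.univ)
      (fun ε _ => ⟨(), Eventually.of_forall fun n => by simp⟩) (fun _ _ => MeasurableSet.univ)
      (fun n => ((measurable_fullAvg hx hhm n).const_mul _).aemeasurable) fun _ => ?_
    -- The second moment of `√r fullAvg h` is `(r/n) ∫ h²`, and `r/n` is eventually below `γ + 1`.
    refine ⟨(γ + 1) * ∫ z, h z ^ 2 ∂Q, ?_⟩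
    filter_upwards [eventually_ge_atTop 1, hγ.eventually_lt_const (lt_add_one γ)] with n hn hn'
    have hi : Integrable (fun ω => fullAvg x h n ω ^ 2) P := by
      have hmem : ∀ i, MemLp (fun ω => h (x i ω)) 2 P := fun i =>
        MemLp.comp_of_map (g := h) (by rwa [hlaw i]) (hx i).aemeasurable
      have hsum : MemLp (fun ω => ∑ i ∈ Finset.range n, h (x i ω)) 2 P :=
        memLp_finsetSum _ fun i _ => hmem i
      exact (hsum.const_mul (1 / (n : ℝ))).integrable_sq
    rw [setLIntegral_univ]
    simp_rw [hsq]
    rw [← ofReal_integral_eq_lintegral_ofReal (hi.const_mul _)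
      (Eventually.of_forall fun ω => by positivity), integral_const_mul,
      integral_fullAvg_sq hx hind hlaw hhm hh h0 hn, ← mul_assoc, mul_one_div]
    exact ENNReal.ofReal_le_ofReal (mul_le_mul_of_nonneg_right hn'.le
      (integral_nonneg fun z => sq_nonneg _))
  refine (h1.add h2).mono fun n ω => le_of_eq ?_
  congr 1
  ring

end IsGeneralSubsampling

end SubsampleAverage

end CensoredSubsampling
namespace CensoredSubsampling

/-! ### Central limit theorem for the subsample averages. -/

namespace IsGeneralSubsampling

variable {Ω : Type*} [MeasurableSpace Ω] {P : Measure Ω} [IsProbabilityMeasure P]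
  {x : ℕ → Ω → Obs} {Q : Measure Obs} {h : Obs → ℝ}
  {r : ℕ → ℕ} {π : ℕ → ℕ → Ω → ℝ} {a : ℕ → ℕ → Ω → ℕ}

/-- The weighted value `h(x_i) / (n π_i)` on the scale `1 / √r`. -/
noncomputable def scaledValue (x : ℕ → Ω → Obs) (r : ℕ → ℕ) (π : ℕ → ℕ → Ω → ℝ) (h : Obs → ℝ)
    (n : ℕ) (i : Fin n) (ω : Ω) : ℝ :=
  (√(r n))⁻¹ * (((n : ℝ) * π n i ω)⁻¹ * h (x i ω))

variable (hsub : IsGeneralSubsampling P x r π a) (hx : ∀ i, Measurable (x i))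
include hsub

theorem measurable_scaledValue (hh : Measurable h) (n : ℕ) (i : Fin n) :
    Measurable[dataSigma x n] (scaledValue x r π h n i) :=
  (hsub.measurable_weighted hh n i).const_mul _

theorem sum_prob_mul_scaledValue (n : ℕ) (ω : Ω) :
    ∑ i : Fin n, π n i ω * scaledValue x r π h n i ω = (√(r n))⁻¹ * fullAvg x h n ω := by
  rw [← hsub.sum_prob_mul_weighted, Finset.mul_sum]
  exact Finset.sum_congr rfl fun i _ => by rw [scaledValue]; ring

theorem prob_mul_weighted_sq (n : ℕ) (i : Fin n) (ω : Ω) :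
    π n i ω * (((n : ℝ) * π n i ω)⁻¹ * h (x i ω)) ^ 2 =
      ((n : ℝ) * π n i ω)⁻¹ * (1 / (n : ℝ) * h (x i ω) ^ 2) := by
  have := (hsub.prob_pos n i ω i.2).ne'
  have hn : (n : ℝ) ≠ 0 := by have := i.pos; positivity
  field_simp

theorem sum_prob_mul_scaledValue_sq (n : ℕ) (ω : Ω) :
    ∑ i : Fin n, π n i ω * scaledValue x r π h n i ω ^ 2 =
      (r n : ℝ)⁻¹ * ((1 / (n : ℝ) ^ 2) *
        ∑ i ∈ Finset.range n, (1 / π n i ω) * h (x i ω) ^ 2) := by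
  rw [Finset.sum_range, Finset.mul_sum, Finset.mul_sum]
  refine Finset.sum_congr rfl fun i _ => ?_
  rw [scaledValue, mul_pow, inv_pow, Real.sq_sqrt (Nat.cast_nonneg _), mul_left_comm,
    hsub.prob_mul_weighted_sq]
  have := (hsub.prob_pos n i ω i.2).ne'
  have hn : (n : ℝ) ≠ 0 := by have := i.pos; positivity
  field_simp

include hx

/-- The Lindeberg condition holds in probability. -/
theorem tendsto_lindeberg (hπ : BoundedInProb P fun n ω => ⨆ i : Fin n, ((n : ℝ) * π n i ω)⁻¹)
    (hr : Tendsto r atTop atTop) (hlaw : ∀ i, P.map (x i) = Q) (hhm : Measurable h)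
    (hh : MemLp h 2 Q) :
    Tendsto (fun q : ℕ × Ω => (r q.1 : ℝ) * ∑ i : Fin q.1, π q.1 i q.2 *
      (scaledValue x r π h q.1 i q.2 ^ 2 * min 1 |scaledValue x r π h q.1 i q.2|))
      (probFilter P) (𝓝 0) := by
  have hQ : IsProbabilityMeasure Q := hlaw 0 ▸ Measure.isProbabilityMeasure_map (hx 0).aemeasurable
  set T : ℕ → Ω → ℝ := fun n ω => (r n : ℝ) * ∑ i : Fin n, π n i ω *
      (scaledValue x r π h n i ω ^ 2 * min 1 |scaledValue x r π h n i ω|) with hT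
  have hT0 : ∀ n ω, 0 ≤ T n ω := fun n ω => mul_nonneg (Nat.cast_nonneg _)
    (Finset.sum_nonneg fun i _ => mul_nonneg (hsub.prob_pos n i ω i.2).le (by positivity))
  have hTm : ∀ n, Measurable (T n) := by
    intro n
    refine (Finset.measurable_fun_sum _ fun i _ => ?_).const_mul _
    have h1 := (hsub.measurable_scaledValue hhm n i).mono (dataSigma_le hx n) le_rfl
    have h2 := (hsub.measurable_prob n i i.2).mono (dataSigma_le hx n) le_rfl
    exact h2.mul ((h1.pow_const 2).mul (measurable_const.min h1.abs))
  have key := tendsto_probFilter_of_lintegral (P := P) (A := weightsLE π)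
    (exists_measure_compl_weightsLE_le hπ)
    (fun K n => dataSigma_le hx n _ (hsub.measurableSet_weightsLE K n))
    (T := fun n ω => ENNReal.ofReal (T n ω))
    (fun n => (hTm n).ennreal_ofReal.aemeasurable) ?_
  · rw [Metric.tendsto_nhds]
    intro ε hε
    filter_upwards [key (ENNReal.ofReal ε) (by simpa using hε)] with q hq
    rw [ENNReal.ofReal_lt_ofReal_iff hε] at hq
    rw [dist_zero_right, Real.norm_of_nonneg (hT0 q.1 q.2)]
    exact hq
  · intro K
    -- Replacing every weight by `K` bounds the Lindeberg sum by a full-data average of `g n`. Its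
    -- expectation `∫ g n` tends to zero by dominated convergence under `K h²`.
    set g : ℕ → Obs → ℝ := fun n z => K * (h z ^ 2 * min 1 ((√(r n))⁻¹ * (K * |h z|))) with hg
    have hgm : ∀ n, Measurable (g n) := fun n => by fun_prop
    have hgb : ∀ n z, ‖g n z‖ ≤ K * h z ^ 2 := by
      intro n z
      have h1 : 0 ≤ min 1 ((√(r n : ℝ))⁻¹ * (K * |h z|)) := by positivity
      rw [Real.norm_of_nonneg (by positivity)]
      refine mul_le_mul_of_nonneg_left ?_ K.2
      exact mul_le_of_le_one_right (sq_nonneg _) (min_le_left _ _)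
    have hgi : ∀ n, Integrable (g n) Q := fun n =>
      (hh.integrable_sq.const_mul (K : ℝ)).mono' (hgm n).aestronglyMeasurable
        (Eventually.of_forall (hgb n))
    have hlim0 : Tendsto (fun n => ∫ z, g n z ∂Q) atTop (𝓝 0) := by
      rw [← integral_zero Obs ℝ (μ := Q)]
      refine tendsto_integral_of_dominated_convergence (fun z => K * h z ^ 2)
        (fun n => (hgm n).aestronglyMeasurable) (hh.integrable_sq.const_mul _)
        (fun n => Eventually.of_forall (hgb n)) (Eventually.of_forall fun z => ?_)
      have h1 : Tendsto (fun n => (√(r n : ℝ))⁻¹) atTop (𝓝 0) :=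
        tendsto_inv_atTop_zero.comp
          (Real.tendsto_sqrt_atTop.comp (tendsto_natCast_atTop_atTop.comp hr))
      have h2 := (tendsto_const_nhds (x := (1 : ℝ))).min (h1.mul_const (K * |h z|))
      rw [zero_mul, min_eq_right zero_le_one] at h2
      simpa using (h2.const_mul (h z ^ 2)).const_mul (K : ℝ)
    have hlim : Tendsto (fun n => ENNReal.ofReal (∫ z, g n z ∂Q)) atTop (𝓝 0) := by
      rw [← ENNReal.ofReal_zero]
      exact (ENNReal.continuous_ofReal.tendsto 0).comp hlim0
    refine tendsto_of_tendsto_of_tendsto_of_le_of_le' tendsto_const_nhds hlim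
      (Eventually.of_forall fun _ => zero_le) ?_
    filter_upwards [eventually_ge_atTop 1, hr.eventually_ge_atTop 1] with n hn hrn
    have hm := dataSigma_le hx n
    rw [← integral_fullAvg hx hlaw (hgi n) hn,
      ofReal_integral_eq_lintegral_ofReal (integrable_fullAvg hx hlaw (hgi n) n)
      (Eventually.of_forall fun ω => by
        change 0 ≤ fullAvg x (g n) n ω
        unfold fullAvg
        positivity)]
    rw [← lintegral_indicator (hm _ (hsub.measurableSet_weightsLE K n))]
    refine lintegral_mono fun ω => ?_
    by_cases hω : ω ∈ weightsLE π K n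
    · rw [Set.indicator_of_mem hω]
      refine ENNReal.ofReal_le_ofReal ?_
      simp only [hT]
      rw [fullAvg_eq_sum_fin, Finset.mul_sum, Finset.mul_sum]
      refine Finset.sum_le_sum fun i _ => ?_
      have hrpos : (0 : ℝ) < r n := by positivity
      have hy0 : 0 ≤ ((n : ℝ) * π n i ω)⁻¹ := by
        have := (hsub.prob_pos n i ω i.2).le
        positivity
      have hsq : (r n : ℝ) * (π n i ω * scaledValue x r π h n i ω ^ 2) =
          ((n : ℝ) * π n i ω)⁻¹ * (1 / (n : ℝ) * h (x i ω) ^ 2) := by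
        rw [scaledValue, mul_pow, inv_pow, Real.sq_sqrt (Nat.cast_nonneg _), mul_left_comm (π n i ω),
          hsub.prob_mul_weighted_sq]
        field_simp
      have habs : |scaledValue x r π h n i ω| ≤ (√(r n))⁻¹ * (K * |h (x i ω)|) := by
        rw [scaledValue, abs_mul, abs_mul, abs_of_nonneg (by positivity), abs_of_nonneg hy0]
        gcongr
        exact hω i
      calc (r n : ℝ) * (π n i ω *
            (scaledValue x r π h n i ω ^ 2 * min 1 |scaledValue x r π h n i ω|))
          = (r n : ℝ) * (π n i ω * scaledValue x r π h n i ω ^ 2) *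
              min 1 |scaledValue x r π h n i ω| := by ring
        _ ≤ (K * (1 / (n : ℝ) * h (x i ω) ^ 2)) * min 1 ((√(r n))⁻¹ * (K * |h (x i ω)|)) := by
            rw [hsq]
            gcongr
            exact hω i
        _ = 1 / (n : ℝ) * g n (x i ω) := by
            simp only [hg]
            ring
    · simp [Set.indicator, hω]

/-- Conditionally on the data the draws are independent and identically distributed, so this is an
exact identity and not yet an approximation. -/
theorem integral_exp_subAvg_eq (hhm : Measurable h) {n : ℕ} (hn : 1 ≤ n) (hrn : 1 ≤ r n) :
    ∫ ω, Complex.exp ((√(r n) * subAvg x r π a h n ω : ℝ) * Complex.I) ∂P =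
      ∫ ω, (∑ i : Fin n, (π n i ω : ℂ) *
        Complex.exp (scaledValue x r π h n i ω * Complex.I)) ^ r n ∂P := by
  have hm := dataSigma_le hx n
  have hrpos : (0 : ℝ) < r n := by positivity
  rw [hsub.integral_eq hx hn (C := 1)
    (F := fun s ω => Complex.exp (∑ j, (scaledValue x r π h n (s j) ω * Complex.I)))]
  · refine integral_congr_ae (Eventually.of_forall fun ω => ?_)
    simp only
    rw [← sum_prod_mul_exp_sum]
    push_cast
    rfl
  · intro s
    refine Complex.measurable_exp.comp (Finset.measurable_fun_sum _ fun j _ => ?_)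
    exact (Complex.measurable_ofReal.comp (hsub.measurable_scaledValue hhm n (s j))).mul_const _
  · intro s ω
    rw [← Finset.sum_mul, ← Complex.ofReal_sum, Complex.norm_exp_ofReal_mul_I]
  · intro s ω hs
    rw [subAvg_eq_of_mem_selected hs, ← Finset.sum_mul, ← Complex.ofReal_sum]
    congr 3
    have hs0 : √(r n : ℝ) ≠ 0 := by positivity
    have hss : (r n : ℝ) = √(r n) * √(r n) := (Real.mul_self_sqrt hrpos.le).symm
    simp only [scaledValue]
    rw [← Finset.mul_sum, ← mul_assoc]
    congr 1
    nth_rewrite 2 [hss]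
    field_simp

/-- The central limit theorem for the subsample averages, in terms of characteristic functions. -/
theorem tendsto_integral_exp_subAvg
    (hπ : BoundedInProb P fun n ω => ⨆ i : Fin n, ((n : ℝ) * π n i ω)⁻¹)
    (hr : Tendsto r atTop atTop) (hind : iIndepFun x P) (hlaw : ∀ i, P.map (x i) = Q)
    (hhm : Measurable h) (hh : MemLp h 2 Q) (h0 : ∫ z, h z ∂Q = 0) {γ : ℝ}
    (hγ : Tendsto (fun n => (r n : ℝ) / (n : ℝ)) atTop (𝓝 γ)) {v : ℝ}
    (hv : Tendsto (fun q : ℕ × Ω => (1 / (q.1 : ℝ) ^ 2) *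
      ∑ i ∈ Finset.range q.1, (1 / π q.1 i q.2) * h (x i q.2) ^ 2) (probFilter P) (𝓝 v)) :
    Tendsto (fun n => ∫ ω, Complex.exp ((√(r n) * subAvg x r π a h n ω : ℝ) * Complex.I) ∂P)
      atTop (𝓝 (Complex.exp (-(v + γ * ∫ z, h z ^ 2 ∂Q) / 2 : ℝ))) := by
  have hQ : IsProbabilityMeasure Q := hlaw 0 ▸ Measure.isProbabilityMeasure_map (hx 0).aemeasurable
  set V : ℕ → Ω → ℝ := fun n ω => (1 / (n : ℝ) ^ 2) *
      ∑ i ∈ Finset.range n, (1 / π n i ω) * h (x i ω) ^ 2 with hV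
  change Tendsto (fun q : ℕ × Ω => V q.1 q.2) (probFilter P) (𝓝 v) at hv
  set φ : ℕ → Ω → ℂ := fun n ω => ∑ i : Fin n, (π n i ω : ℂ) *
        Complex.exp (scaledValue x r π h n i ω * Complex.I) with hφ
  set E : ℕ → Ω → ℂ := fun n ω => Complex.exp ((√(r n) * fullAvg x h n ω : ℝ) * Complex.I) with hE
  have hE1 : ∀ n ω, ‖E n ω‖ = 1 := fun n ω => Complex.norm_exp_ofReal_mul_I _
  have hφ1 : ∀ n ω, 1 ≤ n → ‖φ n ω‖ ≤ 1 := by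
    intro n ω hn
    refine (norm_sum_le _ _).trans (le_of_eq ?_)
    rw [← hsub.sum_prob_fin hn ω]
    refine Finset.sum_congr rfl fun i _ => ?_
    rw [norm_mul, Complex.norm_exp_ofReal_mul_I, mul_one, Complex.norm_real,
      Real.norm_of_nonneg (hsub.prob_pos n i ω i.2).le]
  have hrlim : Tendsto (fun q : ℕ × Ω => ((r q.1 : ℝ))⁻¹) (probFilter P) (𝓝 0) :=
    (tendsto_inv_atTop_zero.comp (tendsto_natCast_atTop_atTop.comp hr)).comp tendsto_fst_probFilter
  have hgood : ∀ᶠ q : ℕ × Ω in probFilter P, 1 ≤ q.1 ∧ 1 ≤ r q.1 :=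
    tendsto_fst_probFilter.eventually
      ((eventually_ge_atTop 1).and (hr.eventually_ge_atTop 1))
  -- The three errors are the Lindeberg sum, `r m² = fullAvg²`, and `r s² / 4 = V² / (4 r)`. The
  -- second vanishes because `h` has mean zero, the third because `V` converges.
  have hstep1 : Tendsto (fun q : ℕ × Ω => φ q.1 q.2 ^ r q.1 -
      E q.1 q.2 * Complex.exp (-(V q.1 q.2) / 2 : ℝ)) (probFilter P) (𝓝 0) := by
    have hfull := tendsto_fullAvg hx hind hlaw hhm (hh.integrable one_le_two)
    rw [h0] at hfull
    have hbound : Tendsto (fun q : ℕ × Ω => 4 * ((r q.1 : ℝ) * ∑ i : Fin q.1, π q.1 i q.2 *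
      (scaledValue x r π h q.1 i q.2 ^ 2 * min 1 |scaledValue x r π h q.1 i q.2|)) +
      3 * (fullAvg x h q.1 q.2 ^ 2 + V q.1 q.2 ^ 2 / 4 * (r q.1 : ℝ)⁻¹)) (probFilter P) (𝓝 0) := by
      have := ((hsub.tendsto_lindeberg hx hπ hr hlaw hhm hh).const_mul 4).add
        (((hfull.pow 2).add (((hv.pow 2).div_const 4).mul hrlim)).const_mul 3)
      simpa using this
    refine squeeze_zero_norm' ?_ hbound
    filter_upwards [hgood] with ⟨n, ω⟩ ⟨hn, hrn⟩
    have hrpos : (0 : ℝ) < r n := by positivity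
    have hs0 : √(r n : ℝ) ≠ 0 := by positivity
    have hss : (r n : ℝ) = √(r n) * √(r n) := (Real.mul_self_sqrt hrpos.le).symm
    have := norm_sum_mul_exp_pow_sub_exp_le (p := fun i : Fin n => π n i ω)
      (u := fun i => scaledValue x r π h n i ω) (fun i => (hsub.prob_pos n i ω i.2).le)
      (hsub.sum_prob_fin hn ω) (hsub.sum_prob_mul_scaledValue n ω)
      (hsub.sum_prob_mul_scaledValue_sq n ω) (r n)
    simp only
    have e1 : E n ω * Complex.exp (-(V n ω) / 2 : ℝ) =
        Complex.exp (r n * (((√(r n))⁻¹ * fullAvg x h n ω : ℝ) * Complex.I -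
          ((r n : ℝ)⁻¹ * V n ω : ℝ) / 2)) := by
      rw [hE, ← Complex.exp_add]
      congr 1
      have c1 : (r n : ℂ) * ((√(r n) : ℝ) : ℂ)⁻¹ = (√(r n) : ℝ) := by
        have : (r n : ℝ) * (√(r n))⁻¹ = √(r n) := by
          nth_rewrite 1 [hss]
          field_simp
        exact_mod_cast this
      have c2 : (r n : ℂ) * (r n : ℂ)⁻¹ = 1 := by
        exact mul_inv_cancel₀ (by exact_mod_cast hrpos.ne')
      push_cast
      linear_combination (-(fullAvg x h n ω : ℂ) * Complex.I) * c1 + ((V n ω : ℂ) / 2) * c2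
    rw [e1]
    refine this.trans (le_of_eq ?_)
    have e2 : ((√(r n : ℝ))⁻¹ * fullAvg x h n ω) ^ 2 = (r n : ℝ)⁻¹ * fullAvg x h n ω ^ 2 := by
      rw [mul_pow, inv_pow, Real.sq_sqrt hrpos.le]
    rw [e2]
    simp only [hV]
    field_simp
  -- The random variance is replaced by its constant limit, after which the expectation splits as a
  -- full-data characteristic function times `exp (-v / 2)`.
  have hstep2 : Tendsto (fun q : ℕ × Ω => E q.1 q.2 * Complex.exp (-(V q.1 q.2) / 2 : ℝ) -
      E q.1 q.2 * Complex.exp (-v / 2 : ℝ)) (probFilter P) (𝓝 0) := by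
    have h1 : Tendsto (fun q : ℕ × Ω => Complex.exp (-(V q.1 q.2) / 2 : ℝ) -
        Complex.exp (-v / 2 : ℝ)) (probFilter P) (𝓝 0) := by
      have hc : Continuous fun y : ℝ => Complex.exp (-y / 2 : ℝ) := by fun_prop
      have := ((hc.tendsto v).comp hv).sub_const (Complex.exp (-v / 2 : ℝ))
      simpa using this
    refine squeeze_zero_norm (fun q => ?_) (tendsto_zero_iff_norm_tendsto_zero.1 h1)
    rw [← mul_sub, norm_mul, hE1, one_mul]
  have hZ := hstep1.add hstep2
  simp only [sub_add_sub_cancel, add_zero] at hZ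
  -- Passing to integrals needs a bound valid for every `n`, while `hφ1` is stated for `1 ≤ n`.
  set Z : ℕ → Ω → ℂ := fun n ω => if 1 ≤ n then φ n ω ^ r n - E n ω * Complex.exp (-v / 2 : ℝ)
    else 0 with hZdef
  have hZlim : Tendsto (fun n => ∫ ω, Z n ω ∂P) atTop (𝓝 0) := by
    refine tendsto_integral_of_tendsto_probFilter (C := 1 + ‖Complex.exp (-v / 2 : ℝ)‖) ?_ ?_
    · intro n ω
      simp only [hZdef]
      split_ifs with hn
      · refine (norm_sub_le _ _).trans (add_le_add ?_ ?_)
        · rw [norm_pow]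
          exact pow_le_one₀ (norm_nonneg _) (hφ1 n ω hn)
        · rw [norm_mul, hE1, one_mul]
      · rw [norm_zero]
        positivity
    · refine hZ.congr' ?_
      filter_upwards [hgood] with q hq
      simp only [hZdef, if_pos hq.1]
  have hfullclt := tendsto_integral_exp_fullAvg hx hind hlaw hhm hh h0 hγ
  have hfinal := hZlim.add (hfullclt.mul_const (Complex.exp (-v / 2 : ℝ)))
  have hlimeq : (0 : ℂ) + Complex.exp (-(γ * ∫ z, h z ^ 2 ∂Q) / 2 : ℝ) *
      Complex.exp (-v / 2 : ℝ) = Complex.exp (-(v + γ * ∫ z, h z ^ 2 ∂Q) / 2 : ℝ) := by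
    rw [zero_add, ← Complex.exp_add]
    congr 1
    push_cast
    ring
  rw [hlimeq] at hfinal
  refine hfinal.congr' ?_
  filter_upwards [eventually_ge_atTop 1, hr.eventually_ge_atTop 1] with n hn hrn
  rw [hsub.integral_exp_subAvg_eq hx hhm hn hrn, ← integral_mul_const]
  have hm := dataSigma_le hx n
  have hφm : Measurable (φ n) := by
    refine Finset.measurable_fun_sum _ fun i _ => ?_
    have h1 := (hsub.measurable_scaledValue hhm n i).mono hm le_rfl
    have h2 := (hsub.measurable_prob n i i.2).mono hm le_rfl
    fun_prop
  have hφi : Integrable (fun ω => φ n ω ^ r n) P :=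
    Integrable.of_bound (hφm.pow_const _).aestronglyMeasurable 1
      (Eventually.of_forall fun ω => by
        rw [norm_pow]
        exact pow_le_one₀ (norm_nonneg _) (hφ1 n ω hn))
  have hEi : Integrable (fun ω => E n ω * Complex.exp (-v / 2 : ℝ)) P := by
    refine Integrable.mul_const (Integrable.of_bound ?_ 1 (Eventually.of_forall fun ω =>
      (hE1 n ω).le)) _
    have := measurable_fullAvg hx hhm n
    refine Measurable.aestronglyMeasurable ?_
    fun_prop
  simp only [hZdef, if_pos hn]
  rw [integral_sub hφi hEi, sub_add_cancel]

end IsGeneralSubsampling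

end CensoredSubsampling
namespace CensoredSubsampling

/-! ### The information inequality under censoring and truncation. -/

section InformationInequality

variable {d : ℕ} {f : Param d → ℝ → ℝ} {Θ : Set (Param d)} {θ θ₀ : Param d}
  {G : Measure (EReal × ℝ)}

namespace IsLifetimeDensity

theorem integrable {g : ℝ → ℝ} (hg : IsLifetimeDensity g) : Integrable g := by
  by_contra h
  have := hg.integral_eq_one
  rw [integral_undef h] at this
  exact zero_ne_one this

theorem one_sub_lifetimeCDF (hg : IsLifetimeDensity (f θ)) (t : ℝ) :
    1 - lifetimeCDF f θ t = ∫ s in Set.Ioi t, f θ s := by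
  have := intervalIntegral.integral_Iic_add_Ioi (b := t) hg.integrable.integrableOn
    hg.integrable.integrableOn
  rw [hg.integral_eq_one] at this
  rw [lifetimeCDF]
  linarith

theorem one_sub_lifetimeCDF_nonneg (hg : IsLifetimeDensity (f θ)) (t : ℝ) :
    0 ≤ 1 - lifetimeCDF f θ t := by
  rw [hg.one_sub_lifetimeCDF]
  exact integral_nonneg fun s => hg.nonneg s

theorem setLIntegral_Ioi (hg : IsLifetimeDensity (f θ)) (t : ℝ) :
    ∫⁻ s in Set.Ioi t, ENNReal.ofReal (f θ s) = ENNReal.ofReal (1 - lifetimeCDF f θ t) := by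
  rw [hg.one_sub_lifetimeCDF, ofReal_integral_eq_lintegral_ofReal hg.integrable.integrableOn
    (Eventually.of_forall fun s => hg.nonneg s)]

theorem measurable_lifetimeCDF (hg : IsLifetimeDensity (f θ)) : Measurable (lifetimeCDF f θ) := by
  refine Monotone.measurable fun s t hst => ?_
  exact setIntegral_mono_set hg.integrable.integrableOn (Eventually.of_forall fun s => hg.nonneg s)
    (Set.Iic_subset_Iic.2 hst).eventuallyLE

theorem measurable_likelihood (hg : IsLifetimeDensity (f θ)) :
    Measurable fun z => likelihood f z θ := by
  have h1 := hg.measurable_lifetimeCDF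
  have h2 := hg.measurable
  unfold likelihood
  refine Measurable.div (Measurable.ite ?_ ?_ ?_) ?_
  · exact measurableSet_eq_fun (by fun_prop) measurable_const
  · fun_prop
  · fun_prop
  · fun_prop

end IsLifetimeDensity

theorem logLik_eq_log_likelihood {z : Obs} (h : 0 < likelihood f z θ) :
    logLik f z θ = Real.log (likelihood f z θ) := by
  unfold likelihood at h ⊢
  unfold logLik
  have h2 : 1 - lifetimeCDF f θ z.2.2 ≠ 0 := fun h0 => by simp [h0] at h
  have h1 : (if z.2.1 then 1 - lifetimeCDF f θ z.1 else f θ z.1) ≠ 0 := fun h0 => by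
    simp [h0] at h
  rw [Real.log_div h1 h2]
  split_ifs <;> rfl

/-- With censoring and truncation times fixed, the ratio changes the density `f(·; θ₀)` into `S₀ /
S` times `f(·; θ)` on the uncensored part, and the mass beyond `c` likewise. The total is `S₀ / S *
S`. Only an inequality holds, since `f(·; θ)` may charge points where `f(·; θ₀)` vanishes. -/
theorem lintegral_likelihood_ratio_slice_le (hg : IsLifetimeDensity (f θ))
    (hg₀ : IsLifetimeDensity (f θ₀)) {c : EReal} {u : ℝ} (huc : (u : EReal) ≤ c) :
    ∫⁻ T in Set.Ioi u, ENNReal.ofReal (f θ₀ T) * ENNReal.ofReal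
      (likelihood f (observe (T, c, u)) θ / likelihood f (observe (T, c, u)) θ₀) ≤
    ENNReal.ofReal (1 - lifetimeCDF f θ₀ u) := by
  set S := 1 - lifetimeCDF f θ u with hS
  set S₀ := 1 - lifetimeCDF f θ₀ u with hS₀
  have hS0 : 0 ≤ S := hg.one_sub_lifetimeCDF_nonneg u
  have hS₀0 : 0 ≤ S₀ := hg₀.one_sub_lifetimeCDF_nonneg u
  -- If `S = 0`, this quotient is zero by convention, and so is the likelihood at `θ`; the bounds
  -- below then remain true.
  have hκ : 0 ≤ S₀ / S := by positivity
  set C : Set ℝ := {T | c < (T : EReal)} with hC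
  have hCm : MeasurableSet C := measurableSet_lt measurable_const (by fun_prop)
  have hCu : C ⊆ Set.Ioi u := fun T hT => by
    have : (u : EReal) < T := huc.trans_lt hT
    exact_mod_cast this
  have hB : ∫⁻ T in Set.Ioi u \ C, ENNReal.ofReal (f θ₀ T) * ENNReal.ofReal
      (likelihood f (observe (T, c, u)) θ / likelihood f (observe (T, c, u)) θ₀) ≤
      ENNReal.ofReal (S₀ / S) * ∫⁻ T in Set.Ioi u \ C, ENNReal.ofReal (f θ T) := by
    rw [← lintegral_const_mul' _ _ ENNReal.ofReal_ne_top]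
    refine setLIntegral_mono' (measurableSet_Ioi.diff hCm) fun T hT => ?_
    have hTc : (T : EReal) ≤ c := not_lt.1 hT.2
    rw [← ENNReal.ofReal_mul (hg₀.nonneg T), ← ENNReal.ofReal_mul hκ]
    refine ENNReal.ofReal_le_ofReal ?_
    simp only [observe, if_pos hTc, likelihood, ← hS, ← hS₀, Bool.false_eq_true, if_false]
    have h0 := hg.nonneg T
    rcases (hg₀.nonneg T).eq_or_lt' with h | h
    · rw [h, zero_mul]
      positivity
    · refine le_of_eq ?_
      field_simp
  have hCle : ∫⁻ T in C, ENNReal.ofReal (f θ₀ T) * ENNReal.ofReal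
      (likelihood f (observe (T, c, u)) θ / likelihood f (observe (T, c, u)) θ₀) ≤
      ENNReal.ofReal (S₀ / S) * ∫⁻ T in C, ENNReal.ofReal (f θ T) := by
    induction c with
    | bot => simp at huc
    | top => simp [hC]
    | coe c =>
      have hCeq : C = Set.Ioi c := by
        ext T
        simp [hC]
      rw [hCeq, hg.setLIntegral_Ioi]
      set ρ := (1 - lifetimeCDF f θ c) / (1 - lifetimeCDF f θ₀ c) with hρ
      have h1 := hg.one_sub_lifetimeCDF_nonneg c
      have h2 := hg₀.one_sub_lifetimeCDF_nonneg c
      have hρ0 : 0 ≤ ρ := div_nonneg h1 h2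
      calc ∫⁻ T in Set.Ioi c, ENNReal.ofReal (f θ₀ T) * ENNReal.ofReal
            (likelihood f (observe (T, (c : EReal), u)) θ /
              likelihood f (observe (T, (c : EReal), u)) θ₀)
          = ∫⁻ T in Set.Ioi c, ENNReal.ofReal (f θ₀ T) * ENNReal.ofReal (S₀ / S * ρ) := by
            refine setLIntegral_congr_fun measurableSet_Ioi fun T hT => ?_
            have hTc : ¬ (T : EReal) ≤ c := by simpa using hT
            simp only [observe, if_neg hTc, likelihood, ← hS, ← hS₀, if_true, EReal.toReal_coe]
            congr 2
            rw [hρ, div_div_div_eq, div_mul_div_comm]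
            ring
        _ = ENNReal.ofReal (1 - lifetimeCDF f θ₀ c) * ENNReal.ofReal (S₀ / S * ρ) := by
            rw [lintegral_mul_const' _ _ ENNReal.ofReal_ne_top, hg₀.setLIntegral_Ioi]
        _ ≤ ENNReal.ofReal (S₀ / S) * ENNReal.ofReal (1 - lifetimeCDF f θ c) := by
            rw [← ENNReal.ofReal_mul h2, ← ENNReal.ofReal_mul hκ]
            refine ENNReal.ofReal_le_ofReal ?_
            rw [mul_left_comm]
            refine mul_le_mul_of_nonneg_left ?_ hκ
            rcases h2.eq_or_lt' with h | h
            · rw [h, zero_mul]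
              exact h1
            · rw [hρ, mul_div_cancel₀ _ h.ne']
  calc ∫⁻ T in Set.Ioi u, ENNReal.ofReal (f θ₀ T) * ENNReal.ofReal
          (likelihood f (observe (T, c, u)) θ / likelihood f (observe (T, c, u)) θ₀)
      = (∫⁻ T in C, ENNReal.ofReal (f θ₀ T) * ENNReal.ofReal
          (likelihood f (observe (T, c, u)) θ / likelihood f (observe (T, c, u)) θ₀)) +
        ∫⁻ T in Set.Ioi u \ C, ENNReal.ofReal (f θ₀ T) * ENNReal.ofReal
          (likelihood f (observe (T, c, u)) θ / likelihood f (observe (T, c, u)) θ₀) := by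
        rw [← lintegral_inter_add_sdiff _ (Set.Ioi u) hCm, Set.inter_eq_self_of_subset_right hCu]
    _ ≤ ENNReal.ofReal (S₀ / S) * ∫⁻ T in Set.Ioi u, ENNReal.ofReal (f θ T) := by
        refine (add_le_add hCle hB).trans (le_of_eq ?_)
        rw [← mul_add, ← lintegral_inter_add_sdiff _ (Set.Ioi u) hCm,
          Set.inter_eq_self_of_subset_right hCu]
    _ ≤ ENNReal.ofReal S₀ := by
        rw [hg.setLIntegral_Ioi, ← hS, ← ENNReal.ofReal_mul hκ]
        refine ENNReal.ofReal_le_ofReal ?_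
        rcases hS0.eq_or_lt' with h | h
        · rw [h, mul_zero]
          exact hS₀0
        · rw [div_mul_cancel₀ _ h.ne']

theorem lintegral_likelihood_ratio_le_one [IsProbabilityMeasure G] (hg : IsLifetimeDensity (f θ))
    (hg₀ : IsLifetimeDensity (f θ₀)) (hG : ∀ᵐ w ∂G, 0 ≤ w.2 ∧ (w.2 : EReal) ≤ w.1) :
    ∫⁻ z, ENNReal.ofReal (likelihood f z θ / likelihood f z θ₀) ∂(obsLaw f θ₀ G) ≤ 1 := by
  have hR : Measurable fun z => ENNReal.ofReal (likelihood f z θ / likelihood f z θ₀) :=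
    (hg.measurable_likelihood.div hg₀.measurable_likelihood).ennreal_ofReal
  have hA : MeasurableSet {w : ℝ × EReal × ℝ | w.2.2 < w.1} :=
    measurableSet_lt (by fun_prop) (by fun_prop)
  have : SFinite (lifetimeLaw f θ₀) := by
    unfold lifetimeLaw
    infer_instance
  rw [obsLaw, lintegral_map hR measurable_observe, ProbabilityTheory.cond,
    lintegral_smul_measure, smul_eq_mul]
  -- The normalizing constant of the conditioning is the mass of `t_l < T`, so it remains to bound
  -- the unnormalized integral by that mass, slice by slice in the second factor.
  refine (mul_le_mul_right ?_ _).trans (ENNReal.inv_mul_le_one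
    ((lifetimeLaw f θ₀).prod G {w : ℝ × EReal × ℝ | w.2.2 < w.1}))
  have hRo : Measurable fun w => ENNReal.ofReal (likelihood f (observe w) θ /
      likelihood f (observe w) θ₀) := hR.comp measurable_observe
  rw [← lintegral_indicator hA, lintegral_prod_symm _ (hRo.indicator hA).aemeasurable,
    Measure.prod_apply_symm hA]
  refine lintegral_mono_ae ?_
  filter_upwards [hG] with w hw
  have hpre : (fun T : ℝ => (T, w)) ⁻¹' {w : ℝ × EReal × ℝ | w.2.2 < w.1} = Set.Ioi w.2 := by
    ext T
    simp
  have hd : Measurable fun t => ENNReal.ofReal (f θ₀ t) := hg₀.measurable.ennreal_ofReal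
  rw [hpre, lifetimeLaw, withDensity_apply _ measurableSet_Ioi, hg₀.setLIntegral_Ioi]
  have hind : (fun T : ℝ => {w : ℝ × EReal × ℝ | w.2.2 < w.1}.indicator
      (fun w => ENNReal.ofReal (likelihood f (observe w) θ / likelihood f (observe w) θ₀)) (T, w)) =
      (Set.Ioi w.2).indicator fun T => ENNReal.ofReal (likelihood f (observe (T, w.1, w.2)) θ /
        likelihood f (observe (T, w.1, w.2)) θ₀) := by
    funext T
    simp [Set.indicator]
  have hRw : Measurable fun T : ℝ => ENNReal.ofReal (likelihood f (observe (T, w.1, w.2)) θ /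
      likelihood f (observe (T, w.1, w.2)) θ₀) :=
    hRo.comp (g := fun w => ENNReal.ofReal (likelihood f (observe w) θ /
      likelihood f (observe w) θ₀)) (f := fun T : ℝ => (T, w.1, w.2)) (by fun_prop)
  rw [hind, lintegral_indicator measurableSet_Ioi, restrict_withDensity measurableSet_Ioi,
    lintegral_withDensity_eq_lintegral_mul _ hd hRw]
  exact lintegral_likelihood_ratio_slice_le hg hg₀ hw.2

/-- The information inequality: the expected log-likelihood is maximal at the true parameter. -/
theorem integral_logLik_le [IsProbabilityMeasure G] [IsProbabilityMeasure (obsLaw f θ₀ G)]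
    (hmodel : IsRegularModel f Θ θ₀ G) (hmom : LogLikMoments f Θ (obsLaw f θ₀ G)) (hθ : θ ∈ Θ) :
    ∫ z, logLik f z θ ∂(obsLaw f θ₀ G) ≤ ∫ z, logLik f z θ₀ ∂(obsLaw f θ₀ G) := by
  have hθ₀ : θ₀ ∈ Θ := interior_subset hmodel.mem_interior
  have hg := hmodel.density θ hθ
  have hg₀ := hmodel.density θ₀ hθ₀
  have hlin := lintegral_likelihood_ratio_le_one hg hg₀ hmodel.trunc_le_cens
  have hm : Measurable fun z => likelihood f z θ / likelihood f z θ₀ :=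
    hg.measurable_likelihood.div hg₀.measurable_likelihood
  have hnn : 0 ≤ᵐ[obsLaw f θ₀ G] fun z => likelihood f z θ / likelihood f z θ₀ := by
    filter_upwards [hmodel.likelihood_pos] with z hz
    exact (div_pos (hz θ hθ) (hz θ₀ hθ₀)).le
  have hint : Integrable (fun z => likelihood f z θ / likelihood f z θ₀) (obsLaw f θ₀ G) :=
    ⟨hm.aestronglyMeasurable, by
      rw [hasFiniteIntegral_iff_ofReal hnn]
      exact hlin.trans_lt ENNReal.one_lt_top⟩
  have hle1 : ∫ z, likelihood f z θ / likelihood f z θ₀ ∂(obsLaw f θ₀ G) ≤ 1 := by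
    rw [integral_eq_lintegral_of_nonneg_ae hnn hm.aestronglyMeasurable]
    exact ENNReal.toReal_le_of_le_ofReal zero_le_one (by simpa using hlin)
  rw [← sub_nonpos, ← integral_sub (hmom.integrable θ hθ) (hmom.integrable θ₀ hθ₀)]
  calc ∫ z, (logLik f z θ - logLik f z θ₀) ∂(obsLaw f θ₀ G)
      ≤ ∫ z, (likelihood f z θ / likelihood f z θ₀ - 1) ∂(obsLaw f θ₀ G) := by
        refine integral_mono_ae ((hmom.integrable θ hθ).sub (hmom.integrable θ₀ hθ₀))
          (hint.sub (integrable_const _)) ?_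
        filter_upwards [hmodel.likelihood_pos] with z hz
        rw [logLik_eq_log_likelihood (hz θ hθ), logLik_eq_log_likelihood (hz θ₀ hθ₀),
          ← Real.log_div (hz θ hθ).ne' (hz θ₀ hθ₀).ne']
        exact Real.log_le_sub_one_of_pos (div_pos (hz θ hθ) (hz θ₀ hθ₀))
    _ ≤ 0 := by
        rw [integral_sub hint (integrable_const _)]
        simpa using hle1

end InformationInequality

end CensoredSubsampling
namespace CensoredSubsampling

/-! ### Taylor expansions of the log-likelihood of one record. -/

section Smoothness

variable {d : ℕ} {f : Param d → ℝ → ℝ} {Θ : Set (Param d)} {θ θ₀ : Param d} {z : Obs}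

/-- The Hessian as a bilinear form. -/
noncomputable def hessForm (f : Param d → ℝ → ℝ) (z : Obs) (θ u v : Param d) : ℝ :=
  ∑ j, ∑ k, u j * v k * hess f z θ j k

theorem inner_score (f : Param d → ℝ → ℝ) (z : Obs) (θ v : Param d) :
    inner ℝ (score f z θ) v = fderiv ℝ (logLik f z) θ v := by
  rw [score, ← toDual_gradient, InnerProductSpace.toDual_apply_apply]

theorem score_apply (f : Param d → ℝ → ℝ) (z : Obs) (θ : Param d) (k : Fin d) :
    score f z θ k = inner ℝ (score f z θ) (EuclideanSpace.single k 1) := by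
  rw [EuclideanSpace.inner_single_right]
  simp

theorem fderiv_fderiv_eq_hessForm (f : Param d → ℝ → ℝ) (z : Obs) (θ u v : Param d) :
    fderiv ℝ (fderiv ℝ (logLik f z)) θ u v = hessForm f z θ u v := by
  have hb : ∀ w : Param d, w = ∑ j, w j • EuclideanSpace.single j (1 : ℝ) := by
    intro w
    ext i
    simp [Finset.sum_apply, Pi.single_apply]
  conv_lhs => rw [hb u, hb v]
  simp only [map_sum, map_smul, FunLike.coe_sum, Finset.sum_apply, FunLike.coe_smul, Pi.smul_apply,
    smul_eq_mul, hessForm, hess, Matrix.of_apply, iteratedFDeriv_two_apply, Matrix.cons_val_zero,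
    Matrix.cons_val_one]
  simp_rw [Finset.mul_sum]
  rw [Finset.sum_comm]
  refine Finset.sum_congr rfl fun j _ => Finset.sum_congr rfl fun k _ => ?_
  ring

theorem hasDerivAt_path (p u : Param d) (t : ℝ) : HasDerivAt (fun t : ℝ => p + t • u) u t := by
  simpa using ((hasDerivAt_id t).smul_const u).const_add p

theorem hasDerivAt_logLik_path {p u : Param d} {t : ℝ}
    (hc : ContDiffAt ℝ 2 (logLik f z) (p + t • u)) :
    HasDerivAt (fun t : ℝ => logLik f z (p + t • u)) (inner ℝ (score f z (p + t • u)) u) t := by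
  rw [inner_score]
  exact (hc.differentiableAt two_ne_zero).hasFDerivAt.comp_hasDerivAt t (hasDerivAt_path p u t)

theorem hasDerivAt_score_path {p u : Param d} (v : Param d) {t : ℝ}
    (hc : ContDiffAt ℝ 2 (logLik f z) (p + t • u)) :
    HasDerivAt (fun t : ℝ => inner ℝ (score f z (p + t • u)) v) (hessForm f z (p + t • u) u v) t := by
  have h1 : DifferentiableAt ℝ (fderiv ℝ (logLik f z)) (p + t • u) :=
    (hc.fderiv_right (m := 1) (by norm_num)).differentiableAt one_ne_zero
  have h2 := h1.hasFDerivAt.comp_hasDerivAt t (hasDerivAt_path p u t)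
  simp_rw [inner_score, ← fderiv_fderiv_eq_hessForm]
  exact h2.clm_apply (hasDerivAt_const t v) |>.congr_deriv (by simp)

/-- Twice continuous differentiability on `Θ` with a `c`-Lipschitz Hessian. -/
structure HasLipschitzHessian (f : Param d → ℝ → ℝ) (Θ : Set (Param d)) (c : ℝ) (z : Obs) :
    Prop where
  contDiffAt : ∀ θ ∈ Θ, ContDiffAt ℝ 2 (logLik f z) θ
  lipschitz : ∀ θ₁ ∈ Θ, ∀ θ₂ ∈ Θ, ∀ j k,
    |hess f z θ₁ j k - hess f z θ₂ j k| ≤ c * ‖θ₁ - θ₂‖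

theorem abs_apply_le_norm (u : Param d) (j : Fin d) : |u j| ≤ ‖u‖ := PiLp.norm_apply_le u j

theorem add_smul_sub_mem (hΘ : Convex ℝ Θ) (hθ₀ : θ₀ ∈ Θ) (hθ : θ ∈ Θ) {t : ℝ}
    (ht : t ∈ Set.Icc (0 : ℝ) 1) : θ₀ + t • (θ - θ₀) ∈ Θ :=
  hΘ.add_smul_sub_mem hθ₀ hθ ht

namespace HasLipschitzHessian

variable {c : ℝ} (hz : HasLipschitzHessian f Θ c z)
include hz

theorem abs_hess_sub_le {θ₁ θ₂ : Param d} (h₁ : θ₁ ∈ Θ) (h₂ : θ₂ ∈ Θ) (j k : Fin d) :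
    |hess f z θ₁ j k - hess f z θ₂ j k| ≤ |c| * ‖θ₁ - θ₂‖ :=
  (hz.lipschitz θ₁ h₁ θ₂ h₂ j k).trans
    (mul_le_mul_of_nonneg_right (le_abs_self c) (norm_nonneg _))

/-- First order Taylor expansion of the score. -/
theorem abs_score_sub_le (hΘ : Convex ℝ Θ) (hθ₀ : θ₀ ∈ Θ) (hθ : θ ∈ Θ) (k : Fin d) :
    |score f z θ k - score f z θ₀ k - ∑ j, (θ - θ₀) j * hess f z θ₀ j k| ≤
      d * |c| * ‖θ - θ₀‖ ^ 2 := by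
  set u := θ - θ₀ with hu
  have hform : ∀ θ', hessForm f z θ' u (EuclideanSpace.single k 1) = ∑ j, u j * hess f z θ' j k := by
    intro θ'
    refine Finset.sum_congr rfl fun j _ => ?_
    simp
  -- Mean value inequality for the score along the segment minus its linear part. The derivative is
  -- a Hessian increment applied to `u`, so the Lipschitz bound makes it quadratic in `‖u‖`.
  have key := norm_image_sub_le_of_norm_deriv_le_segment_01'
    (f := fun t : ℝ => inner ℝ (score f z (θ₀ + t • u)) (EuclideanSpace.single k (1 : ℝ)) -
      t * ∑ j, u j * hess f z θ₀ j k)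
    (f' := fun t => ∑ j, u j * hess f z (θ₀ + t • u) j k - ∑ j, u j * hess f z θ₀ j k)
    (C := d * |c| * ‖u‖ ^ 2) ?_ ?_
  · simp only [one_smul, zero_smul, add_zero, one_mul, zero_mul, sub_zero, ← score_apply,
      Real.norm_eq_abs] at key
    rw [show θ₀ + u = θ by simp [hu]] at key
    convert key using 2
    ring
  · intro t ht
    have h1 := hasDerivAt_score_path (EuclideanSpace.single k (1 : ℝ))
      (hz.contDiffAt _ (add_smul_sub_mem hΘ hθ₀ hθ ht))
    rw [← hu, hform] at h1
    have h2 := (hasDerivAt_id t).mul_const (∑ j, u j * hess f z θ₀ j k)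
    rw [one_mul] at h2
    exact (h1.sub h2).hasDerivWithinAt
  · intro t ht
    have hmem := add_smul_sub_mem hΘ hθ₀ hθ (Set.Ico_subset_Icc_self ht)
    rw [← Finset.sum_sub_distrib, Real.norm_eq_abs]
    refine (Finset.abs_sum_le_sum_abs _ _).trans ?_
    have : ∀ j ∈ Finset.univ, |u j * hess f z (θ₀ + t • u) j k - u j * hess f z θ₀ j k| ≤
        |c| * ‖u‖ ^ 2 := by
      intro j _
      rw [← mul_sub, abs_mul]
      have h1 := hz.abs_hess_sub_le hmem hθ₀ j k
      have h2 : ‖θ₀ + t • u - θ₀‖ ≤ ‖u‖ := by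
        rw [add_sub_cancel_left, norm_smul, Real.norm_of_nonneg ht.1]
        exact mul_le_of_le_one_left (norm_nonneg _) ht.2.le
      calc |u j| * |hess f z (θ₀ + t • u) j k - hess f z θ₀ j k|
          ≤ ‖u‖ * (|c| * ‖u‖) := by
            refine mul_le_mul (abs_apply_le_norm u j) (h1.trans ?_) (abs_nonneg _) (norm_nonneg _)
            exact mul_le_mul_of_nonneg_left h2 (abs_nonneg _)
        _ = |c| * ‖u‖ ^ 2 := by ring
    refine (Finset.sum_le_sum this).trans (le_of_eq ?_)
    simp
    ring

end HasLipschitzHessian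

/-- A bound of the norm of the score over a set of diameter at most `D` around `θ₀`. -/
noncomputable def scoreEnvelope (f : Param d → ℝ → ℝ) (θ₀ : Param d) (D : ℝ) (ψ : Obs → ℝ)
    (z : Obs) : ℝ :=
  ∑ k, (|score f z θ₀ k| + ∑ j, D * |hess f z θ₀ j k| + d * |ψ z| * D ^ 2)

theorem scoreEnvelope_nonneg {D : ℝ} (hD : 0 ≤ D) (ψ : Obs → ℝ) :
    0 ≤ scoreEnvelope f θ₀ D ψ z := by
  unfold scoreEnvelope
  positivity

namespace HasLipschitzHessian

variable {ψ : Obs → ℝ} (hz : HasLipschitzHessian f Θ (ψ z) z)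
include hz

/-- Expanding around `θ₀` gives a bound that is uniform over `Θ` but involves only derivatives at
`θ₀` and `ψ`, hence is square-integrable. -/
theorem norm_score_le (hΘ : Convex ℝ Θ) (hθ₀ : θ₀ ∈ Θ) {D : ℝ} (hD : ∀ θ ∈ Θ, ‖θ - θ₀‖ ≤ D)
    (hθ : θ ∈ Θ) : ‖score f z θ‖ ≤ scoreEnvelope f θ₀ D ψ z := by
  have hD0 : 0 ≤ D := (norm_nonneg _).trans (hD θ hθ)
  have hl1 : ‖score f z θ‖ ≤ ∑ k, |score f z θ k| := by
    rw [EuclideanSpace.norm_eq]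
    refine Real.sqrt_le_iff.2 ⟨Finset.sum_nonneg fun _ _ => abs_nonneg _, ?_⟩
    simp only [Real.norm_eq_abs]
    exact Finset.sum_sq_le_sq_sum_of_nonneg fun i _ => abs_nonneg _
  refine hl1.trans (Finset.sum_le_sum fun k _ => ?_)
  have h1 := hz.abs_score_sub_le hΘ hθ₀ hθ k
  have h2 : |∑ j, (θ - θ₀) j * hess f z θ₀ j k| ≤ ∑ j, D * |hess f z θ₀ j k| := by
    refine (Finset.abs_sum_le_sum_abs _ _).trans (Finset.sum_le_sum fun j _ => ?_)
    rw [abs_mul]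
    exact mul_le_mul_of_nonneg_right ((abs_apply_le_norm _ j).trans (hD θ hθ)) (abs_nonneg _)
  have h3 : (d : ℝ) * |ψ z| * ‖θ - θ₀‖ ^ 2 ≤ d * |ψ z| * D ^ 2 := by
    have := hD θ hθ
    gcongr
  have h4 : score f z θ k = score f z θ₀ k + ∑ j, (θ - θ₀) j * hess f z θ₀ j k +
      (score f z θ k - score f z θ₀ k - ∑ j, (θ - θ₀) j * hess f z θ₀ j k) := by ring
  rw [h4]
  refine (abs_add_le _ _).trans (add_le_add ((abs_add_le _ _).trans ?_) (h1.trans h3))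
  exact add_le_add le_rfl h2

theorem abs_logLik_sub_le (hΘ : Convex ℝ Θ) (hθ₀ : θ₀ ∈ Θ) {D : ℝ}
    (hD : ∀ θ ∈ Θ, ‖θ - θ₀‖ ≤ D) {θ₁ θ₂ : Param d} (h₁ : θ₁ ∈ Θ) (h₂ : θ₂ ∈ Θ) :
    |logLik f z θ₁ - logLik f z θ₂| ≤ scoreEnvelope f θ₀ D ψ z * ‖θ₁ - θ₂‖ := by
  have key := norm_image_sub_le_of_norm_deriv_le_segment_01'
    (f := fun t : ℝ => logLik f z (θ₂ + t • (θ₁ - θ₂)))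
    (f' := fun t => inner ℝ (score f z (θ₂ + t • (θ₁ - θ₂))) (θ₁ - θ₂))
    (C := scoreEnvelope f θ₀ D ψ z * ‖θ₁ - θ₂‖) ?_ ?_
  · simpa using key
  · exact fun t ht =>
      (hasDerivAt_logLik_path (hz.contDiffAt _ (add_smul_sub_mem hΘ h₂ h₁ ht))).hasDerivWithinAt
  · intro t ht
    have hmem := add_smul_sub_mem hΘ h₂ h₁ (Set.Ico_subset_Icc_self ht)
    exact (norm_inner_le_norm _ _).trans
      (mul_le_mul_of_nonneg_right (hz.norm_score_le hΘ hθ₀ hD hmem) (norm_nonneg _))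

theorem abs_hessForm_le (hθ₀ : θ₀ ∈ Θ) {D : ℝ} (hD : ∀ θ ∈ Θ, ‖θ - θ₀‖ ≤ D) (hθ : θ ∈ Θ)
    (u v : Param d) :
    |hessForm f z θ u v| ≤ ∑ j, ∑ k, |u j * v k| * (|hess f z θ₀ j k| + |ψ z| * D) := by
  refine (Finset.abs_sum_le_sum_abs _ _).trans (Finset.sum_le_sum fun j _ => ?_)
  refine (Finset.abs_sum_le_sum_abs _ _).trans (Finset.sum_le_sum fun k _ => ?_)
  rw [abs_mul]
  refine mul_le_mul_of_nonneg_left ?_ (abs_nonneg _)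
  have h1 := hz.abs_hess_sub_le hθ hθ₀ j k
  have h2 : |ψ z| * ‖θ - θ₀‖ ≤ |ψ z| * D := mul_le_mul_of_nonneg_left (hD θ hθ) (abs_nonneg _)
  have h3 := abs_add_le (hess f z θ₀ j k) (hess f z θ j k - hess f z θ₀ j k)
  rw [add_sub_cancel] at h3
  linarith

end HasLipschitzHessian

end Smoothness

end CensoredSubsampling
namespace CensoredSubsampling

/-! ### The expected log-likelihood: differentiation, centred score, unique maximizer. -/

section Population

variable {d : ℕ} {f : Param d → ℝ → ℝ} {Θ : Set (Param d)} {θ θ₀ : Param d}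
  {Q : Measure Obs} {ψ : Obs → ℝ} {D : ℝ}

theorem dotProduct_mulVec_eq_sum (A : Matrix (Fin d) (Fin d) ℝ) (u v : Fin d → ℝ) :
    u ⬝ᵥ A *ᵥ v = ∑ j, ∑ k, u j * v k * A j k := by
  simp only [dotProduct, Matrix.mulVec, Finset.mul_sum]
  exact Finset.sum_congr rfl fun j _ => Finset.sum_congr rfl fun k _ => by ring

/-- The integrability and smoothness of the log-likelihood that the asymptotic theory uses. -/
structure IsSmoothModel (f : Param d → ℝ → ℝ) (Θ : Set (Param d)) (θ₀ : Param d)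
    (Q : Measure Obs) (ψ : Obs → ℝ) (D : ℝ) : Prop where
  convex : Convex ℝ Θ
  mem : θ₀ ∈ Θ
  norm_sub_le : ∀ θ ∈ Θ, ‖θ - θ₀‖ ≤ D
  memLp_psi : MemLp ψ 2 Q
  ae_hasLipschitzHessian : ∀ᵐ z ∂Q, HasLipschitzHessian f Θ (ψ z) z
  memLp_logLik : ∀ θ ∈ Θ, MemLp (fun z => logLik f z θ) 2 Q
  memLp_score : ∀ θ ∈ Θ, MemLp (fun z => score f z θ) 2 Q
  memLp_hess : ∀ θ ∈ Θ, ∀ j k, MemLp (fun z => hess f z θ j k) 2 Q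

namespace IsSmoothModel

variable (hm : IsSmoothModel f Θ θ₀ Q ψ D)
include hm

theorem memLp_score_apply (hθ : θ ∈ Θ) (k : Fin d) : MemLp (fun z => score f z θ k) 2 Q :=
  (hm.memLp_score θ hθ).eval_piLp k

theorem memLp_inner_score (hθ : θ ∈ Θ) (u : Param d) :
    MemLp (fun z => inner ℝ (score f z θ) u) 2 Q := by
  have h := (innerSL ℝ u).comp_memLp' (hm.memLp_score θ hθ)
  refine h.ae_eq (Eventually.of_forall fun z => ?_)
  exact real_inner_comm (score f z θ) u

theorem memLp_hessForm (hθ : θ ∈ Θ) (u v : Param d) :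
    MemLp (fun z => hessForm f z θ u v) 2 Q :=
  memLp_finsetSum _ fun j _ => memLp_finsetSum _ fun k _ => (hm.memLp_hess θ hθ j k).const_mul _

variable [IsProbabilityMeasure Q]

theorem bound_nonneg : 0 ≤ D := (norm_nonneg _).trans (hm.norm_sub_le θ₀ hm.mem)

theorem memLp_scoreEnvelope : MemLp (scoreEnvelope f θ₀ D ψ) 2 Q := by
  have h1 : ∀ k, MemLp (fun z => |score f z θ₀ k|) 2 Q := fun k =>
    (hm.memLp_score_apply hm.mem k).abs
  have h2 : ∀ k, MemLp (fun z => ∑ j, D * |hess f z θ₀ j k|) 2 Q := fun k =>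
    memLp_finsetSum _ fun j _ => (hm.memLp_hess θ₀ hm.mem j k).abs.const_mul D
  have h3 : MemLp (fun z => d * |ψ z| * D ^ 2) 2 Q := (hm.memLp_psi.abs.const_mul _).mul_const _
  exact memLp_finsetSum _ fun k _ => ((h1 k).add (h2 k)).add h3

theorem integral_hessForm (hθ : θ ∈ Θ) (u v : Param d) :
    ∫ z, hessForm f z θ u v ∂Q = u ⬝ᵥ meanHess f Q θ *ᵥ v := by
  have hi : ∀ j k, Integrable (fun z => u j * v k * hess f z θ j k) Q := fun j k =>
    ((hm.memLp_hess θ hθ j k).integrable one_le_two).const_mul _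
  rw [dotProduct_mulVec_eq_sum]
  unfold hessForm
  rw [integral_finsetSum _ fun j _ => integrable_finsetSum _ fun k _ => hi j k]
  refine Finset.sum_congr rfl fun j _ => ?_
  rw [integral_finsetSum _ fun k _ => hi j k]
  refine Finset.sum_congr rfl fun k _ => ?_
  rw [integral_const_mul, meanHess, Matrix.of_apply]

/-- Differentiation under the integral, dominated by the score envelope. Only the line near `t` has
to stay in `Θ`, so points on the boundary of `Θ` are allowed. -/
theorem hasDerivAt_integral_logLik {p u : Param d} {s : Set ℝ} (hs : ∀ t ∈ s, p + t • u ∈ Θ)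
    {t : ℝ} (ht : s ∈ 𝓝 t) :
    HasDerivAt (fun t : ℝ => ∫ z, logLik f z (p + t • u) ∂Q)
      (∫ z, inner ℝ (score f z (p + t • u)) u ∂Q) t := by
  have htΘ := hs t (mem_of_mem_nhds ht)
  refine (hasDerivAt_integral_of_dominated_loc_of_deriv_le
    (F := fun t z => logLik f z (p + t • u)) (F' := fun t z => inner ℝ (score f z (p + t • u)) u)
    (bound := fun z => scoreEnvelope f θ₀ D ψ z * ‖u‖) ht ?_ ?_ ?_ ?_ ?_ ?_).2
  · filter_upwards [ht] with t ht
    exact (hm.memLp_logLik _ (hs t ht)).aestronglyMeasurable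
  · exact (hm.memLp_logLik _ htΘ).integrable one_le_two
  · exact (hm.memLp_inner_score htΘ u).aestronglyMeasurable
  · filter_upwards [hm.ae_hasLipschitzHessian] with z hz t ht
    exact (norm_inner_le_norm _ _).trans (mul_le_mul_of_nonneg_right
      (hz.norm_score_le hm.convex hm.mem hm.norm_sub_le (hs t ht)) (norm_nonneg _))
  · exact (hm.memLp_scoreEnvelope.integrable one_le_two).mul_const _
  · filter_upwards [hm.ae_hasLipschitzHessian] with z hz t ht
    exact hasDerivAt_logLik_path (hz.contDiffAt _ (hs t ht))

theorem hasDerivAt_integral_score {p u : Param d} {s : Set ℝ} (hs : ∀ t ∈ s, p + t • u ∈ Θ)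
    {t : ℝ} (ht : s ∈ 𝓝 t) :
    HasDerivAt (fun t : ℝ => ∫ z, inner ℝ (score f z (p + t • u)) u ∂Q)
      (u ⬝ᵥ meanHess f Q (p + t • u) *ᵥ u) t := by
  have htΘ := hs t (mem_of_mem_nhds ht)
  rw [← hm.integral_hessForm htΘ]
  refine (hasDerivAt_integral_of_dominated_loc_of_deriv_le
    (F := fun t z => inner ℝ (score f z (p + t • u)) u)
    (F' := fun t z => hessForm f z (p + t • u) u u)
    (bound := fun z => ∑ j, ∑ k, |u j * u k| * (|hess f z θ₀ j k| + |ψ z| * D))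
    ht ?_ ?_ ?_ ?_ ?_ ?_).2
  · filter_upwards [ht] with t ht
    exact (hm.memLp_inner_score (hs t ht) u).aestronglyMeasurable
  · exact (hm.memLp_inner_score htΘ u).integrable one_le_two
  · exact (hm.memLp_hessForm htΘ u u).aestronglyMeasurable
  · filter_upwards [hm.ae_hasLipschitzHessian] with z hz t ht
    exact hz.abs_hessForm_le hm.mem hm.norm_sub_le (hs t ht) u u
  · refine integrable_finsetSum _ fun j _ => integrable_finsetSum _ fun k _ => ?_
    exact (((hm.memLp_hess θ₀ hm.mem j k).abs.integrable one_le_two).add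
      ((hm.memLp_psi.abs.integrable one_le_two).mul_const D)).const_mul _
  · filter_upwards [hm.ae_hasLipschitzHessian] with z hz t ht
    exact hasDerivAt_score_path u (hz.contDiffAt _ (hs t ht))

theorem abs_integral_logLik_sub_le {θ₁ θ₂ : Param d} (h₁ : θ₁ ∈ Θ) (h₂ : θ₂ ∈ Θ) :
    |∫ z, logLik f z θ₁ ∂Q - ∫ z, logLik f z θ₂ ∂Q| ≤
      (∫ z, scoreEnvelope f θ₀ D ψ z ∂Q) * ‖θ₁ - θ₂‖ := by
  rw [← integral_sub ((hm.memLp_logLik _ h₁).integrable one_le_two)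
    ((hm.memLp_logLik _ h₂).integrable one_le_two), ← integral_mul_const]
  refine (abs_integral_le_integral_abs).trans (integral_mono_ae ?_ ?_ ?_)
  · exact (((hm.memLp_logLik _ h₁).integrable one_le_two).sub
      ((hm.memLp_logLik _ h₂).integrable one_le_two)).abs
  · exact (hm.memLp_scoreEnvelope.integrable one_le_two).mul_const _
  · filter_upwards [hm.ae_hasLipschitzHessian] with z hz
    exact hz.abs_logLik_sub_le hm.convex hm.mem hm.norm_sub_le h₁ h₂

/-- The score has mean zero at an interior maximizer of the expected log-likelihood. -/
theorem integral_inner_score_eq_zero (hint : θ₀ ∈ interior Θ)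
    (hmax : ∀ θ ∈ Θ, ∫ z, logLik f z θ ∂Q ≤ ∫ z, logLik f z θ₀ ∂Q) (u : Param d) :
    ∫ z, inner ℝ (score f z θ₀) u ∂Q = 0 := by
  have hcont : Tendsto (fun t : ℝ => θ₀ + t • u) (𝓝 0) (𝓝 θ₀) := by
    have : Continuous fun t : ℝ => θ₀ + t • u := by fun_prop
    simpa using this.tendsto 0
  have hs : {t : ℝ | θ₀ + t • u ∈ Θ} ∈ 𝓝 (0 : ℝ) := hcont (mem_interior_iff_mem_nhds.1 hint)
  have hd := hm.hasDerivAt_integral_logLik (p := θ₀) (u := u) (fun t ht => ht) hs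
  have hloc : IsLocalMax (fun t : ℝ => ∫ z, logLik f z (θ₀ + t • u) ∂Q) 0 := by
    filter_upwards [hs] with t ht
    simpa using hmax _ ht
  simpa using hloc.hasDerivAt_eq_zero hd

/-- A maximizer of the expected log-likelihood is the only one if the expected Hessians are
negative definite. -/
theorem integral_logLik_lt (hmax : ∀ θ ∈ Θ, ∫ z, logLik f z θ ∂Q ≤ ∫ z, logLik f z θ₀ ∂Q)
    (hneg : ∀ θ ∈ Θ, (-(meanHess f Q θ)).PosDef) (hθ : θ ∈ Θ) (hne : θ ≠ θ₀) :
    ∫ z, logLik f z θ ∂Q < ∫ z, logLik f z θ₀ ∂Q := by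
  refine lt_of_le_of_ne (hmax θ hθ) fun heq => ?_
  set u := θ - θ₀ with hu
  have hu0 : u ≠ 0 := sub_ne_zero.2 hne
  have hmem : ∀ t ∈ Set.Icc (0 : ℝ) 1, θ₀ + t • u ∈ Θ := fun t ht =>
    add_smul_sub_mem hm.convex hm.mem hθ ht
  have hmem' : ∀ t ∈ Set.Ioo (0 : ℝ) 1, θ₀ + t • u ∈ Θ := fun t ht =>
    hmem t (Set.Ioo_subset_Icc_self ht)
  -- The end `θ` may be a boundary point beyond which the segment leaves `Θ`; continuity is needed
  -- on the closed interval, derivatives only inside it.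
  have hcont : ContinuousOn (fun t : ℝ => ∫ z, logLik f z (θ₀ + t • u) ∂Q) (Set.Icc 0 1) := by
    refine LipschitzOnWith.continuousOn
      (K := ((∫ z, scoreEnvelope f θ₀ D ψ z ∂Q) * ‖u‖).toNNReal) ?_
    refine LipschitzOnWith.of_dist_le_mul fun s hs t ht => ?_
    rw [Real.dist_eq, Real.dist_eq, Real.coe_toNNReal _ (mul_nonneg
      (integral_nonneg fun z => scoreEnvelope_nonneg hm.bound_nonneg ψ) (norm_nonneg _))]
    refine (hm.abs_integral_logLik_sub_le (hmem s hs) (hmem t ht)).trans (le_of_eq ?_)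
    rw [add_sub_add_left_eq_sub, ← sub_smul, norm_smul, Real.norm_eq_abs]
    ring
  have hconc : StrictConcaveOn ℝ (Set.Icc (0 : ℝ) 1)
      fun t : ℝ => ∫ z, logLik f z (θ₀ + t • u) ∂Q := by
    refine strictConcaveOn_of_deriv2_neg (convex_Icc 0 1) hcont fun t ht => ?_
    rw [interior_Icc] at ht
    have hnhds := isOpen_Ioo.mem_nhds ht
    have h1 : deriv (fun t : ℝ => ∫ z, logLik f z (θ₀ + t • u) ∂Q) =ᶠ[𝓝 t]
        fun t => ∫ z, inner ℝ (score f z (θ₀ + t • u)) u ∂Q := by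
      filter_upwards [hnhds] with s hs
      exact (hm.hasDerivAt_integral_logLik hmem' (isOpen_Ioo.mem_nhds hs)).deriv
    have h2 := (hm.hasDerivAt_integral_score hmem' hnhds).deriv
    simp only [Function.iterate_succ, Function.iterate_zero, Function.comp_apply, id]
    rw [h1.deriv_eq, h2]
    have hu0' : u.ofLp ≠ 0 := fun h => hu0 (by ext i; exact congrFun h i)
    have := (hneg _ (hmem' t ht)).dotProduct_mulVec_pos hu0'
    simp only [star_trivial, Matrix.neg_mulVec, dotProduct_neg] at this
    linarith
  -- With equal values at both ends, the midpoint would exceed the maximum.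
  have := hconc.2 (Set.left_mem_Icc.2 zero_le_one) (Set.right_mem_Icc.2 zero_le_one) zero_ne_one
    (show (0 : ℝ) < 1 / 2 by norm_num) (show (0 : ℝ) < 1 / 2 by norm_num) (by norm_num)
  simp only [smul_eq_mul, mul_zero, mul_one, zero_add, zero_smul, add_zero, one_smul] at this
  rw [show θ₀ + u = θ by simp [hu], heq] at this
  have h2 := hmax _ (hmem (1 / 2) (by constructor <;> norm_num))
  linarith

end IsSmoothModel

end Population

end CensoredSubsampling
namespace CensoredSubsampling

/-! ### Algebra of the weighted subsample averages. -/

section SubsampleAlgebra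

variable {Ω : Type*} {x : ℕ → Ω → Obs} {r : ℕ → ℕ} {π : ℕ → ℕ → Ω → ℝ} {a : ℕ → ℕ → Ω → ℕ}
  {g h : Obs → ℝ} {n : ℕ} {ω : Ω}

theorem subAvg_congr (H : ∀ i, g (x i ω) = h (x i ω)) :
    subAvg x r π a g n ω = subAvg x r π a h n ω := by
  simp only [subAvg, H]

theorem subAvg_mono (hw : ∀ j < r n, 0 ≤ π n (a n j ω) ω) (H : ∀ i, g (x i ω) ≤ h (x i ω)) :
    subAvg x r π a g n ω ≤ subAvg x r π a h n ω := by
  refine mul_le_mul_of_nonneg_left (Finset.sum_le_sum fun j hj => ?_) (by positivity)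
  have := hw j (Finset.mem_range.1 hj)
  exact mul_le_mul_of_nonneg_left (H _) (by positivity)

theorem subAvg_const_mul (c : ℝ) : subAvg x r π a (fun z => c * h z) n ω =
    c * subAvg x r π a h n ω := by
  simp only [subAvg, Finset.mul_sum]
  exact Finset.sum_congr rfl fun j _ => by ring

theorem subAvg_sub : subAvg x r π a (fun z => g z - h z) n ω =
    subAvg x r π a g n ω - subAvg x r π a h n ω := by
  simp only [subAvg, mul_sub, Finset.sum_sub_distrib]

theorem subAvg_sum {ι : Type*} (s : Finset ι) (g : ι → Obs → ℝ) :
    subAvg x r π a (fun z => ∑ i ∈ s, g i z) n ω = ∑ i ∈ s, subAvg x r π a (g i) n ω := by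
  simp only [subAvg, Finset.mul_sum]
  rw [Finset.sum_comm]

theorem abs_subAvg_le (hw : ∀ j < r n, 0 ≤ π n (a n j ω) ω)
    (H : ∀ i, |g (x i ω)| ≤ h (x i ω)) : |subAvg x r π a g n ω| ≤ subAvg x r π a h n ω := by
  refine abs_le.2 ⟨?_, subAvg_mono hw fun i => (abs_le.1 (H i)).2⟩
  have := subAvg_mono (g := fun z => -1 * h z) hw fun i => by
    have := (abs_le.1 (H i)).1
    linarith
  rw [subAvg_const_mul] at this
  linarith

/-- The two normalizations differ by a positive factor, which leaves the maximizers unchanged. -/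
theorem subLogLik_eq_mul_subAvg {d : ℕ} (f : Param d → ℝ → ℝ) (hn : 1 ≤ n) (θ : Param d) :
    subLogLik f (r n) (fun i => π n i ω) (fun j => a n j ω) (fun i => x i ω) θ =
      n * subAvg x r π a (fun z => logLik f z θ) n ω := by
  simp only [subLogLik, subAvg, Finset.mul_sum]
  refine Finset.sum_congr rfl fun j _ => ?_
  have hn0 : (n : ℝ) ≠ 0 := by positivity
  field_simp

end SubsampleAlgebra

/-! ### Consistency and the score equation of the subsampling estimator. -/

section Estimator

variable {d : ℕ} {f : Param d → ℝ → ℝ} {Θ : Set (Param d)} {θ₀ : Param d}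
  {Q : Measure Obs} [IsProbabilityMeasure Q] {ψ : Obs → ℝ} {D : ℝ}
  {Ω : Type*} [MeasurableSpace Ω] {P : Measure Ω} [IsProbabilityMeasure P]
  {x : ℕ → Ω → Obs} {r : ℕ → ℕ} {π : ℕ → ℕ → Ω → ℝ} {a : ℕ → ℕ → Ω → ℕ}
  {θtilde : ℕ → Ω → Param d}

/-- The full-measure event on which the subsampling estimator is analysed. -/
structure IsRegularSample (f : Param d → ℝ → ℝ) (Θ : Set (Param d)) (ψ : Obs → ℝ)
    (x : ℕ → Ω → Obs) (r : ℕ → ℕ) (π : ℕ → ℕ → Ω → ℝ) (a : ℕ → ℕ → Ω → ℕ)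
    (θtilde : ℕ → Ω → Param d) (n : ℕ) (ω : Ω) : Prop where
  hasLipschitzHessian : ∀ i, HasLipschitzHessian f Θ (ψ (x i ω)) (x i ω)
  prob_nonneg : ∀ j < r n, 0 ≤ π n (a n j ω) ω
  mem : θtilde n ω ∈ Θ
  isMax : ∀ θ ∈ Θ, subAvg x r π a (fun z => logLik f z θ) n ω ≤
    subAvg x r π a (fun z => logLik f z (θtilde n ω)) n ω

theorem eventually_isRegularSample (hm : IsSmoothModel f Θ θ₀ Q ψ D)
    (hsub : IsGeneralSubsampling P x r π a) (hx : ∀ i, Measurable (x i))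
    (hlaw : ∀ i, P.map (x i) = Q)
    (hθ : ∀ n, 1 ≤ n → ∀ᵐ ω ∂P, θtilde n ω ∈ Θ ∧
      IsMaxOn (subLogLik f (r n) (fun i => π n i ω) (fun j => a n j ω) fun i => x i ω) Θ
        (θtilde n ω)) :
    ∀ᶠ q : ℕ × Ω in probFilter P, IsRegularSample f Θ ψ x r π a θtilde q.1 q.2 := by
  refine eventually_probFilter_of_ae ?_
  filter_upwards [eventually_ge_atTop 1] with n hn
  have hall : ∀ᵐ ω ∂P, ∀ i, HasLipschitzHessian f Θ (ψ (x i ω)) (x i ω) := by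
    rw [ae_all_iff]
    intro i
    have := hm.ae_hasLipschitzHessian
    rw [← hlaw i] at this
    exact ae_of_ae_map (hx i).aemeasurable this
  filter_upwards [hall, hsub.ae_index_lt hx hn, hθ n hn] with ω h1 h2 h3
  refine ⟨h1, fun j hj => (hsub.prob_pos n _ ω (h2 j hj)).le, h3.1, fun θ hθ => ?_⟩
  have h4 := isMaxOn_iff.1 h3.2 θ hθ
  rw [subLogLik_eq_mul_subAvg f hn, subLogLik_eq_mul_subAvg f hn] at h4
  exact le_of_mul_le_mul_left h4 (by positivity)

/-- The subsampling estimator is consistent. -/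
theorem tendsto_estimator (hm : IsSmoothModel f Θ θ₀ Q ψ D) (hΘ : IsCompact Θ)
    (hlt : ∀ θ ∈ Θ, θ ≠ θ₀ → ∫ z, logLik f z θ ∂Q < ∫ z, logLik f z θ₀ ∂Q)
    (hLLN : ∀ h : Obs → ℝ, MemLp h 2 Q →
      Tendsto (fun q : ℕ × Ω => subAvg x r π a h q.1 q.2) (probFilter P) (𝓝 (∫ z, h z ∂Q)))
    (hreg : ∀ᶠ q : ℕ × Ω in probFilter P, IsRegularSample f Θ ψ x r π a θtilde q.1 q.2) :
    Tendsto (fun q : ℕ × Ω => θtilde q.1 q.2) (probFilter P) (𝓝 θ₀) := by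
  -- Compactness along `probFilter` takes the place of a uniform law of large numbers: each `p ≠ θ₀`
  -- only needs a neighbourhood that the estimator avoids with probability tending to one.
  refine hΘ.le_nhds_of_unique_clusterPt (hreg.mono fun q hq => hq.mem) fun p hp hcl => ?_
  by_contra hne
  set B := ∫ z, scoreEnvelope f θ₀ D ψ z ∂Q with hB
  have hB0 : 0 ≤ B := integral_nonneg fun z => scoreEnvelope_nonneg hm.bound_nonneg ψ
  -- A third of the gap for each error: the two laws of large numbers, at `θ₀` and at `p`, and the
  -- oscillation over the ball. The radius `τ` keeps the last below `η` once the averaged envelope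
  -- is below `B + 1`.
  set η := (∫ z, logLik f z θ₀ ∂Q - ∫ z, logLik f z p ∂Q) / 3 with hη
  have hη0 : 0 < η := div_pos (sub_pos.2 (hlt p hp hne)) (by norm_num)
  set τ := η / (B + 1) with hτ
  have hτ0 : 0 < τ := by positivity
  have e1 := (hLLN _ (hm.memLp_logLik θ₀ hm.mem)).eventually_const_lt (sub_lt_self _ hη0)
  have e2 := (hLLN _ (hm.memLp_logLik p hp)).eventually_lt_const (lt_add_of_pos_right _ hη0)
  have e3 := (hLLN _ hm.memLp_scoreEnvelope).eventually_lt_const (lt_add_one B)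
  have hev : ∀ᶠ q : ℕ × Ω in probFilter P, θtilde q.1 q.2 ∉ Metric.ball p τ := by
    filter_upwards [hreg, e1, e2, e3] with ⟨n, ω⟩ hq h1 h2 h3 hball
    simp only at hq h1 h2 h3 hball
    have hdist : ‖θtilde n ω - p‖ < τ := by rwa [← dist_eq_norm]
    have h4 : subAvg x r π a (fun z => logLik f z (θtilde n ω) - logLik f z p) n ω ≤
        subAvg x r π a (fun z => τ * scoreEnvelope f θ₀ D ψ z) n ω := by
      refine subAvg_mono hq.prob_nonneg fun i => ?_
      refine (le_abs_self _).trans (((hq.hasLipschitzHessian i).abs_logLik_sub_le hm.convex hm.mem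
        hm.norm_sub_le hq.mem hp).trans ?_)
      rw [mul_comm]
      exact mul_le_mul_of_nonneg_right hdist.le (scoreEnvelope_nonneg hm.bound_nonneg ψ)
    rw [subAvg_sub, subAvg_const_mul] at h4
    have h5 := hq.isMax θ₀ hm.mem
    have h6 : τ * subAvg x r π a (scoreEnvelope f θ₀ D ψ) n ω ≤ η := by
      calc _ ≤ τ * (B + 1) := mul_le_mul_of_nonneg_left h3.le hτ0.le
        _ = η := div_mul_cancel₀ _ (by positivity)
    have h7 : 3 * η = ∫ z, logLik f z θ₀ ∂Q - ∫ z, logLik f z p ∂Q := by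
      rw [hη]
      ring
    linarith
  obtain ⟨y, hy, hy'⟩ := ((clusterPt_iff_frequently.1 hcl _ (Metric.ball_mem_nhds p hτ0)).and_eventually
    (eventually_map.2 hev : ∀ᶠ y in map (fun q : ℕ × Ω => θtilde q.1 q.2) (probFilter P),
      y ∉ Metric.ball p τ)).exists
  exact hy' hy

/-- The score equation of the subsampling estimator. -/
theorem IsRegularSample.subAvg_score_eq_zero {n : ℕ} {ω : Ω}
    (hq : IsRegularSample f Θ ψ x r π a θtilde n ω) (hint : θtilde n ω ∈ interior Θ) (k : Fin d) :
    subAvg x r π a (fun z => score f z (θtilde n ω) k) n ω = 0 := by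
  set p := θtilde n ω with hp
  set u : Param d := EuclideanSpace.single k 1 with hu
  have hcont : Tendsto (fun t : ℝ => p + t • u) (𝓝 0) (𝓝 p) := by
    have : Continuous fun t : ℝ => p + t • u := by fun_prop
    simpa using this.tendsto 0
  have hs : ∀ᶠ t in 𝓝 (0 : ℝ), p + t • u ∈ Θ := hcont (mem_interior_iff_mem_nhds.1 hint)
  have hd : HasDerivAt (fun t : ℝ => subAvg x r π a (fun z => logLik f z (p + t • u)) n ω)
      (subAvg x r π a (fun z => score f z p k) n ω) 0 := by
    unfold subAvg
    refine HasDerivAt.const_mul _ (HasDerivAt.fun_sum fun j _ => HasDerivAt.const_mul _ ?_)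
    have h1 : ContDiffAt ℝ 2 (logLik f (x (a n j ω) ω)) (p + (0 : ℝ) • u) := by
      rw [zero_smul, add_zero]
      exact (hq.hasLipschitzHessian _).contDiffAt p hq.mem
    have h2 := hasDerivAt_logLik_path h1
    rwa [zero_smul, add_zero, ← score_apply] at h2
  have hloc : IsLocalMax
      (fun t : ℝ => subAvg x r π a (fun z => logLik f z (p + t • u)) n ω) 0 := by
    filter_upwards [hs] with t ht
    simpa using hq.isMax _ ht
  exact hloc.hasDerivAt_eq_zero hd

/-- Linearization of the score equation. -/
theorem IsRegularSample.abs_score_add_le {n : ℕ} {ω : Ω}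
    (hq : IsRegularSample f Θ ψ x r π a θtilde n ω) (hconv : Convex ℝ Θ) (hθ₀ : θ₀ ∈ Θ)
    (hint : θtilde n ω ∈ interior Θ) (k : Fin d) :
    |subAvg x r π a (fun z => score f z θ₀ k) n ω +
      ∑ j, (θtilde n ω - θ₀) j * subAvg x r π a (fun z => hess f z θ₀ j k) n ω| ≤
      d * ‖θtilde n ω - θ₀‖ ^ 2 * subAvg x r π a (fun z => |ψ z|) n ω := by
  have h1 := abs_subAvg_le (x := x) (r := r) (π := π) (a := a) (n := n) (ω := ω)
    (g := fun z => score f z (θtilde n ω) k - score f z θ₀ k -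
      ∑ j, (θtilde n ω - θ₀) j * hess f z θ₀ j k)
    (h := fun z => (d * ‖θtilde n ω - θ₀‖ ^ 2) * |ψ z|) hq.prob_nonneg fun i => by
      refine ((hq.hasLipschitzHessian i).abs_score_sub_le hconv hθ₀ hq.mem k).trans (le_of_eq ?_)
      ring
  rw [subAvg_sub, subAvg_sub, hq.subAvg_score_eq_zero hint, subAvg_const_mul, subAvg_sum] at h1
  simp_rw [subAvg_const_mul] at h1
  rwa [zero_sub, ← neg_add', abs_neg] at h1

end Estimator

end CensoredSubsampling
namespace CensoredSubsampling

/-! ### Asymptotic linear representation of the estimator. -/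

section Linearization

variable {d : ℕ}

theorem norm_le_sum_abs (u : Param d) : ‖u‖ ≤ ∑ i, |u i| := by
  rw [EuclideanSpace.norm_eq]
  refine Real.sqrt_le_iff.2 ⟨Finset.sum_nonneg fun _ _ => abs_nonneg _, ?_⟩
  simp only [Real.norm_eq_abs]
  exact Finset.sum_sq_le_sq_sum_of_nonneg fun i _ => abs_nonneg _

/-- The solution of a perturbed linear system. -/
theorem abs_add_sum_mul_le {M N : Matrix (Fin d) (Fin d) ℝ} (hMN : M * N = 1) {u : Param d}
    {g : Fin d → ℝ} {ε : ℝ} (hg : ∀ k, |g k + ∑ j, u j * M j k| ≤ ε * ‖u‖)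
    (hε : d * (∑ i, ∑ k, |N k i|) * ε ≤ 1 / 2) (i : Fin d) :
    |u i + ∑ k, g k * N k i| ≤ 2 * (∑ i, ∑ k, |N k i|) ^ 2 * (ε * ∑ k, |g k|) := by
  set C := ∑ i, ∑ k, |N k i| with hC
  have hC0 : 0 ≤ C := by positivity
  rcases (norm_nonneg u).eq_or_lt' with hu | hu
  -- The case `u = 0` is separate because the sign of `ε` can be read off the hypothesis only when
  -- `‖u‖ > 0`.
  · have hu0 : u = 0 := norm_eq_zero.1 hu
    have hg0 : ∀ k, g k = 0 := fun k => by simpa [hu0] using hg k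
    simp [hu0, hg0]
  have hε0 : 0 ≤ ε := by
    have := (abs_nonneg _).trans (hg i)
    exact nonneg_of_mul_nonneg_left this hu
  have hsum : ∀ i, u i + ∑ k, g k * N k i = ∑ k, (g k + ∑ j, u j * M j k) * N k i := by
    intro i
    have h1 : ∑ k, (∑ j, u j * M j k) * N k i = u i := by
      simp_rw [Finset.sum_mul, mul_assoc]
      rw [Finset.sum_comm]
      simp_rw [← Finset.mul_sum, ← Matrix.mul_apply, hMN, Matrix.one_apply]
      simp
    simp_rw [add_mul, Finset.sum_add_distrib, h1]
    ring
  have hcol : ∀ i, ∑ k, |N k i| ≤ C := fun i =>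
    Finset.single_le_sum (f := fun i => ∑ k, |N k i|) (fun i _ => by positivity) (Finset.mem_univ i)
  have h1 : ∀ i, |u i + ∑ k, g k * N k i| ≤ C * (ε * ‖u‖) := by
    intro i
    rw [hsum]
    refine (Finset.abs_sum_le_sum_abs _ _).trans ?_
    calc ∑ k, |(g k + ∑ j, u j * M j k) * N k i| ≤ ∑ k, (ε * ‖u‖) * |N k i| := by
          refine Finset.sum_le_sum fun k _ => ?_
          rw [abs_mul]
          exact mul_le_mul_of_nonneg_right (hg k) (abs_nonneg _)
      _ = (ε * ‖u‖) * ∑ k, |N k i| := by rw [Finset.mul_sum]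
      _ ≤ C * (ε * ‖u‖) := by
          rw [mul_comm]
          exact mul_le_mul_of_nonneg_right (hcol i) (by positivity)
  have h2 : ∑ i, |∑ k, g k * N k i| ≤ C * ∑ k, |g k| := by
    rw [hC, Finset.sum_mul]
    refine Finset.sum_le_sum fun i _ => ?_
    refine (Finset.abs_sum_le_sum_abs _ _).trans ?_
    rw [Finset.sum_mul]
    refine Finset.sum_le_sum fun k _ => ?_
    rw [abs_mul, mul_comm]
    exact mul_le_mul_of_nonneg_left
      (Finset.single_le_sum (f := fun k => |g k|) (fun k _ => abs_nonneg _) (Finset.mem_univ k))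
      (abs_nonneg _)
  -- The bound on `u` is self-referential; smallness of `ε` lets half of `‖u‖` be absorbed on the
  -- left, so the error is expressed through `g` alone.
  have h3 : ‖u‖ ≤ C * ∑ k, |g k| + d * (C * (ε * ‖u‖)) := by
    refine (norm_le_sum_abs u).trans ?_
    have : ∀ i ∈ Finset.univ, |u i| ≤ |∑ k, g k * N k i| + C * (ε * ‖u‖) := by
      intro i _
      have e : u i = (u i + ∑ k, g k * N k i) - ∑ k, g k * N k i := by ring
      have := abs_sub (u i + ∑ k, g k * N k i) (∑ k, g k * N k i)
      rw [← e] at this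
      linarith [h1 i]
    refine (Finset.sum_le_sum this).trans ?_
    rw [Finset.sum_add_distrib]
    simp only [Finset.sum_const, Finset.card_univ, Fintype.card_fin, nsmul_eq_mul]
    linarith
  have h4 : ‖u‖ ≤ 2 * (C * ∑ k, |g k|) := by
    have : d * (C * (ε * ‖u‖)) ≤ 1 / 2 * ‖u‖ := by
      calc d * (C * (ε * ‖u‖)) = d * C * ε * ‖u‖ := by ring
        _ ≤ 1 / 2 * ‖u‖ := mul_le_mul_of_nonneg_right hε hu.le
    linarith
  calc |u i + ∑ k, g k * N k i| ≤ C * (ε * ‖u‖) := h1 i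
    _ ≤ C * (ε * (2 * (C * ∑ k, |g k|))) := by gcongr
    _ = _ := by ring

variable {f : Param d → ℝ → ℝ} {Θ : Set (Param d)} {θ₀ : Param d}
  {Q : Measure Obs} [IsProbabilityMeasure Q] {ψ : Obs → ℝ} {D : ℝ}
  {Ω : Type*} [MeasurableSpace Ω] {P : Measure Ω} [IsProbabilityMeasure P]
  {x : ℕ → Ω → Obs} {r : ℕ → ℕ} {π : ℕ → ℕ → Ω → ℝ} {a : ℕ → ℕ → Ω → ℕ}
  {θtilde : ℕ → Ω → Param d}

/-- The asymptotic linear representation of the subsampling estimator. -/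
theorem tendsto_sqrt_mul_estimator_add (hm : IsSmoothModel f Θ θ₀ Q ψ D)
    (hint : θ₀ ∈ interior Θ)
    (hLLN : ∀ h : Obs → ℝ, MemLp h 2 Q →
      Tendsto (fun q : ℕ × Ω => subAvg x r π a h q.1 q.2) (probFilter P) (𝓝 (∫ z, h z ∂Q)))
    (hreg : ∀ᶠ q : ℕ × Ω in probFilter P, IsRegularSample f Θ ψ x r π a θtilde q.1 q.2)
    (hcons : Tendsto (fun q : ℕ × Ω => θtilde q.1 q.2) (probFilter P) (𝓝 θ₀))
    {N : Matrix (Fin d) (Fin d) ℝ} (hN : meanHess f Q θ₀ * N = 1) {g : Fin d → Obs → ℝ}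
    (hg : ∀ᵐ ω ∂P, ∀ i k, score f (x i ω) θ₀ k = g k (x i ω))
    (hOp : ∀ k, BoundedInProb P fun n ω => √(r n) * subAvg x r π a (g k) n ω) (i : Fin d) :
    Tendsto (fun q : ℕ × Ω => √(r q.1) * ((θtilde q.1 q.2 - θ₀) i +
      ∑ k, subAvg x r π a (g k) q.1 q.2 * N k i)) (probFilter P) (𝓝 0) := by
  set M := meanHess f Q θ₀ with hM
  -- One relative error for the linear system: deviation of the averaged Hessian from `M`, plus the
  -- Taylor remainder divided by `‖u‖`. Consistency and the law of large numbers send it to zero.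
  set ε : ℕ × Ω → ℝ := fun q =>
    ∑ k, ∑ j, |subAvg x r π a (fun z => hess f z θ₀ j k) q.1 q.2 - M j k| +
      d * ‖θtilde q.1 q.2 - θ₀‖ * subAvg x r π a (fun z => |ψ z|) q.1 q.2 with hε
  set C := ∑ i, ∑ k, |N k i| with hC
  have hεlim : Tendsto ε (probFilter P) (𝓝 0) := by
    have h1 : ∀ k j, Tendsto (fun q : ℕ × Ω =>
        |subAvg x r π a (fun z => hess f z θ₀ j k) q.1 q.2 - M j k|) (probFilter P) (𝓝 0) := by
      intro k j
      have := (hLLN _ (hm.memLp_hess θ₀ hm.mem j k)).sub_const (M j k)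
      have e : ∫ z, hess f z θ₀ j k ∂Q = M j k := rfl
      rw [e, sub_self] at this
      simpa using this.abs
    have h2 : Tendsto (fun q : ℕ × Ω => ‖θtilde q.1 q.2 - θ₀‖) (probFilter P) (𝓝 0) := by
      simpa using (hcons.sub_const θ₀).norm
    have h3 := (tendsto_finsetSum Finset.univ fun k _ =>
      tendsto_finsetSum Finset.univ fun j _ => h1 k j).add
      ((h2.const_mul (d : ℝ)).mul (hLLN (fun z => |ψ z|) hm.memLp_psi.abs))
    simpa only [Finset.sum_const_zero, mul_zero, zero_mul, add_zero] using h3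
  have hOp' : BoundedInProb P fun n ω => ∑ k, |√(r n) * subAvg x r π a (g k) n ω| :=
    BoundedInProb.sum _ fun k _ => (hOp k).mono fun n ω => by rw [abs_abs]
  have hbound := (hOp'.tendsto_mul hεlim).const_mul (2 * C ^ 2)
  rw [mul_zero] at hbound
  -- Interiority of `θ₀` enters here: consistency carries it over to the estimator, where the score
  -- equation then holds.
  have hint' : ∀ᶠ q : ℕ × Ω in probFilter P, θtilde q.1 q.2 ∈ interior Θ :=
    hcons (isOpen_interior.mem_nhds hint)
  have hsmall : ∀ᶠ q : ℕ × Ω in probFilter P, d * C * ε q ≤ 1 / 2 := by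
    have := hεlim.const_mul (d * C)
    rw [mul_zero] at this
    exact (this.eventually_lt_const (by norm_num : (0 : ℝ) < 1 / 2)).mono fun q hq => hq.le
  have hg' : ∀ᶠ q : ℕ × Ω in probFilter P, ∀ i k, score f (x i q.2) θ₀ k = g k (x i q.2) :=
    eventually_probFilter_of_ae (p := fun _ ω => ∀ i k, score f (x i ω) θ₀ k = g k (x i ω))
      (Eventually.of_forall fun _ => hg)
  refine squeeze_zero_norm' ?_ hbound
  filter_upwards [hreg, hint', hsmall, hg'] with ⟨n, ω⟩ hq hqi hqs hqg
  simp only at hq hqi hqs hqg ⊢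
  set u := θtilde n ω - θ₀ with hu
  have key : ∀ k, |subAvg x r π a (g k) n ω + ∑ j, u j * M j k| ≤ ε (n, ω) * ‖u‖ := by
    intro k
    have h1 := hq.abs_score_add_le hm.convex hm.mem hqi k
    rw [subAvg_congr (h := g k) fun i => hqg i k, ← hu] at h1
    have h2 : |∑ j, u j * (subAvg x r π a (fun z => hess f z θ₀ j k) n ω - M j k)| ≤
        ‖u‖ * ∑ j, |subAvg x r π a (fun z => hess f z θ₀ j k) n ω - M j k| := by
      refine (Finset.abs_sum_le_sum_abs _ _).trans ?_
      rw [Finset.mul_sum]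
      refine Finset.sum_le_sum fun j _ => ?_
      rw [abs_mul]
      exact mul_le_mul_of_nonneg_right (abs_apply_le_norm u j) (abs_nonneg _)
    have h3 : ∑ j, |subAvg x r π a (fun z => hess f z θ₀ j k) n ω - M j k| ≤
        ∑ k, ∑ j, |subAvg x r π a (fun z => hess f z θ₀ j k) n ω - M j k| :=
      Finset.single_le_sum (f := fun k => ∑ j,
        |subAvg x r π a (fun z => hess f z θ₀ j k) n ω - M j k|)
        (fun k _ => by positivity) (Finset.mem_univ k)
    have e : subAvg x r π a (g k) n ω + ∑ j, u j * M j k =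
        (subAvg x r π a (g k) n ω +
          ∑ j, u j * subAvg x r π a (fun z => hess f z θ₀ j k) n ω) -
        ∑ j, u j * (subAvg x r π a (fun z => hess f z θ₀ j k) n ω - M j k) := by
      simp_rw [mul_sub, Finset.sum_sub_distrib]
      ring
    rw [e]
    refine (abs_sub _ _).trans ((add_le_add h1 (h2.trans
      (mul_le_mul_of_nonneg_left h3 (norm_nonneg u)))).trans (le_of_eq ?_))
    simp only [hε]
    ring
  have h4 := abs_add_sum_mul_le hN key hqs i
  rw [norm_mul, Real.norm_of_nonneg (Real.sqrt_nonneg _), Real.norm_eq_abs]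
  refine (mul_le_mul_of_nonneg_left h4 (Real.sqrt_nonneg _)).trans (le_of_eq ?_)
  simp_rw [abs_mul, abs_of_nonneg (Real.sqrt_nonneg _), ← Finset.mul_sum]
  ring

end Linearization

end CensoredSubsampling
namespace CensoredSubsampling

/-! ### The inverse square root and congruences. -/

section Matrices

variable {d : ℕ}

theorem invSqrt_transpose (V : Matrix (Fin d) (Fin d) ℝ) : (invSqrt V)ᵀ = invSqrt V := by
  have h : IsSelfAdjoint (invSqrt V) := cfc_predicate _ V
  rw [← Matrix.conjTranspose_eq_transpose_of_trivial]
  exact h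

/-- On the positive spectrum of `V`, `t ↦ (√t)⁻¹` is continuous and `(√t)⁻¹ t (√t)⁻¹ = 1`; the
functional calculus is multiplicative. -/
theorem invSqrt_mul_mul_invSqrt {V : Matrix (Fin d) (Fin d) ℝ} (hV : V.PosDef) :
    invSqrt V * V * invSqrt V = 1 := by
  have hsa : IsSelfAdjoint V := hV.isHermitian
  have hpos : ∀ t ∈ spectrum ℝ V, 0 < t := by
    intro t ht
    rw [hV.isHermitian.spectrum_real_eq_range_eigenvalues] at ht
    obtain ⟨i, rfl⟩ := ht
    exact hV.eigenvalues_pos i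
  have hc : ContinuousOn (fun t : ℝ => (√t)⁻¹) (spectrum ℝ V) :=
    Real.continuous_sqrt.continuousOn.inv₀ fun t ht => (Real.sqrt_pos.2 (hpos t ht)).ne'
  have h1 : cfc (fun t : ℝ => (√t)⁻¹ * t * (√t)⁻¹) V = invSqrt V * V * invSqrt V := by
    rw [cfc_mul (fun t : ℝ => (√t)⁻¹ * t) (fun t : ℝ => (√t)⁻¹) V (hc.mul continuousOn_id) hc,
      cfc_mul (fun t : ℝ => (√t)⁻¹) (fun t : ℝ => t) V hc continuousOn_id, cfc_id' ℝ V, invSqrt]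
  rw [← h1, cfc_congr (g := fun _ => (1 : ℝ)), cfc_const_one ℝ V]
  intro t ht
  have := Real.sqrt_pos.2 (hpos t ht)
  have h2 := Real.sq_sqrt (hpos t ht).le
  simp only
  field_simp
  exact h2.symm

theorem dotProduct_congr_mulVec (A B : Matrix (Fin d) (Fin d) ℝ) (v : Fin d → ℝ) :
    (B *ᵥ v) ⬝ᵥ A *ᵥ (B *ᵥ v) = v ⬝ᵥ (Bᵀ * A * B) *ᵥ v := by
  rw [← Matrix.mulVec_mulVec, ← Matrix.mulVec_mulVec, Matrix.dotProduct_mulVec v Bᵀ,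
    Matrix.vecMul_transpose]

theorem posDef_inv_mul_mul_inv {M A : Matrix (Fin d) (Fin d) ℝ} (hM : (-M).PosDef)
    (hA : A.PosDef) : (M⁻¹ * A * M⁻¹).PosDef := by
  have hM' : M.IsHermitian := by simpa using hM.isHermitian.neg
  have hu : IsUnit M := by simpa using hM.isUnit.neg
  have h : (M⁻¹)ᴴ = M⁻¹ := hM'.inv
  have := hA.conjTranspose_mul_mul_same (B := M⁻¹)
    (Matrix.mulVec_injective_iff_isUnit.2 ((Matrix.isUnit_nonsing_inv_iff).2 hu))
  rwa [h] at this

end Matrices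

/-! ### Positivity of the limiting subsampling variance. -/

section Variance

variable {Ω : Type*} [MeasurableSpace Ω] {P : Measure Ω} [IsProbabilityMeasure P]
  {x : ℕ → Ω → Obs} {Q : Measure Obs} {h : Obs → ℝ}
  {r : ℕ → ℕ} {π : ℕ → ℕ → Ω → ℝ} {a : ℕ → ℕ → Ω → ℕ}

instance neBot_probFilter : (probFilter P).NeBot := by
  rw [neBot_iff, Ne, ← empty_mem_iff_bot]
  intro h
  have h1 : Tendsto (fun n : ℕ => P {ω : Ω | (n, ω) ∉ (∅ : Set (ℕ × Ω))}) atTop (𝓝 0) := h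
  simp at h1

/-- Cauchy–Schwarz for the probability weights `π_i`: the square of the mean of a weighted draw is
at most its second moment. The left side no longer involves `π`, so its limit is known. -/
theorem IsGeneralSubsampling.sq_fullAvg_abs_le (hsub : IsGeneralSubsampling P x r π a) {n : ℕ}
    (hn : 1 ≤ n) (ω : Ω) :
    fullAvg x (fun z => |h z|) n ω ^ 2 ≤
      (1 / (n : ℝ) ^ 2) * ∑ i ∈ Finset.range n, (1 / π n i ω) * h (x i ω) ^ 2 := by
  rw [← hsub.sum_prob_mul_weighted]
  have h1 := Finset.sum_sq_le_sum_mul_sum_of_sq_le_mul Finset.univ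
    (r := fun i : Fin n => π n i ω * (((n : ℝ) * π n i ω)⁻¹ * |h (x i ω)|))
    (f := fun i : Fin n => π n i ω)
    (g := fun i : Fin n => π n i ω * (((n : ℝ) * π n i ω)⁻¹ * |h (x i ω)|) ^ 2)
    (fun i _ => (hsub.prob_pos n i ω i.2).le)
    (fun i _ => mul_nonneg (hsub.prob_pos n i ω i.2).le (sq_nonneg _)) fun i _ => le_of_eq (by ring)
  refine h1.trans (le_of_eq ?_)
  rw [hsub.sum_prob_fin hn, one_mul, Finset.sum_range, Finset.mul_sum]
  refine Finset.sum_congr rfl fun i _ => ?_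
  rw [hsub.prob_mul_weighted_sq (h := fun z => |h z|), sq_abs]
  have := (hsub.prob_pos n i ω i.2).ne'
  field_simp

/-- The limit of the subsampling variances is positive. -/
theorem IsGeneralSubsampling.pos_of_tendsto (hsub : IsGeneralSubsampling P x r π a)
    (hx : ∀ i, Measurable (x i)) (hind : iIndepFun x P) (hlaw : ∀ i, P.map (x i) = Q)
    (hhm : Measurable h) (hh : MemLp h 2 Q) (hpos : 0 < ∫ z, h z ^ 2 ∂Q) {v : ℝ}
    (hv : Tendsto (fun q : ℕ × Ω => (1 / (q.1 : ℝ) ^ 2) *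
      ∑ i ∈ Finset.range q.1, (1 / π q.1 i q.2) * h (x i q.2) ^ 2) (probFilter P) (𝓝 v)) :
    0 < v := by
  have hQ : IsProbabilityMeasure Q := hlaw 0 ▸ Measure.isProbabilityMeasure_map (hx 0).aemeasurable
  have hi : Integrable (fun z => |h z|) Q := (hh.integrable one_le_two).abs
  have hE : 0 < ∫ z, |h z| ∂Q := by
    refine lt_of_le_of_ne (integral_nonneg fun z => abs_nonneg _) fun h0 => hpos.ne' ?_
    have h1 := (integral_eq_zero_iff_of_nonneg (fun z => abs_nonneg (h z)) hi).1 h0.symm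
    have h2 : (fun z => h z ^ 2) =ᵐ[Q] fun _ => 0 := by
      filter_upwards [h1] with z hz
      have : h z = 0 := abs_eq_zero.1 hz
      simp [this]
    rw [integral_congr_ae h2, integral_zero]
  have h3 := (tendsto_fullAvg hx hind hlaw (measurable_norm.comp hhm) hi).pow 2
  refine lt_of_lt_of_le (pow_pos hE 2) (le_of_tendsto_of_tendsto h3 hv ?_)
  have h4 : ∀ᶠ q : ℕ × Ω in probFilter P, 1 ≤ q.1 :=
    tendsto_fst_probFilter.eventually (eventually_ge_atTop 1)
  filter_upwards [h4] with q hq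
  exact hsub.sq_fullAvg_abs_le hq q.2

end Variance

/-! ### Quadratic forms of the score matrices. -/

section Score

variable {d : ℕ} {f : Param d → ℝ → ℝ} {θ₀ : Param d}
  {Q : Measure Obs} {g : Fin d → Obs → ℝ}

theorem sq_sum_mul (w y : Fin d → ℝ) :
    (∑ k, w k * y k) ^ 2 = ∑ j, ∑ k, w j * w k * (y j * y k) := by
  rw [sq, Finset.sum_mul_sum]
  exact Finset.sum_congr rfl fun j _ => Finset.sum_congr rfl fun k _ => by ring

theorem LambdaG_apply (n : ℕ) (p : ℕ → ℝ) (x : ℕ → Obs) (j k : Fin d) :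
    LambdaG f n p x θ₀ j k = (1 / (n : ℝ) ^ 2) * ∑ i ∈ Finset.range n,
      (1 / p i) * (score f (x i) θ₀ j * score f (x i) θ₀ k) := by
  simp [LambdaG, scoreSq, Matrix.sum_apply]

theorem sum_sq_eq_dotProduct_LambdaG {x : ℕ → Obs}
    (hg : ∀ i k, score f (x i) θ₀ k = g k (x i)) (n : ℕ) (p : ℕ → ℝ) (w : Fin d → ℝ) :
    (1 / (n : ℝ) ^ 2) * ∑ i ∈ Finset.range n, (1 / p i) * (∑ k, w k * g k (x i)) ^ 2 =
      ∑ j, ∑ k, w j * w k * LambdaG f n p x θ₀ j k := by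
  simp_rw [sq_sum_mul, LambdaG_apply, hg, Finset.mul_sum]
  rw [Finset.sum_comm]
  refine Finset.sum_congr rfl fun j _ => ?_
  rw [Finset.sum_comm]
  exact Finset.sum_congr rfl fun k _ => Finset.sum_congr rfl fun i _ => by ring

theorem integral_sq_eq_dotProduct_Lambda (hgL : ∀ k, MemLp (g k) 2 Q)
    (hg : ∀ᵐ z ∂Q, ∀ k, score f z θ₀ k = g k z) (w : Fin d → ℝ) :
    ∫ z, (∑ k, w k * g k z) ^ 2 ∂Q = w ⬝ᵥ Lambda f Q θ₀ *ᵥ w := by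
  have hi : ∀ j k, Integrable (fun z => w j * w k * (g j z * g k z)) Q := fun j k =>
    ((hgL j).integrable_mul (hgL k)).const_mul _
  simp_rw [sq_sum_mul, dotProduct_mulVec_eq_sum]
  rw [integral_finsetSum _ fun j _ => integrable_finsetSum _ fun k _ => hi j k]
  refine Finset.sum_congr rfl fun j _ => ?_
  rw [integral_finsetSum _ fun k _ => hi j k]
  refine Finset.sum_congr rfl fun k _ => ?_
  rw [integral_const_mul, Lambda, Matrix.of_apply]
  congr 1
  refine integral_congr_ae ?_
  filter_upwards [hg] with z hz
  simp [scoreSq, hz]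

end Score

/-! ### Limits in a fixed direction. -/

section Asymptotics

variable {d : ℕ} {f : Param d → ℝ → ℝ} {θ₀ : Param d} {Q : Measure Obs}
  {Ω : Type*} [MeasurableSpace Ω] {P : Measure Ω} [IsProbabilityMeasure P]
  {x : ℕ → Ω → Obs} {r : ℕ → ℕ} {π : ℕ → ℕ → Ω → ℝ} {a : ℕ → ℕ → Ω → ℕ}
  {θtilde : ℕ → Ω → Param d} {g : Fin d → Obs → ℝ} {Λ₁ : Matrix (Fin d) (Fin d) ℝ}

/-- The entrywise limit of `Λ_g(θ₀)` is turned into the variance hypothesis of the scalar central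
limit theorem for the combination `∑ w_k g_k`. -/
theorem tendsto_sum_sq_of_tendsto_LambdaG
    (hg : ∀ᵐ ω ∂P, ∀ i k, score f (x i ω) θ₀ k = g k (x i ω))
    (hΛ : ∀ j k, Tendsto (fun q : ℕ × Ω =>
      LambdaG f q.1 (fun i => π q.1 i q.2) (fun i => x i q.2) θ₀ j k) (probFilter P)
        (𝓝 (Λ₁ j k))) (w : Fin d → ℝ) :
    Tendsto (fun q : ℕ × Ω => (1 / (q.1 : ℝ) ^ 2) * ∑ i ∈ Finset.range q.1,
      (1 / π q.1 i q.2) * (∑ k, w k * g k (x i q.2)) ^ 2) (probFilter P)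
        (𝓝 (w ⬝ᵥ Λ₁ *ᵥ w)) := by
  rw [dotProduct_mulVec_eq_sum]
  have h1 := tendsto_finsetSum Finset.univ fun j _ => tendsto_finsetSum Finset.univ fun k _ =>
    (hΛ j k).const_mul (w j * w k)
  refine h1.congr' ?_
  have h2 : ∀ᶠ q : ℕ × Ω in probFilter P, ∀ i k, score f (x i q.2) θ₀ k = g k (x i q.2) :=
    eventually_probFilter_of_ae (p := fun _ ω => ∀ i k, score f (x i ω) θ₀ k = g k (x i ω))
      (Eventually.of_forall fun _ => hg)
  filter_upwards [h2] with q hq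
  exact (sum_sq_eq_dotProduct_LambdaG (x := fun i => x i q.2) hq q.1 _ w).symm

theorem isHermitian_of_tendsto_LambdaG (hΛ : ∀ j k, Tendsto (fun q : ℕ × Ω =>
      LambdaG f q.1 (fun i => π q.1 i q.2) (fun i => x i q.2) θ₀ j k) (probFilter P)
        (𝓝 (Λ₁ j k))) : Λ₁.IsHermitian := by
  refine Matrix.IsHermitian.ext fun j k => ?_
  refine tendsto_nhds_unique (hΛ k j) ((hΛ j k).congr fun q => ?_)
  simp only [LambdaG_apply]
  congr 1
  exact Finset.sum_congr rfl fun i _ => by ring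

/-- The characteristic functions of the normalized linear combinations of the coordinates of the
estimation error. -/
theorem tendsto_integral_exp_estimator (hsub : IsGeneralSubsampling P x r π a)
    (hx : ∀ i, Measurable (x i))
    (hπ : BoundedInProb P fun n ω => ⨆ i : Fin n, ((n : ℝ) * π n i ω)⁻¹)
    (hr : Tendsto r atTop atTop) (hind : iIndepFun x P) (hlaw : ∀ i, P.map (x i) = Q)
    {γ : ℝ} (hγ : Tendsto (fun n => (r n : ℝ) / (n : ℝ)) atTop (𝓝 γ))
    (hgm : ∀ k, Measurable (g k)) (hgL : ∀ k, MemLp (g k) 2 Q) (hg0 : ∀ k, ∫ z, g k z ∂Q = 0)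
    (hgQ : ∀ᵐ z ∂Q, ∀ k, score f z θ₀ k = g k z)
    (hg : ∀ᵐ ω ∂P, ∀ i k, score f (x i ω) θ₀ k = g k (x i ω))
    (hΛ : ∀ j k, Tendsto (fun q : ℕ × Ω =>
      LambdaG f q.1 (fun i => π q.1 i q.2) (fun i => x i q.2) θ₀ j k) (probFilter P)
        (𝓝 (Λ₁ j k)))
    (hθm : ∀ n, AEMeasurable (θtilde n) P) {N : Matrix (Fin d) (Fin d) ℝ}
    (hrep : ∀ i, Tendsto (fun q : ℕ × Ω => √(r q.1) * ((θtilde q.1 q.2 - θ₀) i +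
      ∑ k, subAvg x r π a (g k) q.1 q.2 * N k i)) (probFilter P) (𝓝 0)) (c : Fin d → ℝ) :
    Tendsto (fun n => ∫ ω, Complex.exp ((√(r n) * ∑ i, c i * (θtilde n ω - θ₀) i : ℝ) *
      Complex.I) ∂P) atTop (𝓝 (Complex.exp
        (-((N *ᵥ c) ⬝ᵥ (Λ₁ + γ • Lambda f Q θ₀) *ᵥ (N *ᵥ c)) / 2 : ℝ))) := by
  have hQ : IsProbabilityMeasure Q := hlaw 0 ▸ Measure.isProbabilityMeasure_map (hx 0).aemeasurable
  -- The linear representation gives `∑ c_i u_i ≈ -∑_k (N c)_k subAvg (g_k)`, so this is the score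
  -- combination that governs direction `c`.
  set w : Fin d → ℝ := fun k => -(N *ᵥ c) k with hw
  have hw' : w = -(N *ᵥ c) := rfl
  set h : Obs → ℝ := fun z => ∑ k, w k * g k z with hh
  have hhm : Measurable h := Finset.measurable_fun_sum _ fun k _ => (hgm k).const_mul _
  have hhL : MemLp h 2 Q := memLp_finsetSum _ fun k _ => (hgL k).const_mul _
  have hh0 : ∫ z, h z ∂Q = 0 := by
    rw [hh, integral_finsetSum _ fun k _ => ((hgL k).integrable one_le_two).const_mul _]
    simp [integral_const_mul, hg0]
  have h1 := hsub.tendsto_integral_exp_subAvg hx hπ hr hind hlaw hhm hhL hh0 hγ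
    (tendsto_sum_sq_of_tendsto_LambdaG hg hΛ w)
  rw [integral_sq_eq_dotProduct_Lambda hgL hgQ] at h1
  have hval : w ⬝ᵥ Λ₁ *ᵥ w + γ * (w ⬝ᵥ Lambda f Q θ₀ *ᵥ w) =
      (N *ᵥ c) ⬝ᵥ (Λ₁ + γ • Lambda f Q θ₀) *ᵥ (N *ᵥ c) := by
    rw [hw', Matrix.add_mulVec, Matrix.smul_mulVec, dotProduct_add, dotProduct_smul]
    simp [Matrix.mulVec_neg]
  rw [hval] at h1
  have hdiff : Tendsto (fun q : ℕ × Ω => √(r q.1) * ∑ i, c i * (θtilde q.1 q.2 - θ₀) i -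
      √(r q.1) * subAvg x r π a h q.1 q.2) (probFilter P) (𝓝 0) := by
    have h2 := tendsto_finsetSum Finset.univ fun i _ => (hrep i).const_mul (c i)
    simp only [mul_zero, Finset.sum_const_zero] at h2
    refine h2.congr fun q => ?_
    have h3 : subAvg x r π a h q.1 q.2 =
        -∑ i, c i * ∑ k, subAvg x r π a (g k) q.1 q.2 * N k i := by
      rw [hh, subAvg_sum]
      simp_rw [subAvg_const_mul, hw, Matrix.mulVec, dotProduct, neg_mul, Finset.sum_neg_distrib,
        Finset.sum_mul, Finset.mul_sum]
      rw [Finset.sum_comm]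
      congr 1
      exact Finset.sum_congr rfl fun i _ => Finset.sum_congr rfl fun k _ => by ring
    rw [h3, Finset.mul_sum, mul_neg, sub_neg_eq_add, Finset.mul_sum, ← Finset.sum_add_distrib]
    exact Finset.sum_congr rfl fun i _ => by ring
  have hexp : ∀ s t : ℝ, Complex.exp (s * Complex.I) - Complex.exp (t * Complex.I) =
      Complex.exp (t * Complex.I) * (Complex.exp ((s - t : ℝ) * Complex.I) - 1) := by
    intro s t
    rw [mul_sub, mul_one, ← Complex.exp_add]
    congr 2
    push_cast
    ring
  have hZ : Tendsto (fun q : ℕ × Ω =>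
      Complex.exp ((√(r q.1) * ∑ i, c i * (θtilde q.1 q.2 - θ₀) i : ℝ) * Complex.I) -
      Complex.exp ((√(r q.1) * subAvg x r π a h q.1 q.2 : ℝ) * Complex.I))
      (probFilter P) (𝓝 0) := by
    have hcont : Continuous fun t : ℝ => ‖Complex.exp (t * Complex.I) - 1‖ := by fun_prop
    have h4 := (hcont.tendsto 0).comp hdiff
    simp only [Complex.ofReal_zero, zero_mul, Complex.exp_zero, sub_self, norm_zero] at h4
    refine squeeze_zero_norm (fun q => ?_) h4
    rw [hexp, norm_mul, Complex.norm_exp_ofReal_mul_I, one_mul]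
    exact le_rfl
  have h5 := tendsto_integral_of_tendsto_probFilter
    (Z := fun n ω => Complex.exp ((√(r n) * ∑ i, c i * (θtilde n ω - θ₀) i : ℝ) * Complex.I) -
      Complex.exp ((√(r n) * subAvg x r π a h n ω : ℝ) * Complex.I)) (C := 2) (fun n ω => by
      refine (norm_sub_le _ _).trans ?_
      rw [Complex.norm_exp_ofReal_mul_I, Complex.norm_exp_ofReal_mul_I]
      norm_num) hZ
  have hint : ∀ Y : Ω → ℝ, AEMeasurable Y P →
      Integrable (fun ω => Complex.exp ((Y ω : ℝ) * Complex.I)) P := by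
    intro Y hY
    refine Integrable.of_bound (C := 1) ?_ (Eventually.of_forall fun ω => ?_)
    · have : Continuous fun t : ℝ => Complex.exp (t * Complex.I) := by fun_prop
      exact (this.measurable.comp_aemeasurable hY).aestronglyMeasurable
    · rw [Complex.norm_exp_ofReal_mul_I]
  have h6 := h5.add h1
  rw [zero_add] at h6
  refine h6.congr fun n => ?_
  have hYm : AEMeasurable (fun ω => √(r n) * ∑ i, c i * (θtilde n ω - θ₀) i) P := by
    refine (Finset.aemeasurable_fun_sum _ fun i _ => AEMeasurable.const_mul ?_ _).const_mul _
    have hi : Measurable fun u : Param d => (u - θ₀) i := by fun_prop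
    exact hi.comp_aemeasurable (hθm n)
  rw [integral_sub (hint _ hYm) (hint _ ((hsub.aemeasurable_subAvg hx hhm n).const_mul _)),
    sub_add_cancel]

end Asymptotics

end CensoredSubsampling
namespace CensoredSubsampling

/-! ### Standardization and assembly. -/

section MainTheorem

variable {d : ℕ} {f : Param d → ℝ → ℝ} {Θ : Set (Param d)} {θ₀ : Param d} {Q : Measure Obs}
  {Ω : Type*} [MeasurableSpace Ω] {P : Measure Ω} [IsProbabilityMeasure P]
  {x : ℕ → Ω → Obs} {r : ℕ → ℕ} {π : ℕ → ℕ → Ω → ℝ} {a : ℕ → ℕ → Ω → ℕ}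
  {θtilde : ℕ → Ω → Param d} {g : Fin d → Obs → ℝ} {Λ₁ : Matrix (Fin d) (Fin d) ℝ}

theorem dotProduct_self_eq_norm_sq (t : Param d) : t.ofLp ⬝ᵥ t.ofLp = ‖t‖ ^ 2 := by
  rw [EuclideanSpace.real_norm_sq_eq]
  exact Finset.sum_congr rfl fun i _ => (sq _).symm

/-- Two congruences: moving the symmetric `M⁻¹` across turns `A` into `V = M⁻¹ A M⁻¹`, and moving
`V^{-1/2}` across turns `V` into the identity. -/
theorem dotProduct_standardized_eq_norm_sq {M A : Matrix (Fin d) (Fin d) ℝ}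
    (hM : M.IsHermitian) (hV : (M⁻¹ * A * M⁻¹).PosDef) (t : Param d) :
    (M⁻¹ *ᵥ (invSqrt (M⁻¹ * A * M⁻¹) *ᵥ t.ofLp)) ⬝ᵥ
      A *ᵥ (M⁻¹ *ᵥ (invSqrt (M⁻¹ * A * M⁻¹) *ᵥ t.ofLp)) = ‖t‖ ^ 2 := by
  have hN : (M⁻¹)ᵀ = M⁻¹ := by
    rw [← Matrix.conjTranspose_eq_transpose_of_trivial]
    exact hM.inv
  rw [dotProduct_congr_mulVec, hN, dotProduct_congr_mulVec, invSqrt_transpose,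
    invSqrt_mul_mul_invSqrt hV, Matrix.one_mulVec, dotProduct_self_eq_norm_sq]

theorem exists_isSmoothModel {G : Measure (EReal × ℝ)} (hmodel : IsRegularModel f Θ θ₀ G)
    (hlog : ∀ θ ∈ Θ, MemLp (fun z => logLik f z θ) 2 (obsLaw f θ₀ G))
    (hscore : ∀ θ ∈ Θ, MemLp (fun z => score f z θ) 2 (obsLaw f θ₀ G))
    (hhess : ∀ θ ∈ Θ, ∀ j k, MemLp (fun z => hess f z θ j k) 2 (obsLaw f θ₀ G))
    (hlip : ∃ ψ : Obs → ℝ, MemLp ψ 2 (obsLaw f θ₀ G) ∧ ∀ᵐ z ∂(obsLaw f θ₀ G),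
      ∀ θ₁ ∈ Θ, ∀ θ₂ ∈ Θ, ∀ j k,
        |hess f z θ₁ j k - hess f z θ₂ j k| ≤ ψ z * ‖θ₁ - θ₂‖) :
    ∃ ψ D, IsSmoothModel f Θ θ₀ (obsLaw f θ₀ G) ψ D := by
  obtain ⟨ψ, hψ, hl⟩ := hlip
  have hθ₀ := interior_subset hmodel.mem_interior
  refine ⟨ψ, Metric.diam Θ, hmodel.convex, hθ₀, fun θ hθ => ?_, hψ, ?_, hlog, hscore, hhess⟩
  · rw [← dist_eq_norm]
    exact Metric.dist_le_diam_of_mem hmodel.isCompact.isBounded hθ hθ₀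
  · filter_upwards [hmodel.contDiffAt, hl] with z h1 h2
    exact ⟨h1, h2⟩

/-- A version of the score at `θ₀` with measurable coordinates. -/
theorem exists_measurable_score (hx : ∀ i, Measurable (x i)) (hlaw : ∀ i, P.map (x i) = Q)
    (hs : MemLp (fun z => score f z θ₀) 2 Q) :
    ∃ g : Fin d → Obs → ℝ, (∀ k, Measurable (g k)) ∧
      (∀ᵐ z ∂Q, ∀ k, score f z θ₀ k = g k z) ∧
      ∀ᵐ ω ∂P, ∀ i k, score f (x i ω) θ₀ k = g k (x i ω) := by
  have hsm := hs.aestronglyMeasurable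
  have hQ : ∀ᵐ z ∂Q, ∀ k, score f z θ₀ k = hsm.mk _ z k := by
    filter_upwards [hsm.ae_eq_mk] with z hz k
    rw [← hz]
  refine ⟨fun k z => hsm.mk _ z k, fun k => ?_, hQ, ?_⟩
  · have hk : Measurable fun u : Param d => u k := by fun_prop
    exact hk.comp hsm.stronglyMeasurable_mk.measurable
  · rw [ae_all_iff]
    exact fun i => ae_of_ae_map (hx i).aemeasurable ((hlaw i).symm ▸ hQ :
      ∀ᵐ z ∂P.map (x i), ∀ k, score f z θ₀ k = hsm.mk _ z k)

/-- `Λ₁` is already positive definite by the Cauchy–Schwarz bound in every direction, and `γ ≥ 0` as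
a limit of ratios, so the second summand is positive semidefinite. -/
theorem posDef_add_smul_Lambda (hsub : IsGeneralSubsampling P x r π a)
    (hx : ∀ i, Measurable (x i)) (hind : iIndepFun x P) (hlaw : ∀ i, P.map (x i) = Q)
    {γ : ℝ} (hγ : Tendsto (fun n => (r n : ℝ) / (n : ℝ)) atTop (𝓝 γ))
    (hgm : ∀ k, Measurable (g k)) (hgL : ∀ k, MemLp (g k) 2 Q)
    (hgQ : ∀ᵐ z ∂Q, ∀ k, score f z θ₀ k = g k z)
    (hg : ∀ᵐ ω ∂P, ∀ i k, score f (x i ω) θ₀ k = g k (x i ω))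
    (hΛ : ∀ j k, Tendsto (fun q : ℕ × Ω =>
      LambdaG f q.1 (fun i => π q.1 i q.2) (fun i => x i q.2) θ₀ j k) (probFilter P)
        (𝓝 (Λ₁ j k))) (hpos : (Lambda f Q θ₀).PosDef) :
    (Λ₁ + γ • Lambda f Q θ₀).PosDef := by
  have hγ0 : 0 ≤ γ := ge_of_tendsto' hγ fun n => by positivity
  refine Matrix.PosDef.add_posSemidef ?_ (hpos.posSemidef.smul hγ0)
  refine Matrix.PosDef.of_dotProduct_mulVec_pos (isHermitian_of_tendsto_LambdaG hΛ) fun w hw => ?_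
  rw [star_trivial]
  refine hsub.pos_of_tendsto hx hind hlaw
    (Finset.measurable_fun_sum _ fun k _ => (hgm k).const_mul (w k))
    (memLp_finsetSum _ fun k _ => (hgL k).const_mul (w k)) ?_
    (tendsto_sum_sq_of_tendsto_LambdaG hg hΛ w)
  rw [integral_sq_eq_dotProduct_Lambda hgL hgQ]
  simpa using hpos.dotProduct_mulVec_pos hw

/-- Convergence to the standard Gaussian law, from the characteristic functions. -/
theorem tendstoInDistribution_stdGaussian {S : Matrix (Fin d) (Fin d) ℝ}
    (hθm : ∀ n, AEMeasurable (θtilde n) P)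
    (h : ∀ t : Param d, Tendsto (fun n => ∫ ω, Complex.exp
      ((√(r n) * ∑ i, (Sᵀ *ᵥ t.ofLp) i * (θtilde n ω - θ₀) i : ℝ) * Complex.I) ∂P) atTop
      (𝓝 (Complex.exp (-‖t‖ ^ 2 / 2 : ℝ)))) :
    TendstoInDistribution
      (fun n ω => Real.sqrt (r n) • Matrix.toEuclideanLin S (θtilde n ω - θ₀))
      atTop (id : Param d → Param d) (fun _ => P) (stdGaussian (Param d)) := by
  have hcont : ∀ n, Continuous fun u : Param d =>
      Real.sqrt (r n) • Matrix.toEuclideanLin S (u - θ₀) := fun n => by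
    have := LinearMap.continuous_of_finiteDimensional (Matrix.toEuclideanLin S)
    fun_prop
  have hYm : ∀ n, AEMeasurable
      (fun ω => Real.sqrt (r n) • Matrix.toEuclideanLin S (θtilde n ω - θ₀)) P := fun n =>
    (hcont n).measurable.comp_aemeasurable (hθm n)
  refine ⟨hYm, aemeasurable_id, ?_⟩
  refine ProbabilityMeasure.tendsto_iff_tendsto_charFun.2 fun t => ?_
  simp only [ProbabilityMeasure.coe_mk, Measure.map_id]
  rw [charFun_stdGaussian]
  have h1 := h t
  push_cast at h1
  refine h1.congr fun n => ?_
  rw [charFun_apply, integral_map (hYm n) (by fun_prop)]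
  refine integral_congr_ae (Eventually.of_forall fun ω => ?_)
  simp only
  congr 2
  have h2 : inner ℝ (Real.sqrt (r n) • Matrix.toEuclideanLin S (θtilde n ω - θ₀)) t =
      √(r n) * ∑ i, (Sᵀ *ᵥ t.ofLp) i * (θtilde n ω - θ₀) i := by
    rw [real_inner_smul_left]
    congr 1
    have h3 : inner ℝ (Matrix.toEuclideanLin S (θtilde n ω - θ₀)) t =
        t.ofLp ⬝ᵥ S *ᵥ (θtilde n ω - θ₀).ofLp := rfl
    rw [h3, Matrix.dotProduct_mulVec, ← Matrix.mulVec_transpose]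
    rfl
  rw [h2]
  push_cast
  rfl

end MainTheorem

end CensoredSubsampling
theorem mainTheorem5 {d : ℕ}
    -- the parametric lifetime model, the true parameter, the law of (censoring, truncation) times
    (f : CensoredSubsampling.Param d → ℝ → ℝ) (Θ : Set (CensoredSubsampling.Param d))
    (θ₀ : CensoredSubsampling.Param d)
    (G : Measure (EReal × ℝ)) [IsProbabilityMeasure G]
    (hmodel : CensoredSubsampling.IsRegularModel f Θ θ₀ G)
    -- the i.i.d. records
    {Ω : Type*} [MeasurableSpace Ω] (P : Measure Ω) [IsProbabilityMeasure P]
    (x : ℕ → Ω → CensoredSubsampling.Obs) (hx_meas : ∀ i, Measurable (x i))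
    (hx_indep : iIndepFun x P)
    (hx_law : ∀ i, P.map (x i) = CensoredSubsampling.obsLaw f θ₀ G)
    -- subsample sizes and the subsampling
    (r : ℕ → ℕ) (hr : Tendsto r atTop atTop)
    (γ : ℝ) (hγ : Tendsto (fun n => (r n : ℝ) / (n : ℝ)) atTop (𝓝 γ))
    (π : ℕ → ℕ → Ω → ℝ) (a : ℕ → ℕ → Ω → ℕ)
    (hsub : CensoredSubsampling.IsGeneralSubsampling P x r π a)
    -- the full-data maximum likelihood estimator
    (θhat : ℕ → Ω → CensoredSubsampling.Param d)
    (hmle : CensoredSubsampling.IsUniqueMLE P f Θ x θhat)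
    -- the subsampling estimator
    (θtilde : ℕ → Ω → CensoredSubsampling.Param d)
    (hθtilde_meas : ∀ n, AEMeasurable (θtilde n) P)
    (hθtilde : ∀ n, 1 ≤ n → ∀ᵐ ω ∂P, θtilde n ω ∈ Θ ∧
      IsMaxOn (CensoredSubsampling.subLogLik f (r n) (fun i => π n i ω) (fun j => a n j ω)
        fun i => x i ω) Θ (θtilde n ω))
    -- moment and regularity conditions
    (hmoments : CensoredSubsampling.LogLikMoments f Θ (CensoredSubsampling.obsLaw f θ₀ G))
    (hhess : CensoredSubsampling.HessianConditions f Θ (CensoredSubsampling.obsLaw f θ₀ G))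
    (hscore : CensoredSubsampling.ScoreConditions P f Θ (CensoredSubsampling.obsLaw f θ₀ G)
      x θhat)
    -- the subsampling probabilities are not too small
    (hπ : CensoredSubsampling.BoundedInProb P fun n ω =>
      ⨆ i : Fin n, ((n : ℝ) * π n i ω)⁻¹)
    -- convergence (in probability, entry by entry) of `Λ_g(θ₀)`
    (Λ₁ : Matrix (Fin d) (Fin d) ℝ)
    (hΛ : ∀ j k, TendstoInMeasure P
      (fun n ω => CensoredSubsampling.LambdaG f n (fun i => π n i ω) (fun i => x i ω) θ₀ j k)
      atTop (fun _ => Λ₁ j k)) :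
    (CensoredSubsampling.V0 f (CensoredSubsampling.obsLaw f θ₀ G) θ₀ Λ₁ γ).PosDef ∧
    TendstoInDistribution
      (fun n ω => Real.sqrt (r n) •
        Matrix.toEuclideanLin (CensoredSubsampling.invSqrt
          (CensoredSubsampling.V0 f (CensoredSubsampling.obsLaw f θ₀ G) θ₀ Λ₁ γ))
          (θtilde n ω - θ₀))
      atTop (id : CensoredSubsampling.Param d → CensoredSubsampling.Param d) (fun _ => P)
      (stdGaussian (CensoredSubsampling.Param d)) := by
  -- Conditioning on a null event would give the zero measure; that is excluded because the law of a
  -- record is an image of `P`.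
  have hQ : IsProbabilityMeasure (CensoredSubsampling.obsLaw f θ₀ G) :=
    hx_law 0 ▸ Measure.isProbabilityMeasure_map (hx_meas 0).aemeasurable
  have hθ₀ : θ₀ ∈ Θ := interior_subset hmodel.mem_interior
  have hΛ' : ∀ j k, Tendsto (fun q : ℕ × Ω => CensoredSubsampling.LambdaG f q.1
      (fun i => π q.1 i q.2) (fun i => x i q.2) θ₀ j k)
      (CensoredSubsampling.probFilter P) (𝓝 (Λ₁ j k)) := by
    intro j k
    have h := CensoredSubsampling.tendstoInMeasure_const_iff.1 (hΛ j k)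
    exact h
  obtain ⟨ψ, D, hm⟩ := CensoredSubsampling.exists_isSmoothModel hmodel hmoments.memLp_two
    hscore.memLp_two hhess.memLp_two hhess.lipschitz
  have hmax : ∀ θ ∈ Θ, ∫ z, CensoredSubsampling.logLik f z θ ∂(CensoredSubsampling.obsLaw f θ₀ G) ≤
      ∫ z, CensoredSubsampling.logLik f z θ₀ ∂(CensoredSubsampling.obsLaw f θ₀ G) := fun θ hθ =>
    CensoredSubsampling.integral_logLik_le hmodel hmoments hθ
  obtain ⟨g, hgm, hgQ, hg⟩ := CensoredSubsampling.exists_measurable_score hx_meas hx_law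
    (hm.memLp_score θ₀ hθ₀)
  have hgL : ∀ k, MemLp (g k) 2 (CensoredSubsampling.obsLaw f θ₀ G) := fun k =>
    (hm.memLp_score_apply hθ₀ k).ae_eq (hgQ.mono fun z hz => hz k)
  -- The score is centred because `θ₀` is an interior maximizer of the expected log-likelihood; no
  -- density is differentiated under its normalization.
  have hg0 : ∀ k, ∫ z, g k z ∂(CensoredSubsampling.obsLaw f θ₀ G) = 0 := by
    intro k
    rw [← hm.integral_inner_score_eq_zero hmodel.mem_interior hmax (EuclideanSpace.single k 1)]
    refine integral_congr_ae (hgQ.mono fun z hz => ?_)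
    simp only
    rw [← hz k, CensoredSubsampling.score_apply]
  have hA : (Λ₁ + γ • CensoredSubsampling.Lambda f (CensoredSubsampling.obsLaw f θ₀ G) θ₀).PosDef :=
    CensoredSubsampling.posDef_add_smul_Lambda hsub hx_meas hx_indep hx_law hγ hgm hgL hgQ hg hΛ'
      (hscore.posDef θ₀ hθ₀)
  have hM := hhess.posDef θ₀ hθ₀
  have hV : (CensoredSubsampling.V0 f (CensoredSubsampling.obsLaw f θ₀ G) θ₀ Λ₁ γ).PosDef :=
    CensoredSubsampling.posDef_inv_mul_mul_inv hM hA
  refine ⟨hV, ?_⟩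
  have hMu : IsUnit (CensoredSubsampling.meanHess f (CensoredSubsampling.obsLaw f θ₀ G) θ₀) := by
    simpa using hM.isUnit.neg
  have hMN := Matrix.mul_nonsing_inv
    (CensoredSubsampling.meanHess f (CensoredSubsampling.obsLaw f θ₀ G) θ₀)
    ((Matrix.isUnit_iff_isUnit_det _).1 hMu)
  have hLLN : ∀ h : CensoredSubsampling.Obs → ℝ, MemLp h 2 (CensoredSubsampling.obsLaw f θ₀ G) →
      Tendsto (fun q : ℕ × Ω => CensoredSubsampling.subAvg x r π a h q.1 q.2)
        (CensoredSubsampling.probFilter P)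
        (𝓝 (∫ z, h z ∂(CensoredSubsampling.obsLaw f θ₀ G))) := fun h hh =>
    hsub.tendsto_subAvg hx_meas hπ hr hx_indep hx_law hh
  have hreg := CensoredSubsampling.eventually_isRegularSample hm hsub hx_meas hx_law hθtilde
  have hcons := CensoredSubsampling.tendsto_estimator hm hmodel.isCompact
    (fun θ hθ hne => hm.integral_logLik_lt hmax hhess.posDef hθ hne) hLLN hreg
  have hrep := CensoredSubsampling.tendsto_sqrt_mul_estimator_add hm hmodel.mem_interior hLLN hreg
    hcons hMN hg fun k => hsub.boundedInProb_sqrt_mul_subAvg hx_meas hπ hr hx_indep hx_law (hgm k)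
      (hgL k) (hg0 k) hγ
  refine CensoredSubsampling.tendstoInDistribution_stdGaussian hθtilde_meas fun t => ?_
  -- In the direction `c = V^{-1/2} t` and with `N = M⁻¹`, the limiting quadratic form collapses to
  -- `‖t‖²`.
  have hchar := CensoredSubsampling.tendsto_integral_exp_estimator hsub hx_meas hπ hr hx_indep
    hx_law hγ hgm hgL hg0 hgQ hg hΛ' hθtilde_meas hrep (CensoredSubsampling.invSqrt
      (CensoredSubsampling.V0 f (CensoredSubsampling.obsLaw f θ₀ G) θ₀ Λ₁ γ) *ᵥ t)
  rw [CensoredSubsampling.V0, CensoredSubsampling.dotProduct_standardized_eq_norm_sq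
    (by simpa using hM.isHermitian.neg) hV] at hchar
  rwa [CensoredSubsampling.invSqrt_transpose]
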